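/- Graphs are finite and may have parallel edges. A \emph{2T-graph} is a graph $G=(V,E)$ whose edge set is the union of two edge-disjoint spanning trees. For an ordering $\prec$ of $V$, let $D_\prec$ be the acyclic orientation of $G$ in which each edge $uv$ with $u\prec v$ is oriented from $u$ to $v$. The ordering $\prec$ is \emph{good} if $D_\prec$ contains an out-branching and an in-branching that are arc-disjoint, and $G$ is \emph{good} if it has a good ordering. A loopless graph $H=(V_H,E_H)$ is a \emph{generic circuit} if $|E_H|=2|V_H|-2>0$ and $|E(H[X])|\le 2|X|-3$ for every $X\subset V_H$ with $2\le |X|\le |V_H|-1$. A \emph{circuit of} $G$ is an induced subgraph of $G$ which is a generic circuit. Two circuits of $G$ are \emph{connected} if their vertex sets lie in the same connected component of the hypergraph on $V$ whose hyperedges are the vertex sets of the circuits of $G$. A \emph{generic component} of $G$ is either a single vertex lying in no circuit of $G$ or the union of a maximal non-empty set of pairwise connected circuits of $G$; it is \emph{trivial} if it has only one vertex, and \emph{non-trivial} otherwise. A generic component is a \emph{hyperpath} if its circuits can be listed without repetition as $G_1,\dots,G_k$ ($k\ge 1$) so that for all distinct $i,j$, $G_i$ and $G_j$ have a common vertex if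 and only if $|i-j|=1$. The graph $G$ is \emph{linear} if each of its non-trivial generic components is a hyperpath. \textbf{Proposition.} Let $G$ be a 2T-graph. \begin{enumerate} \item If $G$ has a good ordering, then $G$ is linear. \item Suppose that $G$ has exactly one generic component $K$ and that $K$ is non-trivial. Then $G$ has a good ordering if and only if $K$ is a hyperpath; equivalently, if and only if $G$ is linear. \end{enumerate} -/

import Mathlib

open scoped Graph

namespace Graph

variable {α β W : Type*}

/-! ### 2T-graphs

Graphs are multigraphs (`Graph α β`): parallel edges are allowed. -/

/-- `G` is connected: it has a vertex and any two vertices are joined by a walk. -/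
def IsConnected (G : Graph α β) : Prop :=
  V(G).Nonempty ∧ ∀ x ∈ V(G), ∀ y ∈ V(G), Relation.ReflTransGen G.Adj x y

/-- `G` has no cycle (in particular no loops and no parallel edges): deleting any edge
separates its ends. -/
def IsForest (G : Graph α β) : Prop :=
  ∀ e x y, G.IsLink e x y → ¬ Relation.ReflTransGen (G.deleteEdges {e}).Adj x y

/-- A tree is a connected graph without cycles. -/
def IsTree (G : Graph α β) : Prop := G.IsConnected ∧ G.IsForest

/-- `G` is a 2T-graph: its edge set is the union of two edge-disjoint spanning trees. -/
def IsTwoTGraph (G : Graph α β) : Prop :=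
  ∃ T₁ T₂ : Graph α β, T₁ ≤s G ∧ T₂ ≤s G ∧ T₁.IsTree ∧ T₂.IsTree ∧
    Disjoint E(T₁) E(T₂) ∧ E(T₁) ∪ E(T₂) = E(G)

/-! ### Good orderings

A digraph with vertex type `W` and arcs named in `β` is given by a predicate
`D e u v`: the arc `e` goes from `u` to `v`. -/

/-- The arc set `B` is (the arc set of) an out-branching of the digraph `D` with root `s`:
`s` has no entering arc, every other vertex has precisely one entering arc, and
every vertex is reached from `s`. -/
structure IsOutBranching (D : β → W → W → Prop) (B : Set β) (s : W) : Prop where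
  isArc : ∀ e ∈ B, ∃ u v, D e u v
  root : ∀ e ∈ B, ∀ u, ¬ D e u s
  entering : ∀ v, v ≠ s → ∃! e, e ∈ B ∧ ∃ u, D e u v
  reachable : ∀ v, Relation.ReflTransGen (fun u w => ∃ e ∈ B, D e u w) s v

/-- The arc set `B` is (the arc set of) an in-branching of the digraph `D` with root `t`:
`t` has no leaving arc, every other vertex has precisely one leaving arc, and
`t` is reached from every vertex. -/
structure IsInBranching (D : β → W → W → Prop) (B : Set β) (t : W) : Prop where
  isArc : ∀ e ∈ B, ∃ u v, D e u v
  root : ∀ e ∈ B, ∀ v, ¬ D e t v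
  leaving : ∀ u, u ≠ t → ∃! e, e ∈ B ∧ ∃ v, D e u v
  reachable : ∀ u, Relation.ReflTransGen (fun v w => ∃ e ∈ B, D e v w) u t

/-- The orientation of `G` given by an ordering `prec` of its vertices: every edge goes from
its smaller to its larger end. -/
def orient (G : Graph α β) (prec : V(G) → V(G) → Prop) : β → V(G) → V(G) → Prop :=
  fun e u v => G.IsLink e u v ∧ prec u v

/-- The vertex ordering `prec` of `G` is good: the orientation of `G` it gives contains
an out-branching and an in-branching that are arc-disjoint. -/
def IsGoodOrdering (G : Graph α β) (prec : V(G) → V(G) → Prop) : Prop :=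
  IsStrictTotalOrder V(G) prec ∧
    ∃ (Bout Bin : Set β) (s t : V(G)), IsOutBranching (G.orient prec) Bout s ∧
      IsInBranching (G.orient prec) Bin t ∧ Disjoint Bout Bin

/-- `G` is good: it has a good ordering. -/
def IsGood (G : Graph α β) : Prop := ∃ prec : V(G) → V(G) → Prop, G.IsGoodOrdering prec

/-! ### Generic circuits and generic components -/

/-- `G` is a generic circuit: a loopless graph with `|E| = 2|V| - 2 > 0` in which
every vertex set `X ⊂ V` with `2 ≤ |X| ≤ |V| - 1` spans at most `2|X| - 3` edges. -/
def IsGenericCircuit (G : Graph α β) : Prop :=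
  G.Loopless ∧ V(G).Finite ∧ E(G).Finite ∧
    (E(G).ncard : ℤ) = 2 * (V(G).ncard : ℤ) - 2 ∧ 0 < E(G).ncard ∧
    ∀ X : Set α, X ⊂ V(G) → 2 ≤ X.ncard →
      (E(G.induce X).ncard : ℤ) ≤ 2 * (X.ncard : ℤ) - 3

/-- `X` is the vertex set of a generic circuit of `G`, that is, of an induced subgraph of `G`
which is a generic circuit. As such subgraphs are induced, they are identified with their
vertex sets. -/
def IsCircuitOf (G : Graph α β) (X : Set α) : Prop :=
  X ⊆ V(G) ∧ (G.induce X).IsGenericCircuit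

/-- The generic circuits on `X` and `Y` are connected in the hypergraph on `V(G)` whose
hyperedges are the vertex sets of all generic circuits of `G`. -/
def CircuitsConnected (G : Graph α β) : Set α → Set α → Prop :=
  Relation.ReflTransGen fun X Y => G.IsCircuitOf X ∧ G.IsCircuitOf Y ∧ (X ∩ Y).Nonempty

/-- `K` is (the vertex set of) a generic component of `G`: either a single vertex that lies in
no generic circuit, or the union of a maximal (non-empty) set of connected generic circuits. -/
def IsGenericComponent (G : Graph α β) (K : Set α) : Prop :=
  (∃ v ∈ V(G), (∀ X, G.IsCircuitOf X → v ∉ X) ∧ K = {v}) ∨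
  ∃ S : Set (Set α),
    Maximal (fun S' : Set (Set α) => S'.Nonempty ∧ (∀ X ∈ S', G.IsCircuitOf X) ∧
      ∀ X ∈ S', ∀ Y ∈ S', G.CircuitsConnected X Y) S ∧
    K = ⋃₀ S

/-- The component `K` of `G` is a hyperpath: its circuits can be listed without repetition as
`c 0, …, c (k-1)`, `k ≥ 1`, such that two different ones have a common vertex if and only if
they are consecutive. -/
def IsHyperpath (G : Graph α β) (K : Set α) : Prop :=
  ∃ (k : ℕ) (c : Fin k → Set α), 1 ≤ k ∧ Function.Injective c ∧
    Set.range c = {X | G.IsCircuitOf X ∧ X ⊆ K} ∧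
    ∀ i j, i ≠ j → ((c i ∩ c j).Nonempty ↔ (i : ℕ) + 1 = j ∨ (j : ℕ) + 1 = i)

/-- `G` is linear: every non-trivial generic component (one with at least two vertices)
is a hyperpath. -/
def IsLinear (G : Graph α β) : Prop :=
  ∀ K, G.IsGenericComponent K → K.Nontrivial → G.IsHyperpath K

end Graph

/-! Necessity. In a good ordering the two branchings have |V| - 1 arcs each, so together they use
all 2|V| - 2 edges of a 2T-graph. A circuit X with lowest vertex a and highest vertex b spans 2|X| -
2 edges. Only the out-branching arcs entering X - a and the in-branching arcs leaving X - b can lie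
inside X, so all of them do (`Covered.mem_inside`). Distinct circuits share at most one vertex,
hence no edge; a common vertex is therefore the top of one and the bottom of the other
(`Covered.extreme_of_mem_inter`). Circuits thus behave like intervals that meet only in end points,
with distinct bottoms and distinct tops, and a connected family of these is a chain
(`exists_enumeration_of_connected`).

Sufficiency. It is enough to order a single circuit with prescribed lowest vertex s and highest
vertex t: along a hyperpath the circuits are stacked, each joint being the top of one circuit and
the bottom of the next (`PreGood.concat`). An ordering is encoded by rational positions together
with an owner for each edge. A vertex may use only edges that it owns, one leading down
(out-branching) and one leading up (in-branching), which makes the branchings arc-disjoint.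

For a single circuit the induction on |V| needs a stronger statement, `MGraph.solvable`: the owner
of an edge e at s is prescribed as well, and proper vertex sets X with 2|X| - 2 edges are tolerated
if they contain R, the set consisting of t and the ends of e. Degree counting yields a vertex v
outside R of degree 2 or 3. If the degree is 2, v is deleted and later put between its neighbours
(`Good.insert_two`). If it is 3, v is replaced by an edge between two neighbours
(`Good.insert_three`). This can fail only if all three pairs of neighbours have blocking sets X, Y,
Z, and submodularity of the induced edge count forces these to meet pairwise in single neighbours of
v, with no edge crossing between them. If some proper U spans 2|U| - 2 edges, v was chosen outside U
and a contradiction follows. Otherwise the graph is X ∪ Y ∪ Z plus v. Either it has a 2-separation,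
whose sides are completed by virtual edges, solved and glued (`Good.glue`, which is where the
prescribed owner is needed), or it is the complete graph on four vertices. -/

set_option linter.unusedSectionVars false

/-- A finite multigraph with vertex set `V` and edge set `E`, in which the edge `e` joins the
elements of `ends e`. -/
structure MGraph (α β : Type*) where
  V : Finset α
  E : Finset β
  ends : β → Finset α

/-! ### Induced edge counts and blocking sets around a vertex of degree three -/

namespace MGraph

variable {α β : Type*} [DecidableEq α]

/-- The edges with all ends in `X`. -/
def inside (G : MGraph α β) (X : Finset α) : Finset β := G.E.filter fun e => G.ends e ⊆ X

/-- The number of edges with all ends in `X`. -/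
def num (G : MGraph α β) (X : Finset α) : ℕ := (G.inside X).card

/-- `G` is loopless with `2|V| - 2` edges, every vertex set `X` with at least two elements spans
at most `2|X| - 2` edges, and at most `2|X| - 3` edges unless it contains `R`. -/
structure Tight (G : MGraph α β) (R : Finset α) : Prop where
  ends_subset : ∀ e ∈ G.E, G.ends e ⊆ G.V
  card_ends : ∀ e ∈ G.E, (G.ends e).card = 2
  card_edges : G.E.card + 2 = 2 * G.V.card
  num_le : ∀ X ⊆ G.V, 2 ≤ X.card → G.num X + 2 ≤ 2 * X.card
  num_lt : ∀ X ⊆ G.V, 2 ≤ X.card → ¬ R ⊆ X → G.num X + 3 ≤ 2 * X.card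

theorem mem_inside {G : MGraph α β} {X : Finset α} {e : β} :
    e ∈ G.inside X ↔ e ∈ G.E ∧ G.ends e ⊆ X := by simp [inside]

theorem inside_mono (G : MGraph α β) {X Y : Finset α} (h : X ⊆ Y) : G.inside X ⊆ G.inside Y := by
  intro e he
  rw [mem_inside] at *
  exact ⟨he.1, he.2.trans h⟩

section
variable [DecidableEq β]

theorem inside_inter (G : MGraph α β) (X Y : Finset α) :
    G.inside (X ∩ Y) = G.inside X ∩ G.inside Y := by
  ext e
  simp only [mem_inside, Finset.mem_inter, Finset.subset_inter_iff]
  tauto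

theorem inside_union_subset (G : MGraph α β) (X Y : Finset α) :
    G.inside X ∪ G.inside Y ⊆ G.inside (X ∪ Y) :=
  Finset.union_subset (G.inside_mono Finset.subset_union_left)
    (G.inside_mono Finset.subset_union_right)

theorem num_add_num (G : MGraph α β) (X Y : Finset α) :
    G.num X + G.num Y = (G.inside X ∪ G.inside Y).card + G.num (X ∩ Y) := by
  rw [num, num, num, inside_inter, Finset.card_union_add_card_inter]

theorem num_add_num_le (G : MGraph α β) (X Y : Finset α) :
    G.num X + G.num Y ≤ G.num (X ∪ Y) + G.num (X ∩ Y) := by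
  rw [num_add_num]
  exact Nat.add_le_add_right (Finset.card_le_card (G.inside_union_subset X Y)) _

/-- Equality in the supermodular inequality leaves no room for an edge crossing between X and Y. -/
theorem subset_or_subset_of_num_le (G : MGraph α β) {X Y : Finset α}
    (h : G.num (X ∪ Y) + G.num (X ∩ Y) ≤ G.num X + G.num Y) {e : β} (he : e ∈ G.E)
    (hs : G.ends e ⊆ X ∪ Y) : G.ends e ⊆ X ∨ G.ends e ⊆ Y := by
  have h0 := G.num_add_num X Y
  have h1 := Finset.eq_of_subset_of_card_le (G.inside_union_subset X Y)
    (by unfold num at h h0; omega)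
  have h2 : e ∈ G.inside X ∪ G.inside Y := by
    rw [h1, mem_inside]
    exact ⟨he, hs⟩
  simp only [Finset.mem_union, mem_inside] at h2
  tauto

end

namespace Tight

variable {G : MGraph α β} {R : Finset α}

theorem num_eq_zero (hG : G.Tight R) {X : Finset α} (hX : X.card ≤ 1) : G.num X = 0 := by
  rw [num, Finset.card_eq_zero, Finset.eq_empty_iff_forall_notMem]
  intro e he
  rw [mem_inside] at he
  have h1 := hG.card_ends e he.1
  have h2 := Finset.card_le_card he.2
  omega

theorem num_le' (hG : G.Tight R) {X : Finset α} (hX : X ⊆ G.V) (h : X.Nonempty) :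
    G.num X + 2 ≤ 2 * X.card := by
  rcases Nat.lt_or_ge X.card 2 with h2 | h2
  · have := hG.num_eq_zero (X := X) (by omega)
    have := h.card_pos
    omega
  · exact hG.num_le X hX h2

end Tight

/-- The vertex set `X` prevents `v` from being split off by an edge between `x` and `y`. -/
structure Blocks (G : MGraph α β) (R : Finset α) (v x y : α) (X : Finset α) : Prop where
  subset : X ⊆ G.V
  notMem : v ∉ X
  left : x ∈ X
  right : y ∈ X
  le : 2 * X.card ≤ G.num X + 2 ∨ ¬ R ⊆ X ∧ 2 * X.card ≤ G.num X + 3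

theorem Blocks.symm {G : MGraph α β} {R : Finset α} {v x y : α} {X : Finset α}
    (h : G.Blocks R v x y X) : G.Blocks R v y x X :=
  ⟨h.subset, h.notMem, h.right, h.left, h.le⟩

/-- The situation around a vertex `v` of degree three with neighbours `x`, `y`, `z`. -/
structure Claw (G : MGraph α β) (R : Finset α) (v x y z : α) : Prop where
  tight : G.Tight R
  xy : x ≠ y
  yz : y ≠ z
  xz : x ≠ z
  le : ∀ W ⊆ G.V, v ∉ W → x ∈ W → y ∈ W → z ∈ W → G.num W + 3 ≤ 2 * W.card
  lt : ∀ W ⊆ G.V, v ∉ W → x ∈ W → y ∈ W → z ∈ W → ¬ R ⊆ W → G.num W + 4 ≤ 2 * W.card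

namespace Claw

variable {G : MGraph α β} {R : Finset α} {v x y z : α} {X Y Z : Finset α}

theorem rotate (h : G.Claw R v x y z) : G.Claw R v y z x :=
  ⟨h.tight, h.yz, h.xz.symm, h.xy.symm, fun W a b c d e => h.le W a b e c d,
    fun W a b c d e => h.lt W a b e c d⟩

/-- A set with all three neighbours of v gains three edges when v is added, so its own count is one
below the usual bound, too small for blocking. -/
theorem notMem (h : G.Claw R v x y z) (hX : G.Blocks R v x y X) : z ∉ X := by
  intro hz
  have h1 := h.le X hX.subset hX.notMem hX.left hX.right hz
  have h2 := h.lt X hX.subset hX.notMem hX.left hX.right hz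
  rcases hX.le with h3 | ⟨h3, h4⟩
  · omega
  · have := h2 h3
    omega

variable [DecidableEq β]

/-- If X had 2|X| - 2 edges, then Y and Z would have to miss part of R and meet X only in y and x,
since otherwise X ∪ Y or X ∪ Z exceeds the bound of `Claw.le`. Adding Z to X ∪ Y then exceeds that
bound as well. -/
theorem not_num_add_two (h : G.Claw R v x y z) (hX : G.Blocks R v x y X)
    (hY : G.Blocks R v y z Y) (hZ : G.Blocks R v x z Z) (hc : 2 * X.card ≤ G.num X + 2) :
    False := by
  have hzX := h.notMem hX
  have hxY := h.rotate.notMem hY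
  have hyZ := h.rotate.rotate.notMem hZ.symm
  have hsub := h.tight.num_le' (X := X ∩ Y) (Finset.inter_subset_left.trans hX.subset)
    ⟨y, Finset.mem_inter.2 ⟨hX.right, hY.left⟩⟩
  have hXY := h.le (X ∪ Y) (Finset.union_subset hX.subset hY.subset)
    (by simp [hX.notMem, hY.notMem]) (by simp [hX.left]) (by simp [hX.right]) (by simp [hY.right])
  have hsm := G.num_add_num_le X Y
  have hcard := Finset.card_union_add_card_inter X Y
  rcases hY.le with hY2 | ⟨hYR, hY3⟩
  · omega
  have hone : (X ∩ Y).card < 2 := by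
    by_contra hcon
    have := h.tight.num_lt (X ∩ Y) (Finset.inter_subset_left.trans hX.subset) (by omega)
      fun h' => hYR (h'.trans Finset.inter_subset_right)
    omega
  have hyXY : X ∩ Y = {y} := by
    symm
    apply Finset.eq_of_subset_of_card_le
    · simp [hX.right, hY.left]
    · simp; omega
  have hcross := fun e => G.subset_or_subset_of_num_le (X := X) (Y := Y) (e := e) (by omega)
  rcases hZ.le with hZ2 | ⟨hZR, hZ3⟩
  · have hsub' := h.tight.num_le' (X := X ∩ Z) (Finset.inter_subset_left.trans hX.subset)
      ⟨x, Finset.mem_inter.2 ⟨hX.left, hZ.left⟩⟩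
    have hXZ := h.le (X ∪ Z) (Finset.union_subset hX.subset hZ.subset)
      (by simp [hX.notMem, hZ.notMem]) (by simp [hX.left]) (by simp [hX.right])
      (by simp [hZ.right])
    have hsm' := G.num_add_num_le X Z
    have hcard' := Finset.card_union_add_card_inter X Z
    omega
  have hxZ : (X ∩ Z).card < 2 := by
    by_contra hcon
    have := h.tight.num_lt (X ∩ Z) (Finset.inter_subset_left.trans hX.subset) (by omega)
      fun h' => hZR (h'.trans Finset.inter_subset_right)
    have hXZ := h.le (X ∪ Z) (Finset.union_subset hX.subset hZ.subset)
      (by simp [hX.notMem, hZ.notMem]) (by simp [hX.left]) (by simp [hX.right])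
      (by simp [hZ.right])
    have hsm' := G.num_add_num_le X Z
    have hcard' := Finset.card_union_add_card_inter X Z
    omega
  have hxXZ : X ∩ Z = {x} := by
    symm
    apply Finset.eq_of_subset_of_card_le
    · simp [hX.left, hZ.left]
    · simp; omega
  have hWZ : (X ∪ Y) ∩ Z = insert x (Y ∩ Z) := by
    rw [Finset.union_inter_distrib_right, hxXZ, Finset.insert_eq]
  have hins : (insert x (Y ∩ Z)).card = (Y ∩ Z).card + 1 := by
    apply Finset.card_insert_of_notMem
    simp [hxY]
  -- No edge crosses between X and Y, so x is isolated in (X ∪ Y) ∩ Z. This lowers the bound on its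
  -- edges to two below the usual one.
  have hnum : G.num ((X ∪ Y) ∩ Z) ≤ G.num (Y ∩ Z) := by
    apply Finset.card_le_card
    intro e he
    rw [mem_inside] at he ⊢
    refine ⟨he.1, ?_⟩
    rcases hcross e he.1 (he.2.trans Finset.inter_subset_left) with h1 | h1
    · have h2 : G.ends e ⊆ {x} := by
        rw [← hxXZ]
        exact Finset.subset_inter h1 (he.2.trans Finset.inter_subset_right)
      have h3 := Finset.card_le_card h2
      have h4 := h.tight.card_ends e he.1
      simp at h3
      omega
    · exact Finset.subset_inter h1 (he.2.trans Finset.inter_subset_right)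
  have hYZ := h.tight.num_le' (X := Y ∩ Z) (Finset.inter_subset_left.trans hY.subset)
    ⟨z, Finset.mem_inter.2 ⟨hY.right, hZ.right⟩⟩
  have hU := h.le (X ∪ Y ∪ Z)
    (Finset.union_subset (Finset.union_subset hX.subset hY.subset) hZ.subset)
    (by simp [hX.notMem, hY.notMem, hZ.notMem]) (by simp [hX.left]) (by simp [hX.right])
    (by simp [hY.right])
  have hsm2 := G.num_add_num_le (X ∪ Y) Z
  have hcard2 := Finset.card_union_add_card_inter (X ∪ Y) Z
  rw [hWZ] at hcard2
  omega

/-- Two blocking sets with at least two common vertices. -/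
theorem union_of_two_le_inter (h : G.Claw R v x y z) (hX : G.Blocks R v x y X)
    (hY : G.Blocks R v y z Y) (hXR : ¬ R ⊆ X) (hX3 : 2 * X.card ≤ G.num X + 3)
    (hY3 : 2 * Y.card ≤ G.num Y + 3) (hc : 2 ≤ (X ∩ Y).card) :
    R ⊆ X ∪ Y ∧ G.num (X ∪ Y) + 3 = 2 * (X ∪ Y).card ∧
      ∀ e ∈ G.E, G.ends e ⊆ X ∪ Y → G.ends e ⊆ X ∨ G.ends e ⊆ Y := by
  have h1 := h.tight.num_lt (X ∩ Y) (Finset.inter_subset_left.trans hX.subset) hc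
    fun h' => hXR (h'.trans Finset.inter_subset_left)
  have hsub : X ∪ Y ⊆ G.V := Finset.union_subset hX.subset hY.subset
  have hv : v ∉ X ∪ Y := by simp [hX.notMem, hY.notMem]
  have hx : x ∈ X ∪ Y := by simp [hX.left]
  have hy : y ∈ X ∪ Y := by simp [hX.right]
  have hz : z ∈ X ∪ Y := by simp [hY.right]
  have h2 := h.le (X ∪ Y) hsub hv hx hy hz
  have h3 := h.lt (X ∪ Y) hsub hv hx hy hz
  have hsm := G.num_add_num_le X Y
  have hcard := Finset.card_union_add_card_inter X Y
  refine ⟨?_, by omega, fun e he hs => G.subset_or_subset_of_num_le (by omega) he hs⟩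
  by_contra hR
  have := h3 hR
  omega

/-- The form of R, an edge plus one vertex, is essential: if all three pairs of blocking sets
overlapped in two vertices, e and t would each lie in two of the three sets, hence together in one.
-/
theorem inter_card_lt_two (h : G.Claw R v x y z) (hX : G.Blocks R v x y X)
    (hY : G.Blocks R v y z Y) (hZ : G.Blocks R v x z Z) (hXR : ¬ R ⊆ X) (hYR : ¬ R ⊆ Y)
    (hZR : ¬ R ⊆ Z) (hX3 : 2 * X.card ≤ G.num X + 3) (hY3 : 2 * Y.card ≤ G.num Y + 3)
    (hZ3 : 2 * Z.card ≤ G.num Z + 3) {e : β} (he : e ∈ G.E) {t : α}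
    (hR : insert t (G.ends e) = R) : (X ∩ Y).card < 2 := by
  by_contra hc
  push Not at hc
  have hzX := h.notMem hX
  have hxY := h.rotate.notMem hY
  have hyZ := h.rotate.rotate.notMem hZ.symm
  obtain ⟨h1, h2, h3⟩ := h.union_of_two_le_inter hX hY hXR hX3 hY3 hc
  -- Without a common vertex, (X ∪ Y) ∩ Z falls into two disjoint parts joined by no edge. Its edge
  -- count is then so small that X ∪ Y ∪ Z violates `Claw.le`.
  have hp : ∃ p, p ∈ X ∧ p ∈ Y ∧ p ∈ Z := by
    by_contra hcon
    have hne : (X ∩ Z) ∩ (Y ∩ Z) = ∅ := by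
      ext p
      simp only [Finset.mem_inter, Finset.notMem_empty, iff_false]
      exact fun hp => hcon ⟨p, hp.1.1, hp.2.1, hp.1.2⟩
    have hdis := Finset.card_union_add_card_inter (X ∩ Z) (Y ∩ Z)
    rw [hne, ← Finset.union_inter_distrib_right, Finset.card_empty] at hdis
    have hn : G.num ((X ∪ Y) ∩ Z) ≤ G.num (X ∩ Z) + G.num (Y ∩ Z) := by
      refine le_trans (Finset.card_le_card ?_) (Finset.card_union_le _ _)
      intro f hf
      rw [mem_inside, Finset.subset_inter_iff] at hf
      simp only [Finset.mem_union, mem_inside, Finset.subset_inter_iff]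
      rcases h3 f hf.1 hf.2.1 with h4 | h4
      · exact Or.inl ⟨hf.1, h4, hf.2.2⟩
      · exact Or.inr ⟨hf.1, h4, hf.2.2⟩
    have h5 := h.tight.num_le' (X := X ∩ Z) (Finset.inter_subset_left.trans hX.subset)
      ⟨x, Finset.mem_inter.2 ⟨hX.left, hZ.left⟩⟩
    have h6 := h.tight.num_le' (X := Y ∩ Z) (Finset.inter_subset_left.trans hY.subset)
      ⟨z, Finset.mem_inter.2 ⟨hY.right, hZ.right⟩⟩
    have hU := h.le (X ∪ Y ∪ Z)
      (Finset.union_subset (Finset.union_subset hX.subset hY.subset) hZ.subset)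
      (by simp [hX.notMem, hY.notMem, hZ.notMem]) (by simp [hX.left]) (by simp [hX.right])
      (by simp [hY.right])
    have hsm2 := G.num_add_num_le (X ∪ Y) Z
    have hcard2 := Finset.card_union_add_card_inter (X ∪ Y) Z
    omega
  obtain ⟨p, hpX, hpY, hpZ⟩ := hp
  have hXZ : 2 ≤ (Z ∩ X).card := by
    apply Finset.one_lt_card.2
    exact ⟨x, by simp [hX.left, hZ.left], p, by simp [hpX, hpZ], fun h' => hxY (h' ▸ hpY)⟩
  have hYZ : 2 ≤ (Y ∩ Z).card := by
    apply Finset.one_lt_card.2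
    exact ⟨z, by simp [hY.right, hZ.right], p, by simp [hpY, hpZ], fun h' => hzX (h' ▸ hpX)⟩
  obtain ⟨g1, -, g3⟩ := h.rotate.union_of_two_le_inter hY hZ.symm hYR hY3 hZ3 hYZ
  obtain ⟨k1, -, k3⟩ := h.rotate.rotate.union_of_two_le_inter hZ.symm hX hZR hZ3 hX3 hXZ
  subst hR
  rw [Finset.insert_subset_iff, Finset.mem_union] at h1 g1 k1
  rw [Finset.insert_subset_iff] at hXR hYR hZR
  have c1 := h3 e he h1.2
  have c2 := g3 e he g1.2
  have c3 := k3 e he k1.2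
  have d1 := h1.1
  have d2 := g1.1
  have d3 := k1.1
  -- Pigeonhole: each pair of sets has a member containing e and a member containing t, so some set
  -- contains all of R.
  clear h1 h2 h3 g1 g3 k1 k3 hX hY hZ hX3 hY3 hZ3 h hXZ hYZ hc
  tauto

/-- The union has |X| + |Y| + |Z| - 3 vertices and the three edge sets are disjoint. The bounds
therefore add up to 2|X ∪ Y ∪ Z| - 3, which is extremal for `Claw.le` and excluded by `Claw.lt`
unless R is covered. -/
theorem union_of_inter_card_lt_two (h : G.Claw R v x y z) (hX : G.Blocks R v x y X)
    (hY : G.Blocks R v y z Y) (hZ : G.Blocks R v x z Z)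
    (hX3 : 2 * X.card ≤ G.num X + 3) (hY3 : 2 * Y.card ≤ G.num Y + 3)
    (hZ3 : 2 * Z.card ≤ G.num Z + 3) (hXY : (X ∩ Y).card < 2) (hYZ : (Y ∩ Z).card < 2)
    (hXZ : (X ∩ Z).card < 2) :
    R ⊆ X ∪ Y ∪ Z ∧ G.num (X ∪ Y ∪ Z) + 3 = 2 * (X ∪ Y ∪ Z).card ∧
      (∀ e ∈ G.E, G.ends e ⊆ X ∪ Y ∪ Z → G.ends e ⊆ X ∨ G.ends e ⊆ Y ∨ G.ends e ⊆ Z) ∧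
      X ∩ Y = {y} ∧ Y ∩ Z = {z} ∧ X ∩ Z = {x} := by
  have hzX := h.notMem hX
  have hxY := h.rotate.notMem hY
  have hyZ := h.rotate.rotate.notMem hZ.symm
  have eXY : X ∩ Y = {y} := by
    symm
    apply Finset.eq_of_subset_of_card_le
    · simp [hX.right, hY.left]
    · simp; omega
  have eYZ : Y ∩ Z = {z} := by
    symm
    apply Finset.eq_of_subset_of_card_le
    · simp [hY.right, hZ.right]
    · simp; omega
  have eXZ : X ∩ Z = {x} := by
    symm
    apply Finset.eq_of_subset_of_card_le
    · simp [hX.left, hZ.left]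
    · simp; omega
  have hcXY := Finset.card_union_add_card_inter X Y
  have hc := Finset.card_union_add_card_inter (X ∪ Y) Z
  rw [Finset.union_inter_distrib_right, eXZ, eYZ, ← Finset.insert_eq, Finset.card_pair h.xz] at hc
  rw [eXY, Finset.card_singleton] at hcXY
  have nXY := G.num_add_num X Y
  have hsub : G.inside X ∪ G.inside Y ∪ G.inside Z ⊆ G.inside (X ∪ Y ∪ Z) :=
    (Finset.union_subset_union_left (G.inside_union_subset X Y)).trans
      (G.inside_union_subset (X ∪ Y) Z)
  have hdis : (G.inside X ∪ G.inside Y) ∩ G.inside Z = ∅ := by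
    rw [Finset.union_inter_distrib_right, ← inside_inter, ← inside_inter, eXZ, eYZ]
    have a1 := h.tight.num_eq_zero (X := {x}) (by simp)
    have a2 := h.tight.num_eq_zero (X := {z}) (by simp)
    rw [num, Finset.card_eq_zero] at a1 a2
    simp [a1, a2]
  have nU := Finset.card_union_add_card_inter (G.inside X ∪ G.inside Y) (G.inside Z)
  rw [hdis, Finset.card_empty] at nU
  have a1 := h.tight.num_eq_zero (X := X ∩ Y) (by omega)
  have hle := Finset.card_le_card hsub
  have hWV : X ∪ Y ∪ Z ⊆ G.V :=
    Finset.union_subset (Finset.union_subset hX.subset hY.subset) hZ.subset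
  have hvW : v ∉ X ∪ Y ∪ Z := by simp [hX.notMem, hY.notMem, hZ.notMem]
  have hxW : x ∈ X ∪ Y ∪ Z := by simp [hX.left]
  have hyW : y ∈ X ∪ Y ∪ Z := by simp [hX.right]
  have hzW : z ∈ X ∪ Y ∪ Z := by simp [hY.right]
  have hU := h.le _ hWV hvW hxW hyW hzW
  have hU4 := h.lt _ hWV hvW hxW hyW hzW
  unfold num at *
  refine ⟨?_, by omega, ?_, eXY, eYZ, eXZ⟩
  · by_contra hR
    have := hU4 hR
    omega
  · intro e he hs
    have heq := Finset.eq_of_subset_of_card_le hsub (by omega)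
    have h2 : e ∈ G.inside X ∪ G.inside Y ∪ G.inside Z := by
      rw [heq, mem_inside]
      exact ⟨he, hs⟩
    simp only [Finset.mem_union, mem_inside] at h2
    tauto

end Claw

end MGraph

/-! ### Orderings with edge owners: insertion of a vertex and gluing -/

namespace MGraph

variable {α β : Type*} [DecidableEq α]

/-- The vertex positions `pos` and the owners `own` of the edges are such that every vertex other
than `s` owns an edge to a lower vertex and every vertex other than `t` owns an edge to a higher
vertex. -/
structure PreGood (G : MGraph α β) (s t : α) (pos : α → ℚ) (own : β → α) : Prop where
  down : ∀ v ∈ G.V, v ≠ s →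
    ∃ e ∈ G.E, own e = v ∧ ∃ u ∈ G.V, G.ends e = {v, u} ∧ pos u < pos v
  up : ∀ v ∈ G.V, v ≠ t →
    ∃ e ∈ G.E, own e = v ∧ ∃ u ∈ G.V, G.ends e = {v, u} ∧ pos v < pos u

/-- A `PreGood` pair whose positions are pairwise different. -/
structure Good (G : MGraph α β) (s t : α) (pos : α → ℚ) (own : β → α) : Prop
    extends G.PreGood s t pos own where
  inj : Set.InjOn pos G.V

/-- Ties are broken lexicographically by an enumeration of V; the countable order so obtained embeds
in the rationals. Constructions may thus ignore coincidences of positions. -/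
theorem exists_injOn_of_lt (V : Finset α) (pos : α → ℚ) :
    ∃ pos' : α → ℚ, Set.InjOn pos' V ∧ ∀ u ∈ V, ∀ v ∈ V, pos u < pos v → pos' u < pos' v := by
  have : Countable (ℚ ×ₗ ℕ) := inferInstanceAs (Countable (ℚ × ℕ))
  obtain ⟨φ⟩ := Order.embedding_from_countable_to_dense (α := ℚ ×ₗ ℕ) (β := ℚ)
  refine ⟨fun v => φ (toLex (pos v, V.toList.idxOf v)), ?_, ?_⟩
  · intro u hu v hv h
    have h1 := φ.injective h
    have h2 : V.toList.idxOf u = V.toList.idxOf v := congrArg (fun p => (ofLex p).2) h1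
    exact (List.idxOf_inj (Finset.mem_toList.2 hu)).1 h2
  · intro u _ v _ h
    exact φ.strictMono (Prod.Lex.toLex_lt_toLex.2 (Or.inl h))

theorem PreGood.exists_good {G : MGraph α β} {s t : α} {pos : α → ℚ} {own : β → α}
    (h : G.PreGood s t pos own) : ∃ pos', G.Good s t pos' own := by
  obtain ⟨pos', hinj, hlt⟩ := exists_injOn_of_lt G.V pos
  refine ⟨pos', ⟨fun v hv hs => ?_, fun v hv ht => ?_⟩, hinj⟩
  · obtain ⟨e, he, ho, u, hu, hen, hl⟩ := h.down v hv hs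
    exact ⟨e, he, ho, u, hu, hen, hlt u hu v hv hl⟩
  · obtain ⟨e, he, ho, u, hu, hen, hl⟩ := h.up v hv ht
    exact ⟨e, he, ho, u, hu, hen, hlt v hv u hu hl⟩

/-- A vertex of minimal position has no edge leading down, so it must be s. -/
theorem PreGood.source_lt {G : MGraph α β} {s t : α} {pos : α → ℚ} {own : β → α}
    (h : G.PreGood s t pos own) {v : α} (hv : v ∈ G.V) (hvs : v ≠ s) : pos s < pos v := by
  obtain ⟨m, hm, hmin⟩ := G.V.exists_min_image pos ⟨v, hv⟩
  have key : ∀ w ∈ G.V, w ≠ s → pos m < pos w := by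
    intro w hw hws
    obtain ⟨e, -, -, u, hu, -, hl⟩ := h.down w hw hws
    exact (hmin u hu).trans_lt hl
  by_cases hms : m = s
  · exact hms ▸ key v hv hvs
  · exact absurd (key m hm hms) (lt_irrefl _)

theorem PreGood.lt_sink {G : MGraph α β} {s t : α} {pos : α → ℚ} {own : β → α}
    (h : G.PreGood s t pos own) {v : α} (hv : v ∈ G.V) (hvt : v ≠ t) : pos v < pos t := by
  obtain ⟨m, hm, hmax⟩ := G.V.exists_max_image pos ⟨v, hv⟩
  have key : ∀ w ∈ G.V, w ≠ t → pos w < pos m := by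
    intro w hw hwt
    obtain ⟨e, -, -, u, hu, -, hl⟩ := h.up w hw hwt
    exact hl.trans_le (hmax u hu)
  by_cases hmt : m = t
  · exact hmt ▸ key v hv hvt
  · exact absurd (key m hm hmt) (lt_irrefl _)

theorem pair_cases {a b c d : α} (h : ({a, b} : Finset α) = {c, d}) (hcd : c ≠ d) :
    (a = c ∧ b = d) ∨ (a = d ∧ b = c) := by
  have h1 : c ∈ ({a, b} : Finset α) := by simp [h]
  have h2 : d ∈ ({a, b} : Finset α) := by simp [h]
  have h3 : a ∈ ({c, d} : Finset α) := by simp [← h]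
  have h4 : b ∈ ({c, d} : Finset α) := by simp [← h]
  simp only [Finset.mem_insert, Finset.mem_singleton] at h1 h2 h3 h4
  grind

/-- Placed strictly between x and y, the vertex v owns one edge down and one edge up; nothing else
changes. -/
theorem Good.insert_two {G H : MGraph α β} {s t v x y : α} {e₁ e₂ : β} {pos : α → ℚ}
    {own : β → α} (h : H.Good s t pos own) (hV : ∀ u, u ∈ G.V ↔ u = v ∨ u ∈ H.V)
    (hv : v ∉ H.V) (hE : ∀ e ∈ H.E, e ∈ G.E ∧ v ∉ G.ends e ∧ H.ends e = G.ends e)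
    (hx : x ∈ H.V) (hy : y ∈ H.V) (hxy : x ≠ y) (he₁ : e₁ ∈ G.E) (he₂ : e₂ ∈ G.E)
    (hn₁ : G.ends e₁ = {v, x}) (hn₂ : G.ends e₂ = {v, y}) :
    ∃ pos' own', G.Good s t pos' own' ∧ ∀ e, v ∉ G.ends e → own' e = own e := by
  have hne : pos x ≠ pos y := fun h' => hxy (h.inj hx hy h')
  obtain ⟨p, hp⟩ : ∃ p, (pos x < p ∧ p < pos y) ∨ (pos y < p ∧ p < pos x) := by
    rcases hne.lt_or_gt with h1 | h1
    · obtain ⟨p, hp⟩ := exists_between h1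
      exact ⟨p, Or.inl hp⟩
    · obtain ⟨p, hp⟩ := exists_between h1
      exact ⟨p, Or.inr hp⟩
  have hpos : ∀ u ∈ H.V, Function.update pos v p u = pos u := fun u hu =>
    Function.update_of_ne (fun h' : u = v => hv (h' ▸ hu)) _ _
  have key : G.PreGood s t (Function.update pos v p)
      (fun e => if v ∈ G.ends e then v else own e) := by
    constructor
    · intro u hu hus
      rcases (hV u).1 hu with rfl | hu
      · rcases hp with hp | hp
        · exact ⟨e₁, he₁, by simp [hn₁], x, (hV x).2 (Or.inr hx), hn₁, by
            rw [hpos x hx, Function.update_self]; exact hp.1⟩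
        · exact ⟨e₂, he₂, by simp [hn₂], y, (hV y).2 (Or.inr hy), hn₂, by
            rw [hpos y hy, Function.update_self]; exact hp.1⟩
      · obtain ⟨e, he, ho, w, hw, hen, hl⟩ := h.down u hu hus
        obtain ⟨k1, k2, k3⟩ := hE e he
        exact ⟨e, k1, by simp [k2, ho], w, (hV w).2 (Or.inr hw), k3 ▸ hen, by
          rwa [hpos w hw, hpos u hu]⟩
    · intro u hu hus
      rcases (hV u).1 hu with rfl | hu
      · rcases hp with hp | hp
        · exact ⟨e₂, he₂, by simp [hn₂], y, (hV y).2 (Or.inr hy), hn₂, by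
            rw [hpos y hy, Function.update_self]; exact hp.2⟩
        · exact ⟨e₁, he₁, by simp [hn₁], x, (hV x).2 (Or.inr hx), hn₁, by
            rw [hpos x hx, Function.update_self]; exact hp.2⟩
      · obtain ⟨e, he, ho, w, hw, hen, hl⟩ := h.up u hu hus
        obtain ⟨k1, k2, k3⟩ := hE e he
        exact ⟨e, k1, by simp [k2, ho], w, (hV w).2 (Or.inr hw), k3 ▸ hen, by
          rwa [hpos w hw, hpos u hu]⟩
  obtain ⟨pos', hpos'⟩ := key.exists_good
  exact ⟨pos', _, hpos', fun e he => if_neg he⟩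

theorem exists_between_same_side {a c z : ℚ} (hac : c ≠ a) (haz : z ≠ a) :
    ∃ p, ((a < p ∧ p < z) ∨ (z < p ∧ p < a)) ∧ (a < c → p < c) ∧ (c < a → c < p) := by
  rcases haz.lt_or_gt with h1 | h1 <;> rcases hac.lt_or_gt with h2 | h2
  · obtain ⟨p, hp1, hp2⟩ := exists_between (max_lt h1 h2)
    rw [max_lt_iff] at hp1
    exact ⟨p, Or.inr ⟨hp1.1, hp2⟩, fun h => absurd h h2.not_gt, fun _ => hp1.2⟩
  · obtain ⟨p, hp1, hp2⟩ := exists_between h1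
    exact ⟨p, Or.inr ⟨hp1, hp2⟩, fun h => hp2.trans h, fun h => absurd h h2.not_gt⟩
  · obtain ⟨p, hp1, hp2⟩ := exists_between h1
    exact ⟨p, Or.inl ⟨hp1, hp2⟩, fun h => absurd h h2.not_gt, fun h => h.trans hp1⟩
  · obtain ⟨p, hp1, hp2⟩ := exists_between (lt_min h1 h2)
    rw [lt_min_iff] at hp2
    exact ⟨p, Or.inl ⟨hp1, hp2.1⟩, fun _ => hp2.2, fun h => absurd h h2.not_gt⟩

/-- The edge `e₀` between c and a is useless for a, as a does not own it. If v lies between a and z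
and so close to a that c sees both on the same side, the edge from c to v takes over the role of
`e₀` for c, while v uses its edges to a and z. -/
theorem Good.insert_three [DecidableEq β] {G H : MGraph α β} {s t v a c z : α}
    {e₀ ea ec ez : β} {pos : α → ℚ} {own : β → α} (h : H.Good s t pos own)
    (hV : ∀ u, u ∈ G.V ↔ u = v ∨ u ∈ H.V) (hv : v ∉ H.V)
    (hE : ∀ e ∈ H.E, e = e₀ ∨ (e ∈ G.E ∧ v ∉ G.ends e ∧ H.ends e = G.ends e))
    (ha : a ∈ H.V) (hc : c ∈ H.V) (hz : z ∈ H.V) (hac : c ≠ a) (haz : z ≠ a) (hcz : c ≠ z)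
    (hea : ea ∈ G.E) (hec : ec ∈ G.E) (hez : ez ∈ G.E) (hna : G.ends ea = {v, a})
    (hnc : G.ends ec = {v, c}) (hnz : G.ends ez = {v, z}) (h₀ : H.ends e₀ = {c, a})
    (ho₀ : own e₀ ≠ a) :
    ∃ pos' own', G.Good s t pos' own' ∧ ∀ e, v ∉ G.ends e → own' e = own e := by
  have hva : v ≠ a := fun h' => hv (h' ▸ ha)
  have hvc : v ≠ c := fun h' => hv (h' ▸ hc)
  have hvz : v ≠ z := fun h' => hv (h' ▸ hz)
  have hae : ea ≠ ec := by
    rintro rfl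
    rcases pair_cases (hna.symm.trans hnc) hvc with h' | h'
    · exact hac h'.2.symm
    · exact hvc h'.1
  have hze : ez ≠ ec := by
    rintro rfl
    rcases pair_cases (hnz.symm.trans hnc) hvc with h' | h'
    · exact hcz h'.2.symm
    · exact hvc h'.1
  obtain ⟨p, hp, hp1, hp2⟩ := exists_between_same_side (a := pos a) (c := pos c) (z := pos z)
    (fun h' => hac (h.inj hc ha h')) (fun h' => haz (h.inj hz ha h'))
  have hpos : ∀ u ∈ H.V, Function.update pos v p u = pos u := fun u hu =>
    Function.update_of_ne (fun h' : u = v => hv (h' ▸ hu)) _ _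
  have key : G.PreGood s t (Function.update pos v p)
      (fun e => if v ∈ G.ends e then (if e = ec then c else v) else own e) := by
    constructor
    · intro u hu hus
      rcases (hV u).1 hu with rfl | hu
      · rcases hp with hp | hp
        · exact ⟨ea, hea, by simp [hna, hae], a, (hV a).2 (Or.inr ha), hna, by
            rw [hpos a ha, Function.update_self]; exact hp.1⟩
        · exact ⟨ez, hez, by simp [hnz, hze], z, (hV z).2 (Or.inr hz), hnz, by
            rw [hpos z hz, Function.update_self]; exact hp.1⟩
      · obtain ⟨e, he, ho, w, hw, hen, hl⟩ := h.down u hu hus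
        rcases hE e he with rfl | ⟨k1, k2, k3⟩
        · rcases pair_cases (hen.symm.trans h₀) hac with ⟨rfl, rfl⟩ | ⟨rfl, rfl⟩
          · exact ⟨ec, hec, by simp [hnc], v, (hV v).2 (Or.inl rfl), by
              rw [hnc, Finset.pair_comm], by
              rw [hpos u hc, Function.update_self]; exact hp1 hl⟩
          · exact absurd ho ho₀
        · exact ⟨e, k1, by simp [k2, ho], w, (hV w).2 (Or.inr hw), k3 ▸ hen, by
            rwa [hpos w hw, hpos u hu]⟩
    · intro u hu hus
      rcases (hV u).1 hu with rfl | hu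
      · rcases hp with hp | hp
        · exact ⟨ez, hez, by simp [hnz, hze], z, (hV z).2 (Or.inr hz), hnz, by
            rw [hpos z hz, Function.update_self]; exact hp.2⟩
        · exact ⟨ea, hea, by simp [hna, hae], a, (hV a).2 (Or.inr ha), hna, by
            rw [hpos a ha, Function.update_self]; exact hp.2⟩
      · obtain ⟨e, he, ho, w, hw, hen, hl⟩ := h.up u hu hus
        rcases hE e he with rfl | ⟨k1, k2, k3⟩
        · rcases pair_cases (hen.symm.trans h₀) hac with ⟨rfl, rfl⟩ | ⟨rfl, rfl⟩
          · exact ⟨ec, hec, by simp [hnc], v, (hV v).2 (Or.inl rfl), by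
              rw [hnc, Finset.pair_comm], by
              rw [hpos u hc, Function.update_self]; exact hp2 hl⟩
          · exact absurd ho ho₀
        · exact ⟨e, k1, by simp [k2, ho], w, (hV w).2 (Or.inr hw), k3 ▸ hen, by
            rwa [hpos w hw, hpos u hu]⟩
  obtain ⟨pos', hpos'⟩ := key.exists_good
  exact ⟨pos', _, hpos', fun e he => if_neg he⟩

/-- The virtual edge ab may be used in A by one of its ends. Its copy in B is owned by the other
end, so the first finds a genuine edge in B for the same purpose. No edge down is needed from B at
a, its lowest vertex, since A supplies one unless a = s. The alternatives in `ht` say whether b gets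
its edge up from A or, when b is the top of A, from B. -/
theorem Good.glue {G A B : MGraph α β} {s t tA tB a b : α} {f h : β} {posA posB : α → ℚ}
    {ownA ownB : β → α} (hA : A.Good s tA posA ownA) (hB : B.Good a tB posB ownB)
    (hab : posA a < posA b) (hown : ownB h = if ownA f = a then b else a)
    (hV : ∀ u, u ∈ G.V ↔ u ∈ A.V ∨ u ∈ B.V) (hAB : ∀ u ∈ A.V, u ∈ B.V → u = a ∨ u = b)
    (haA : a ∈ A.V) (haB : a ∈ B.V) (hbA : b ∈ A.V) (hbB : b ∈ B.V)
    (hf : A.ends f = {a, b}) (hh : B.ends h = {a, b})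
    (hEA : ∀ e ∈ A.E, e = f ∨ (e ∈ G.E ∧ G.ends e ⊆ A.V ∧ A.ends e = G.ends e))
    (hEB : ∀ e ∈ B.E, e = h ∨ (e ∈ G.E ∧ G.ends e ⊆ B.V ∧ B.ends e = G.ends e))
    (hE : ∀ e ∈ G.E, G.ends e ⊆ A.V → ¬ G.ends e ⊆ B.V)
    (ht : (tA = t ∧ tB = b) ∨ (tA = b ∧ tB = t ∧ t ∉ A.V)) :
    ∃ pos own, G.Good s t pos own ∧ ∀ e, G.ends e ⊆ A.V → own e = ownA e := by
  classical
  have hne : a ≠ b := fun h' => (h' ▸ hab).false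
  have habB : posB a < posB b := hB.source_lt hbB hne.symm
  -- Affine rescaling of B which makes both positions of a and both positions of b agree; k > 0
  -- keeps the order.
  set k := (posA b - posA a) / (posB b - posB a) with hk
  have hk0 : 0 < k := div_pos (sub_pos.2 hab) (sub_pos.2 habB)
  have hkb : posA a + (posB b - posB a) * k = posA b := by
    rw [hk, mul_div_cancel₀ _ (sub_pos.2 habB).ne']
    ring
  set pos : α → ℚ := fun u => if u ∈ A.V then posA u else posA a + (posB u - posB a) * k with hpos
  have hpA : ∀ u ∈ A.V, pos u = posA u := fun u hu => if_pos hu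
  have hpB : ∀ u ∈ B.V, pos u = posA a + (posB u - posB a) * k := by
    intro u hu
    by_cases huA : u ∈ A.V
    · rw [hpA u huA]
      rcases hAB u huA hu with rfl | rfl
      · simp
      · exact hkb.symm
    · exact if_neg huA
  have hlt : ∀ u ∈ B.V, ∀ w ∈ B.V, posB u < posB w → pos u < pos w := by
    intro u hu w hw huw
    rw [hpB u hu, hpB w hw]
    have := mul_lt_mul_of_pos_right (sub_lt_sub_right huw (posB a)) hk0
    linarith
  set own : β → α := fun e => if G.ends e ⊆ A.V then ownA e else ownB e with hodef
  have hoB : ∀ e ∈ G.E, G.ends e ⊆ B.V → own e = ownB e := fun e he hs =>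
    if_neg fun h' => hE e he h' hs
  have downB : ∀ u ∈ B.V, u ≠ a → ownB h ≠ u →
      ∃ e ∈ G.E, own e = u ∧ ∃ w ∈ G.V, G.ends e = {u, w} ∧ pos w < pos u := by
    intro u hu hua hhu
    obtain ⟨e, he, ho, w, hw, hen, hl⟩ := hB.down u hu hua
    rcases hEB e he with rfl | ⟨k1, k2, k3⟩
    · exact absurd ho hhu
    · exact ⟨e, k1, (hoB e k1 k2).trans ho, w, (hV w).2 (Or.inr hw), k3 ▸ hen, hlt w hw u hu hl⟩
  have upB : ∀ u ∈ B.V, u ≠ tB → (ownB h ≠ u ∨ u ≠ a) →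
      ∃ e ∈ G.E, own e = u ∧ ∃ w ∈ G.V, G.ends e = {u, w} ∧ pos u < pos w := by
    intro u hu hua hhu
    obtain ⟨e, he, ho, w, hw, hen, hl⟩ := hB.up u hu hua
    rcases hEB e he with rfl | ⟨k1, k2, k3⟩
    · rcases hhu with hhu | hhu
      · exact absurd ho hhu
      · rcases pair_cases (hen.symm.trans hh) hne with h' | h'
        · exact absurd h'.1 hhu
        · rw [h'.1, h'.2] at hl
          exact absurd hl habB.not_gt
    · exact ⟨e, k1, (hoB e k1 k2).trans ho, w, (hV w).2 (Or.inr hw), k3 ▸ hen, hlt u hu w hw hl⟩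
  have key : G.PreGood s t pos own := by
    constructor
    · intro u hu hus
      by_cases huA : u ∈ A.V
      · obtain ⟨e, he, ho, w, hw, hen, hl⟩ := hA.down u huA hus
        rcases hEA e he with rfl | ⟨k1, k2, k3⟩
        · rcases pair_cases (hen.symm.trans hf) hne with ⟨rfl, rfl⟩ | ⟨rfl, rfl⟩
          · exact absurd hl hab.not_gt
          · refine downB u hbB hne.symm ?_
            rw [hown, if_neg]
            · exact hne
            · rw [ho]; exact hne.symm
        · exact ⟨e, k1, (if_pos k2).trans ho, w, (hV w).2 (Or.inl hw), k3 ▸ hen, by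
            rwa [hpA w hw, hpA u huA]⟩
      · have huB := ((hV u).1 hu).resolve_left huA
        refine downB u huB (fun h' => huA (h' ▸ haA)) ?_
        rw [hown]
        split_ifs
        · exact fun h' => huA (h' ▸ hbA)
        · exact fun h' => huA (h' ▸ haA)
    · intro u hu hut
      by_cases huA : u ∈ A.V
      · by_cases hutA : u = tA
        · rcases ht with ⟨h1, h2⟩ | ⟨h1, h2, h3⟩
          · exact absurd (hutA.trans h1) hut
          · have hub : u = b := hutA.trans h1
            exact upB u (hub ▸ hbB) (h2 ▸ hut) (Or.inr (hub ▸ hne.symm))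
        · obtain ⟨e, he, ho, w, hw, hen, hl⟩ := hA.up u huA hutA
          rcases hEA e he with rfl | ⟨k1, k2, k3⟩
          · rcases pair_cases (hen.symm.trans hf) hne with ⟨rfl, rfl⟩ | ⟨rfl, rfl⟩
            · refine upB u haB ?_ (Or.inl ?_)
              · rcases ht with ⟨h1, h2⟩ | ⟨h1, h2, h3⟩
                · rw [h2]; exact hne
                · rw [h2]; exact hut
              · rw [hown, if_pos ho]
                exact hne.symm
            · exact absurd hl hab.not_gt
          · exact ⟨e, k1, (if_pos k2).trans ho, w, (hV w).2 (Or.inl hw), k3 ▸ hen, by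
              rwa [hpA w hw, hpA u huA]⟩
      · have huB := ((hV u).1 hu).resolve_left huA
        refine upB u huB ?_ (Or.inr fun h' => huA (h' ▸ haA))
        rcases ht with ⟨h1, h2⟩ | ⟨h1, h2, h3⟩
        · rw [h2]; exact fun h' => huA (h' ▸ hbA)
        · rw [h2]; exact hut
  obtain ⟨pos', hpos'⟩ := key.exists_good
  exact ⟨pos', own, hpos', fun e he => if_pos he⟩

end MGraph

/-! ### Tight graphs: reductions, degrees and small cases -/

namespace MGraph

variable {α β : Type*} [DecidableEq α] [DecidableEq β]

/-- The subgraph induced by `A`. -/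
def restrict (G : MGraph α β) (A : Finset α) : MGraph α β := ⟨A, G.inside A, G.ends⟩

/-- The subgraph induced by `A` with an additional edge `f` between `a` and `b`. -/
def addOn (G : MGraph α β) (A : Finset α) (f : β) (a b : α) : MGraph α β :=
  ⟨A, insert f (G.inside A), Function.update G.ends f {a, b}⟩

/-- The number of edges at `v`. -/
def deg (G : MGraph α β) (v : α) : ℕ := (G.E.filter fun e => v ∈ G.ends e).card

theorem num_restrict (G : MGraph α β) {A X : Finset α} (hX : X ⊆ A) :
    (G.restrict A).num X = G.num X := by
  unfold num
  congr 1
  ext e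
  simp only [mem_inside, restrict]
  exact ⟨fun h => ⟨h.1.1, h.2⟩, fun h => ⟨⟨h.1, h.2.trans hX⟩, h.2⟩⟩

theorem num_addOn (G : MGraph α β) {A X : Finset α} {f : β} {a b : α} (hX : X ⊆ A)
    (hf : f ∉ G.inside A) :
    (G.addOn A f a b).num X = G.num X + if a ∈ X ∧ b ∈ X then 1 else 0 := by
  have hfX : f ∉ G.inside X := fun h => hf (G.inside_mono hX h)
  have key : ∀ e, e ∈ (G.addOn A f a b).inside X ↔ (e = f ∧ a ∈ X ∧ b ∈ X) ∨ e ∈ G.inside X := by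
    intro e
    by_cases hef : e = f
    · subst hef
      simp [mem_inside, addOn, Finset.insert_subset_iff] at hfX ⊢
      tauto
    · simp only [mem_inside, addOn, Finset.mem_insert, Function.update_of_ne hef, hef, false_and,
        false_or]
      exact ⟨fun h => ⟨h.1.1, h.2⟩, fun h => ⟨⟨h.1, h.2.trans hX⟩, h.2⟩⟩
  unfold num
  split_ifs with hab
  · rw [← Finset.card_insert_of_notMem hfX]
    congr 1
    ext e
    rw [key, Finset.mem_insert]
    tauto
  · rw [add_zero]
    congr 1
    ext e
    rw [key]
    tauto

theorem num_erase_add_deg {G : MGraph α β} {R : Finset α} (hG : G.Tight R) (v : α) :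
    G.num (G.V.erase v) + G.deg v = G.E.card := by
  have : G.inside (G.V.erase v) = G.E.filter fun e => ¬ v ∈ G.ends e := by
    ext e
    rw [mem_inside, Finset.mem_filter, Finset.subset_erase]
    exact ⟨fun h => ⟨h.1, h.2.2⟩, fun h => ⟨h.1, hG.ends_subset e h.1, h.2⟩⟩
  rw [num, this, deg, add_comm]
  exact Finset.card_filter_add_card_filter_not _

namespace Tight

variable {G : MGraph α β} {R : Finset α}

theorem restrict (hG : G.Tight R) {A : Finset α} (hA : A ⊆ G.V)
    (hn : G.num A + 2 = 2 * A.card) : (G.restrict A).Tight R where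
  ends_subset e he := (mem_inside.1 he).2
  card_ends e he := hG.card_ends e (mem_inside.1 he).1
  card_edges := hn
  num_le X hX h2 := by
    replace hX : X ⊆ A := hX
    rw [num_restrict G hX]
    exact hG.num_le X (hX.trans hA) h2
  num_lt X hX h2 hR := by
    replace hX : X ⊆ A := hX
    rw [num_restrict G hX]
    exact hG.num_lt X (hX.trans hA) h2 hR

theorem addOn (hG : G.Tight R) {R' A : Finset α} (hA : A ⊆ G.V) {f : β} {a b : α} (hab : a ≠ b)
    (haA : a ∈ A) (hbA : b ∈ A) (hf : f ∉ G.inside A) (hn : G.num A + 3 = 2 * A.card)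
    (h1 : ∀ X ⊆ A, 2 ≤ X.card → ¬ (a ∈ X ∧ b ∈ X) → ¬ R' ⊆ X → G.num X + 3 ≤ 2 * X.card)
    (h2 : ∀ X ⊆ A, a ∈ X → b ∈ X → G.num X + 3 ≤ 2 * X.card)
    (h3 : ∀ X ⊆ A, a ∈ X → b ∈ X → ¬ R' ⊆ X → G.num X + 4 ≤ 2 * X.card) :
    (G.addOn A f a b).Tight R' where
  ends_subset e he := by
    by_cases hef : e = f
    · subst hef
      simp [MGraph.addOn, Finset.insert_subset_iff, haA, hbA]
    · simp only [MGraph.addOn, Finset.mem_insert, hef, false_or] at he ⊢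
      rw [Function.update_of_ne hef]
      exact (mem_inside.1 he).2
  card_ends e he := by
    by_cases hef : e = f
    · subst hef
      simp [MGraph.addOn, hab]
    · simp only [MGraph.addOn, Finset.mem_insert, hef, false_or] at he ⊢
      rw [Function.update_of_ne hef]
      exact hG.card_ends e (mem_inside.1 he).1
  card_edges := by
    simp only [MGraph.addOn]
    rw [Finset.card_insert_of_notMem hf]
    unfold num at hn
    omega
  num_le X hX hc := by
    replace hX : X ⊆ A := hX
    rw [num_addOn G hX hf]
    have := hG.num_le X (hX.trans hA) hc
    split_ifs with hab
    · have := h2 X hX hab.1 hab.2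
      omega
    · omega
  num_lt X hX hc hR := by
    replace hX : X ⊆ A := hX
    rw [num_addOn G hX hf]
    split_ifs with hab
    · have := h3 X hX hab.1 hab.2 hR
      omega
    · exact h1 X hX hc hab hR

theorem two_le_deg (hG : G.Tight R) (h3 : 3 ≤ G.V.card) {v : α} (hv : v ∈ G.V) :
    2 ≤ G.deg v := by
  have h1 := num_erase_add_deg hG v
  have h2 := Finset.card_erase_of_mem hv
  have h4 := hG.num_le _ (Finset.erase_subset v G.V) (by omega)
  have h5 := hG.card_edges
  omega

theorem three_le_deg (hG : G.Tight R) (h3 : 3 ≤ G.V.card) {v : α} (hv : v ∈ G.V) (hvR : v ∈ R) :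
    3 ≤ G.deg v := by
  have h1 := num_erase_add_deg hG v
  have h2 := Finset.card_erase_of_mem hv
  have h4 := hG.num_lt _ (Finset.erase_subset v G.V) (by omega) fun h =>
    Finset.notMem_erase v G.V (h hvR)
  have h5 := hG.card_edges
  omega

theorem sum_deg (G : MGraph α β) (M : Finset α) :
    ∑ v ∈ M, G.deg v = ∑ e ∈ G.E, (M.filter fun v => v ∈ G.ends e).card :=
  Finset.sum_card_bipartiteAbove_eq_sum_card_bipartiteBelow (fun v e => v ∈ G.ends e)

/-- The degrees sum to 4|V| - 4. Vertices of R have degree at least 3, so if all others had degree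
at least 4 the sum would be at least 4|V| - 3. -/
theorem exists_deg_le_three (hG : G.Tight R) (h3 : 3 ≤ G.V.card) (hR : R ⊆ G.V)
    (hRc : R.card ≤ 3) : ∃ v ∈ G.V, v ∉ R ∧ G.deg v ≤ 3 := by
  by_contra! hcon
  have h1 : ∑ v ∈ G.V, G.deg v = 2 * G.E.card := by
    rw [sum_deg, Finset.sum_const_nat (m := 2), mul_comm]
    intro e he
    rw [← hG.card_ends e he]
    congr 1
    ext v
    simp only [Finset.mem_filter, and_iff_right_iff_imp]
    exact fun h => hG.ends_subset e he h
  have h2 : ∑ v ∈ G.V, (4 - if v ∈ R then 1 else 0) ≤ ∑ v ∈ G.V, G.deg v := by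
    apply Finset.sum_le_sum
    intro v hv
    split_ifs with hvR
    · exact hG.three_le_deg h3 hv hvR
    · exact hcon v hv hvR
  have h4 : ∑ v ∈ G.V, (4 - if v ∈ R then 1 else 0) + R.card = 4 * G.V.card := by
    have : R.card = ∑ v ∈ G.V, if v ∈ R then 1 else 0 := by
      rw [Finset.sum_ite_mem, Finset.inter_eq_right.2 hR]
      simp
    rw [this, ← Finset.sum_add_distrib, Finset.sum_const_nat (m := 4), mul_comm]
    intro v _
    split_ifs <;> rfl
  have h5 := hG.card_edges
  omega

/-- With M = V \ U there are 2|M| edges not inside U, and at most 2|M| - 2 of them lie inside M and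
count twice. The degrees on M thus sum to less than 4|M|. -/
theorem exists_deg_le_three_of_num (hG : G.Tight R) {U : Finset α} (hU : U ⊆ G.V) (hUV : U ≠ G.V)
    (hn : G.num U + 2 = 2 * U.card) : ∃ v ∈ G.V, v ∉ U ∧ G.deg v ≤ 3 := by
  by_contra! hcon
  have hMne : (G.V \ U).Nonempty := by
    rw [Finset.sdiff_nonempty]
    exact fun h => hUV (hU.antisymm h)
  have hM := hG.num_le' (X := G.V \ U) Finset.sdiff_subset hMne
  have h1 : ∑ v ∈ G.V \ U, G.deg v + G.num U ≤ G.E.card + G.num (G.V \ U) := by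
    rw [sum_deg]
    have e1 : G.num U = ∑ e ∈ G.E, if G.ends e ⊆ U then 1 else 0 := by
      rw [num, inside, Finset.card_filter]
    have e2 : G.num (G.V \ U) = ∑ e ∈ G.E, if G.ends e ⊆ G.V \ U then 1 else 0 := by
      rw [num, inside, Finset.card_filter]
    rw [e1, e2, Finset.card_eq_sum_ones, ← Finset.sum_add_distrib, ← Finset.sum_add_distrib]
    apply Finset.sum_le_sum
    intro e he
    have hsub : ((G.V \ U).filter fun v => v ∈ G.ends e) ⊆ G.ends e := by
      intro v hv
      exact (Finset.mem_filter.1 hv).2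
    have hle := Finset.card_le_card hsub
    rw [hG.card_ends e he] at hle
    by_cases hs : G.ends e ⊆ U
    · have : ((G.V \ U).filter fun v => v ∈ G.ends e) = ∅ := by
        ext v
        simp only [Finset.mem_filter, Finset.mem_sdiff, Finset.notMem_empty, iff_false]
        exact fun h => h.1.2 (hs h.2)
      rw [this, if_pos hs]
      simp
    · rw [if_neg hs]
      by_cases hs' : G.ends e ⊆ G.V \ U
      · rw [if_pos hs']
        omega
      · rw [if_neg hs']
        have : ((G.V \ U).filter fun v => v ∈ G.ends e).card ≠ 2 := by
          intro h2
          apply hs'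
          rw [← Finset.eq_of_subset_of_card_le hsub (by rw [h2, hG.card_ends e he])]
          exact Finset.filter_subset _ _
        omega
  have h2 : (G.V \ U).card * 4 ≤ ∑ v ∈ G.V \ U, G.deg v := by
    rw [← smul_eq_mul]
    apply Finset.card_nsmul_le_sum
    intro v hv
    rw [Finset.mem_sdiff] at hv
    exact hcon v hv.1 hv.2
  have h3 := Finset.card_sdiff_add_card_eq_card hU
  have h4 := hG.card_edges
  omega

theorem exists_other (hG : G.Tight R) {e : β} (he : e ∈ G.E) {v : α} (hv : v ∈ G.ends e) :
    ∃ x ∈ G.V, x ≠ v ∧ G.ends e = {v, x} := by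
  obtain ⟨a, b, hab, h⟩ := Finset.card_eq_two.1 (hG.card_ends e he)
  have hs := hG.ends_subset e he
  rw [h] at hv hs
  simp only [Finset.insert_subset_iff, Finset.singleton_subset_iff] at hs
  simp only [Finset.mem_insert, Finset.mem_singleton] at hv
  rcases hv with rfl | rfl
  · exact ⟨b, hs.2, hab.symm, h⟩
  · exact ⟨a, hs.1, hab, by rw [h, Finset.pair_comm]⟩

/-- As {v, x} cannot contain R, it spans at most one edge. A vertex outside R therefore has distinct
neighbours along its edges. -/
theorem eq_of_ends_eq (hG : G.Tight R) (hR : 2 ≤ R.card) {v x : α} (hv : v ∈ G.V) (hvR : v ∉ R)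
    (hx : x ∈ G.V) (hxv : x ≠ v) {e f : β} (he : e ∈ G.E) (hf : f ∈ G.E)
    (hne : G.ends e = {v, x}) (hnf : G.ends f = {v, x}) : e = f := by
  by_contra hef
  have hc : ({v, x} : Finset α).card = 2 := Finset.card_pair hxv.symm
  have h1 := hG.num_lt {v, x} (by simp [Finset.insert_subset_iff, hv, hx]) hc.ge (by
    intro h
    have : R ⊆ {x} := by
      intro r hr
      have := h hr
      simp only [Finset.mem_insert, Finset.mem_singleton] at this ⊢
      exact this.resolve_left fun h' => hvR (h' ▸ hr)
    have := Finset.card_le_card this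
    simp at this
    omega)
  have h2 : ({e, f} : Finset β) ⊆ G.inside {v, x} := by
    intro g hg
    simp only [Finset.mem_insert, Finset.mem_singleton] at hg
    rw [mem_inside]
    rcases hg with rfl | rfl
    · exact ⟨he, hne.le⟩
    · exact ⟨hf, hnf.le⟩
  have h3 := Finset.card_le_card h2
  rw [Finset.card_pair hef] at h3
  unfold num at h1
  omega

end Tight

/-- Whenever `H` satisfies the hypotheses, there are positions and owners with prescribed
extreme vertices `s` and `t` and a prescribed owner of an edge at `s`. -/
def Solvable (H : MGraph α β) : Prop :=
  ∀ s t e c, H.Tight (insert t (H.ends e)) → e ∈ H.E → s ∈ H.ends e → t ∈ H.V → t ≠ s →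
    c ∈ H.ends e → ∃ pos own, H.Good s t pos own ∧ own e = c

theorem exists_good_of_card_eq_two {G : MGraph α β} (h2 : G.V.card = 2) : G.Solvable := by
  intro s t e c hG he hs ht hts hc
  obtain ⟨w, hw, hws, hn⟩ := hG.exists_other he hs
  have hsV := hG.ends_subset e he hs
  have hV : ({s, t} : Finset α) = G.V := by
    apply Finset.eq_of_subset_of_card_le
    · simp [Finset.insert_subset_iff, hsV, ht]
    · rw [h2, Finset.card_pair hts.symm]
  have hends : ∀ f ∈ G.E, G.ends f = {s, t} := by
    intro f hf
    rw [hV]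
    exact Finset.eq_of_subset_of_card_le (hG.ends_subset f hf) (by rw [hG.card_ends f hf, h2])
  have hE := hG.card_edges
  obtain ⟨f, hf, hfe⟩ := Finset.exists_mem_ne (s := G.E) (by omega) e
  rw [hends e he] at hc
  have key : ∀ own : β → α, (∃ f ∈ G.E, own f = s) → (∃ f ∈ G.E, own f = t) →
      G.PreGood s t (fun v => if v = s then 0 else 1) own := by
    rintro own ⟨f, hf, hfs⟩ ⟨g, hg, hgt⟩
    constructor
    · intro v hv hvs
      rw [← hV] at hv
      have hvt : v = t := by simpa [hvs] using hv
      subst hvt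
      exact ⟨g, hg, hgt, s, hsV, by rw [hends g hg, Finset.pair_comm], by simp [hvs]⟩
    · intro v hv hvt
      rw [← hV] at hv
      have hvs : v = s := by simpa [hvt] using hv
      subst hvs
      exact ⟨f, hf, hfs, t, ht, hends f hf, by simp [hts]⟩
  simp only [Finset.mem_insert, Finset.mem_singleton] at hc
  rcases hc with rfl | rfl
  · obtain ⟨pos, hpos⟩ := (key (fun g => if g = e then c else t) ⟨e, he, by simp⟩
      ⟨f, hf, by simp [hfe]⟩).exists_good
    exact ⟨pos, _, hpos, by simp⟩
  · obtain ⟨pos, hpos⟩ := (key (fun g => if g = e then c else s) ⟨f, hf, by simp [hfe]⟩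
      ⟨e, he, by simp⟩).exists_good
    exact ⟨pos, _, hpos, by simp⟩

theorem exists_good_of_complete {G : MGraph α β} {s t w v c : α} {e : β}
    (hV : G.V = {s, v, w, t}) (hsv : s ≠ v) (hsw : s ≠ w) (hst : s ≠ t) (hvw : v ≠ w)
    (hvt : v ≠ t) (hwt : w ≠ t)
    (hE : ∀ p ∈ G.V, ∀ q ∈ G.V, p ≠ q → ∃ f ∈ G.E, G.ends f = {p, q})
    (hn : G.ends e = {s, w}) (hc : c = s ∨ c = w) :
    ∃ pos own, G.Good s t pos own ∧ own e = c := by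
  have ms : s ∈ G.V := by simp [hV]
  have mv : v ∈ G.V := by simp [hV]
  have mw : w ∈ G.V := by simp [hV]
  have mt : t ∈ G.V := by simp [hV]
  set pos : α → ℚ := fun u => if u = s then 0 else if u = v then 1 else if u = w then 2 else 3
    with hpos
  have ps : pos s = 0 := by simp [hpos]
  have pv : pos v = 1 := by simp [hpos, hsv.symm]
  have pw : pos w = 2 := by simp [hpos, hsw.symm, hvw.symm]
  have pt : pos t = 3 := by simp [hpos, hst.symm, hvt.symm, hwt.symm]
  obtain ⟨sv, msv, nsv⟩ := hE v mv s ms hsv.symm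
  obtain ⟨st, mst, nst⟩ := hE s ms t mt hst
  obtain ⟨sw, msw, nsw⟩ := hE s ms w mw hsw
  obtain ⟨vw, mvw, nvw⟩ := hE v mv w mw hvw
  obtain ⟨vt, mvt, nvt⟩ := hE v mv t mt hvt
  obtain ⟨wt, mwt, nwt⟩ := hE w mw t mt hwt
  -- The order is s < v < w < t. The two owner patterns differ in whether the edge sw serves s
  -- upwards or w downwards, matching the two values of c.
  have key : ∀ own : β → α, own sv = v → own wt = w →
      ((own sw = s ∧ own vw = w ∧ own vt = v ∧ own st = t) ∨
        (own sw = w ∧ own st = s ∧ own vt = t ∧ own vw = v)) → G.PreGood s t pos own := by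
    intro own o1 o2 o3
    constructor
    · intro u hu hus
      rw [hV] at hu
      simp only [Finset.mem_insert, Finset.mem_singleton, hus, false_or] at hu
      rcases hu with rfl | rfl | rfl
      · exact ⟨sv, msv, o1, s, ms, nsv, by rw [ps, pv]; norm_num⟩
      · rcases o3 with ⟨a1, a2, a3, a4⟩ | ⟨a1, a2, a3, a4⟩
        · exact ⟨vw, mvw, a2, v, mv, by rw [nvw, Finset.pair_comm], by rw [pv, pw]; norm_num⟩
        · exact ⟨sw, msw, a1, s, ms, by rw [nsw, Finset.pair_comm], by rw [ps, pw]; norm_num⟩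
      · rcases o3 with ⟨a1, a2, a3, a4⟩ | ⟨a1, a2, a3, a4⟩
        · exact ⟨st, mst, a4, s, ms, by rw [nst, Finset.pair_comm], by rw [ps, pt]; norm_num⟩
        · exact ⟨vt, mvt, a3, v, mv, by rw [nvt, Finset.pair_comm], by rw [pv, pt]; norm_num⟩
    · intro u hu hut
      rw [hV] at hu
      simp only [Finset.mem_insert, Finset.mem_singleton, hut, or_false] at hu
      rcases hu with rfl | rfl | rfl
      · rcases o3 with ⟨a1, a2, a3, a4⟩ | ⟨a1, a2, a3, a4⟩
        · exact ⟨sw, msw, a1, w, mw, nsw, by rw [ps, pw]; norm_num⟩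
        · exact ⟨st, mst, a2, t, mt, nst, by rw [ps, pt]; norm_num⟩
      · rcases o3 with ⟨a1, a2, a3, a4⟩ | ⟨a1, a2, a3, a4⟩
        · exact ⟨vt, mvt, a3, t, mt, nvt, by rw [pv, pt]; norm_num⟩
        · exact ⟨vw, mvw, a4, w, mw, nvw, by rw [pv, pw]; norm_num⟩
      · exact ⟨wt, mwt, o2, t, mt, nwt, by rw [pw, pt]; norm_num⟩
  have hvs := hsv.symm
  have hws := hsw.symm
  have hts := hst.symm
  have hwv := hvw.symm
  have htv := hvt.symm
  have htw := hwt.symm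
  rcases hc with rfl | rfl
  · obtain ⟨pos', hpos'⟩ := (key (fun f => if c ∈ G.ends f ∧ v ∈ G.ends f then v else
      if w ∈ G.ends f ∧ t ∈ G.ends f then w else if c ∈ G.ends f ∧ w ∈ G.ends f then c else
      if v ∈ G.ends f ∧ w ∈ G.ends f then w else if c ∈ G.ends f ∧ t ∈ G.ends f then t else v)
      (by simp [*]) (by simp [*]) (Or.inl (by simp [*]))).exists_good
    exact ⟨pos', _, hpos', by simp [*]⟩
  · obtain ⟨pos', hpos'⟩ := (key (fun f => if s ∈ G.ends f ∧ v ∈ G.ends f then v else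
      if c ∈ G.ends f ∧ t ∈ G.ends f then c else if s ∈ G.ends f ∧ c ∈ G.ends f then c else
      if v ∈ G.ends f ∧ c ∈ G.ends f then v else if s ∈ G.ends f ∧ t ∈ G.ends f then s else t)
      (by simp [*]) (by simp [*]) (Or.inr (by simp [*]))).exists_good
    exact ⟨pos', _, hpos', by simp [*]⟩

end MGraph

/-! ### Two-separations and the splitting of vertices of degree two or three -/

namespace MGraph

variable {α β : Type*} [DecidableEq α] [DecidableEq β]

/-- A division of `G` into two parts with exactly two common vertices. -/
structure Separation (G : MGraph α β) (A B : Finset α) (a b : α) : Prop where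
  ne : a ≠ b
  union : A ∪ B = G.V
  inter : A ∩ B = {a, b}
  cover : ∀ e ∈ G.E, G.ends e ⊆ A ∨ G.ends e ⊆ B
  left : 3 ≤ A.card
  right : 3 ≤ B.card

namespace Separation

variable {G : MGraph α β} {A B : Finset α} {a b : α}

theorem symm (h : G.Separation A B a b) : G.Separation B A a b :=
  ⟨h.ne, by rw [Finset.union_comm, h.union], by rw [Finset.inter_comm, h.inter],
    fun e he => (h.cover e he).symm, h.right, h.left⟩

theorem swap (h : G.Separation A B a b) : G.Separation A B b a :=
  ⟨h.ne.symm, h.union, by rw [h.inter, Finset.pair_comm], h.cover, h.left, h.right⟩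

theorem left_subset (h : G.Separation A B a b) : A ⊆ G.V := h.union ▸ Finset.subset_union_left

theorem mem_left (h : G.Separation A B a b) : a ∈ A := by
  have : a ∈ A ∩ B := by simp [h.inter]
  exact (Finset.mem_inter.1 this).1

theorem card_add (h : G.Separation A B a b) : A.card + B.card = G.V.card + 2 := by
  rw [← Finset.card_union_add_card_inter, h.union, h.inter, Finset.card_pair h.ne]

theorem ne_V (h : G.Separation A B a b) : A ≠ G.V := by
  intro h'
  have h1 := h.card_add
  have h2 := h.right
  rw [h'] at h1
  omega

variable {R : Finset α}

/-- The counts of A and B sum to |E| plus the number of edges ab, and |A| + |B| = |V| + 2. Bounds of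
2|A| - 3 and 2|B| - 3 leave equality as the only possibility, with no edge ab. -/
theorem num_left (h : G.Separation A B a b) (hG : G.Tight R)
    (hgen : ∀ X ⊆ G.V, X ≠ G.V → 2 ≤ X.card → G.num X + 3 ≤ 2 * X.card) :
    G.num A + 3 = 2 * A.card ∧ G.num {a, b} = 0 := by
  have h1 := hgen A h.left_subset h.ne_V (by have := h.left; omega)
  have h2 := hgen B h.symm.left_subset h.symm.ne_V (by have := h.right; omega)
  have h3 := h.card_add
  have h4 := hG.card_edges
  have h5 : G.inside A ∪ G.inside B = G.E := by
    ext e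
    simp only [Finset.mem_union, mem_inside]
    have := h.cover e
    tauto
  have h6 := G.num_add_num A B
  rw [h5, h.inter] at h6
  omega

/-- A proper subset X of A containing a and b with 2|X| - 3 edges would combine with B to a proper
vertex set with 2|X ∪ B| - 2 edges, against `hgen`. So the side with its virtual edge tolerates any
R' inside A. -/
theorem tight_addOn (h : G.Separation A B a b) (hG : G.Tight R)
    (hgen : ∀ X ⊆ G.V, X ≠ G.V → 2 ≤ X.card → G.num X + 3 ≤ 2 * X.card) {f : β}
    (hf : f ∈ G.inside B) {R' : Finset α} (hR' : R' ⊆ A) : (G.addOn A f a b).Tight R' := by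
  obtain ⟨hA, hab⟩ := h.num_left hG hgen
  have hB := (h.symm.num_left hG hgen).1
  have hadd := h.card_add
  have hgenA : ∀ X ⊆ A, 2 ≤ X.card → G.num X + 3 ≤ 2 * X.card := fun X hX h2 =>
    hgen X (hX.trans h.left_subset) (fun h' => h.ne_V (h.left_subset.antisymm (h' ▸ hX))) h2
  refine hG.addOn h.left_subset h.ne h.mem_left h.swap.mem_left ?_ hA (fun X hX h2 _ _ =>
    hgenA X hX h2) (fun X hX ha hb => hgenA X hX (Finset.one_lt_card.2 ⟨a, ha, b, hb, h.ne⟩)) ?_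
  · intro hfA
    have : f ∈ G.inside {a, b} := by
      rw [← h.inter, inside_inter, Finset.mem_inter]
      exact ⟨hfA, hf⟩
    rw [num, Finset.card_eq_zero] at hab
    simp [hab] at this
  · intro X hX ha hb hRX
    have hXA : X ≠ A := fun h' => hRX (h' ▸ hR')
    have hXB : X ∩ B = {a, b} := by
      apply Finset.Subset.antisymm
      · rw [← h.inter]
        exact Finset.inter_subset_inter_right hX
      · have haB := h.symm.mem_left
        have hbB := h.symm.swap.mem_left
        simp [Finset.insert_subset_iff, ha, hb, haB, hbB]
    have hc := Finset.card_union_add_card_inter X B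
    rw [hXB, Finset.card_pair h.ne] at hc
    have hs := G.num_add_num_le X B
    rw [hXB, hab] at hs
    have hlt := Finset.card_lt_card (hX.ssubset_of_ne hXA)
    have hBU : B.card ≤ (X ∪ B).card := Finset.card_le_card Finset.subset_union_right
    have := hgen (X ∪ B) (Finset.union_subset (hX.trans h.left_subset) h.symm.left_subset)
      (fun h' => by rw [h'] at hc; omega) (by have := h.right; omega)
    omega

/-- The side containing e is solved first; it reveals which of a, b is lower and who owns the
virtual edge. The other side is then solved with the lower one as source and the complementary
owner, as `Good.glue` requires. -/
theorem exists_good (h : G.Separation A B a b)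
    (hgen : ∀ X ⊆ G.V, X ≠ G.V → 2 ≤ X.card → G.num X + 3 ≤ 2 * X.card)
    (ih : ∀ H : MGraph α β, H.V.card < G.V.card → H.Solvable) {s t c : α} {e : β}
    (hG : G.Tight (insert t (G.ends e))) (he : e ∈ G.E) (hs : s ∈ G.ends e) (ht : t ∈ G.V)
    (hts : t ≠ s) (hc : c ∈ G.ends e) (heA : G.ends e ⊆ A) :
    ∃ pos own, G.Good s t pos own ∧ own e = c := by
  obtain ⟨hA, hab⟩ := h.num_left hG hgen
  have hB := (h.symm.num_left hG hgen).1
  have hadd := h.card_add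
  have hl := h.left
  have hr := h.right
  have disj : ∀ g ∈ G.E, G.ends g ⊆ A → ¬ G.ends g ⊆ B := by
    intro g hg h1 h2
    have : g ∈ G.inside {a, b} := by
      rw [← h.inter, mem_inside]
      exact ⟨hg, Finset.subset_inter h1 h2⟩
    rw [num, Finset.card_eq_zero] at hab
    simp [hab] at this
  -- An edge of B lends its name to the virtual edge added to A; in B the name e plays that part.
  obtain ⟨f, hf⟩ : (G.inside B).Nonempty := by
    rw [← Finset.card_pos]
    unfold num at hB
    omega
  have hfB := mem_inside.1 hf
  have hfA : ¬ G.ends f ⊆ A := fun h' => disj f hfB.1 h' hfB.2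
  have hef : e ≠ f := fun h' => hfA (h' ▸ heA)
  have hne : ∀ d d', (G.addOn A f d d').ends e = G.ends e := fun d d' =>
    Function.update_of_ne hef _ _
  have heE : ∀ d d', e ∈ (G.addOn A f d d').E := fun d d' =>
    Finset.mem_insert_of_mem (mem_inside.2 ⟨he, heA⟩)
  have solveB : ∀ s' t' d d' c', G.Separation A B d d' → s' = d → t' ∈ B → t' ≠ s' →
      (c' = d ∨ c' = d') →
      ∃ pos own, (G.addOn B e d d').Good s' t' pos own ∧ own e = c' := by
    intro s' t' d d' c' hsep hs' ht' hts' hc'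
    have hnB : (G.addOn B e d d').ends e = {d, d'} := Function.update_self _ _ _
    refine ih (G.addOn B e d d') (show B.card < G.V.card by omega) s' t' e c' ?_
      (Finset.mem_insert_self _ _) ?_ ht' hts' ?_
    · apply hsep.symm.tight_addOn hG hgen (mem_inside.2 ⟨he, heA⟩)
      rw [hnB]
      simp [Finset.insert_subset_iff, ht', hsep.symm.mem_left, hsep.symm.swap.mem_left]
    · rw [hnB, hs']
      simp
    · rw [hnB]
      simpa using hc'
  have glueup : ∀ d d' tA tB posA posB ownA ownB, G.Separation A B d d' →
      (G.addOn A f d d').Good s tA posA ownA → (G.addOn B e d d').Good d tB posB ownB →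
      posA d < posA d' → ownA e = c → ownB e = (if ownA f = d then d' else d) →
      ((tA = t ∧ tB = d') ∨ (tA = d' ∧ tB = t ∧ t ∉ A)) →
      ∃ pos own, G.Good s t pos own ∧ own e = c := by
    intro d d' tA tB posA posB ownA ownB hsep gA gB hlt hoA hoB ht'
    obtain ⟨pos, own, hgood, hown⟩ := Good.glue (G := G) (f := f) (h := e) gA gB hlt hoB
      (fun u => by rw [← h.union, Finset.mem_union]; rfl)
      (fun u hu hu' => by
        have : u ∈ A ∩ B := Finset.mem_inter.2 ⟨hu, hu'⟩
        rw [hsep.inter] at this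
        simpa using this)
      hsep.mem_left hsep.symm.mem_left hsep.swap.mem_left hsep.symm.swap.mem_left
      (Function.update_self _ _ _) (Function.update_self _ _ _)
      (fun g hg => by
        rcases Finset.mem_insert.1 hg with hg | hg
        · exact Or.inl hg
        · have hg' := mem_inside.1 hg
          exact Or.inr ⟨hg'.1, hg'.2, Function.update_of_ne (fun h' : g = f => hfA (h' ▸ hg'.2)) _ _⟩)
      (fun g hg => by
        rcases Finset.mem_insert.1 hg with hg | hg
        · exact Or.inl hg
        · have hg' := mem_inside.1 hg
          exact Or.inr ⟨hg'.1, hg'.2, Function.update_of_ne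
            (fun h' : g = e => disj e he heA (h' ▸ hg'.2)) _ _⟩)
      disj ht'
    exact ⟨pos, own, hgood, (hown e heA).trans hoA⟩
  have hAlt : A.card < G.V.card := by omega
  by_cases htA : t ∈ A
  · have main : ∀ d d' posA ownA, G.Separation A B d d' → (G.addOn A f d d').Good s t posA ownA →
        ownA e = c → posA d < posA d' → ∃ pos own, G.Good s t pos own ∧ own e = c := by
      intro d d' posA ownA hsep gA hoA hlt
      obtain ⟨posB, ownB, gB, hoB⟩ := solveB d d' d d' (if ownA f = d then d' else d) hsep rfl
        hsep.symm.swap.mem_left hsep.ne.symm (by split_ifs <;> simp)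
      exact glueup d d' t d' posA posB ownA ownB hsep gA gB hlt hoA hoB (Or.inl ⟨rfl, rfl⟩)
    obtain ⟨posA, ownA, gA, hoA⟩ := ih (G.addOn A f a b) hAlt s t e c (by
      rw [hne]
      exact h.tight_addOn hG hgen hf (Finset.insert_subset htA heA)) (heE a b)
      (by rwa [hne]) htA hts (by rwa [hne])
    rcases lt_or_gt_of_ne (fun h' => h.ne (gA.inj h.mem_left h.swap.mem_left h')) with hlt | hlt
    · exact main a b posA ownA h gA hoA hlt
    · refine main b a posA ownA h.swap ?_ hoA hlt
      have : G.addOn A f b a = G.addOn A f a b := by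
        unfold addOn
        rw [Finset.pair_comm]
      rwa [this]
  -- With t beyond A, one of the two cut vertices becomes the sink of A. It must differ from s, and
  -- being the sink it is automatically above the other cut vertex.
  · have main : ∀ d d', G.Separation A B d d' → d' ≠ s →
        ∃ pos own, G.Good s t pos own ∧ own e = c := by
      intro d d' hsep hds
      obtain ⟨posA, ownA, gA, hoA⟩ := ih (G.addOn A f d d') hAlt s d' e c (by
        rw [hne]
        exact hsep.tight_addOn hG hgen hf (Finset.insert_subset hsep.swap.mem_left heA)) (heE d d')
        (by rwa [hne]) hsep.swap.mem_left hds (by rwa [hne])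
      have htB : t ∈ B := by
        rw [← h.union, Finset.mem_union] at ht
        exact ht.resolve_left htA
      obtain ⟨posB, ownB, gB, hoB⟩ := solveB d t d d' (if ownA f = d then d' else d) hsep rfl
        htB (fun h' => htA (h' ▸ hsep.mem_left)) (by split_ifs <;> simp)
      exact glueup d d' d' t posA posB ownA ownB hsep gA gB
        (gA.lt_sink hsep.mem_left hsep.ne) hoA hoB (Or.inr ⟨rfl, rfl, htA⟩)
    by_cases hbs : b = s
    · exact main b a h.swap (fun h' => h.ne (h'.trans hbs.symm))
    · exact main a b h hbs

end Separation

theorem exists_good_of_deg_two {G : MGraph α β}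
    (ih : ∀ H : MGraph α β, H.V.card < G.V.card → H.Solvable) {s t c v : α} {e : β}
    (hG : G.Tight (insert t (G.ends e))) (he : e ∈ G.E) (hs : s ∈ G.ends e) (ht : t ∈ G.V)
    (hts : t ≠ s) (hc : c ∈ G.ends e) (hv : v ∈ G.V) (hvR : v ∉ insert t (G.ends e))
    (hd : G.deg v = 2) : ∃ pos own, G.Good s t pos own ∧ own e = c := by
  have hve : v ∉ G.ends e := fun h => hvR (Finset.mem_insert_of_mem h)
  have hvt : v ≠ t := fun h => hvR (h ▸ Finset.mem_insert_self _ _)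
  have hRc : 2 ≤ (insert t (G.ends e)).card := by
    rw [← hG.card_ends e he]
    exact Finset.card_le_card (Finset.subset_insert _ _)
  obtain ⟨e₁, e₂, h12, hE12⟩ := Finset.card_eq_two.1 hd
  have m₁ : e₁ ∈ G.E ∧ v ∈ G.ends e₁ := by
    refine (Finset.mem_filter (p := fun e => v ∈ G.ends e)).1 ?_
    simp [hE12]
  have m₂ : e₂ ∈ G.E ∧ v ∈ G.ends e₂ := by
    refine (Finset.mem_filter (p := fun e => v ∈ G.ends e)).1 ?_
    simp [hE12]
  obtain ⟨x, hx, hxv, hnx⟩ := hG.exists_other m₁.1 m₁.2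
  obtain ⟨y, hy, hyv, hny⟩ := hG.exists_other m₂.1 m₂.2
  have hxy : x ≠ y := by
    rintro rfl
    exact h12 (hG.eq_of_ends_eq hRc hv hvR hx hxv m₁.1 m₂.1 hnx hny)
  have hcard := Finset.card_erase_of_mem hv
  have hn := num_erase_add_deg hG v
  have hce := hG.card_edges
  have hpos : 0 < G.V.card := Finset.card_pos.2 ⟨v, hv⟩
  have hsub : G.ends e ⊆ G.V.erase v :=
    Finset.subset_erase.2 ⟨hG.ends_subset e he, hve⟩
  obtain ⟨pos, own, hgood, ho⟩ := ih (G.restrict (G.V.erase v))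
    (show (G.V.erase v).card < G.V.card by omega) s t e c
    (hG.restrict (Finset.erase_subset _ _) (by omega))
    (mem_inside.2 ⟨he, hsub⟩) hs (Finset.mem_erase.2 ⟨hvt.symm, ht⟩) hts hc
  obtain ⟨pos', own', hgood', ho'⟩ := hgood.insert_two (G := G) (v := v) (x := x) (y := y)
    (fun u => by
      simp only [restrict, Finset.mem_erase]
      by_cases huv : u = v
      · simp [huv, hv]
      · simp [huv])
    (Finset.notMem_erase v _)
    (fun g hg => by
      have hg' := mem_inside.1 hg
      exact ⟨hg'.1, (Finset.subset_erase.1 hg'.2).2, rfl⟩)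
    (Finset.mem_erase.2 ⟨hxv, hx⟩) (Finset.mem_erase.2 ⟨hyv, hy⟩) hxy m₁.1 m₂.1 hnx hny
  exact ⟨pos', own', hgood', (ho' e hve).trans ho⟩

/-- Without a blocking set, G - v with an added edge xy is again tight for the same R, so the
induction hypothesis applies. -/
theorem exists_good_of_not_blocks {G : MGraph α β}
    (ih : ∀ H : MGraph α β, H.V.card < G.V.card → H.Solvable) {s t c v x y z : α}
    {e e₁ e₂ e₃ : β}
    (hG : G.Tight (insert t (G.ends e))) (he : e ∈ G.E) (hs : s ∈ G.ends e) (ht : t ∈ G.V)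
    (hts : t ≠ s) (hc : c ∈ G.ends e) (hv : v ∈ G.V) (hvR : v ∉ insert t (G.ends e))
    (hd : G.deg v = 3) (m₁ : e₁ ∈ G.E) (m₂ : e₂ ∈ G.E) (m₃ : e₃ ∈ G.E)
    (n₁ : G.ends e₁ = {v, x}) (n₂ : G.ends e₂ = {v, y}) (n₃ : G.ends e₃ = {v, z})
    (hx : x ∈ G.V) (hy : y ∈ G.V) (hz : z ∈ G.V) (hxv : x ≠ v) (hyv : y ≠ v) (hzv : z ≠ v)
    (hxy : x ≠ y) (hyz : y ≠ z) (hxz : x ≠ z)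
    (hb : ∀ X, ¬ G.Blocks (insert t (G.ends e)) v x y X) :
    ∃ pos own, G.Good s t pos own ∧ own e = c := by
  have hve : v ∉ G.ends e := fun h => hvR (Finset.mem_insert_of_mem h)
  have hvt : v ≠ t := fun h => hvR (h ▸ Finset.mem_insert_self _ _)
  have hcard := Finset.card_erase_of_mem hv
  have hn := num_erase_add_deg hG v
  have hce := hG.card_edges
  have hpos : 0 < G.V.card := Finset.card_pos.2 ⟨v, hv⟩
  have hsub : G.ends e ⊆ G.V.erase v :=
    Finset.subset_erase.2 ⟨hG.ends_subset e he, hve⟩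
  have hee : e ≠ e₁ := by
    rintro rfl
    exact hve (by simp [n₁])
  have hnot : e₁ ∉ G.inside (G.V.erase v) := fun h' =>
    (Finset.subset_erase.1 (mem_inside.1 h').2).2 (by simp [n₁])
  set H := G.addOn (G.V.erase v) e₁ x y with hH
  have hHe : H.ends e = G.ends e := Function.update_of_ne hee _ _
  have hHV : H.V = G.V.erase v := rfl
  have hblock : ∀ X ⊆ G.V.erase v, x ∈ X → y ∈ X →
      ¬ (2 * X.card ≤ G.num X + 2 ∨ ¬ insert t (G.ends e) ⊆ X ∧ 2 * X.card ≤ G.num X + 3) := by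
    intro X hX hxX hyX h'
    exact hb X ⟨hX.trans (Finset.erase_subset _ _), fun hvX => Finset.notMem_erase v _ (hX hvX),
      hxX, hyX, h'⟩
  have hT : H.Tight (insert t (H.ends e)) := by
    rw [hHe]
    refine hG.addOn (Finset.erase_subset _ _) hxy (Finset.mem_erase.2 ⟨hxv, hx⟩)
      (Finset.mem_erase.2 ⟨hyv, hy⟩) hnot (by omega) ?_ ?_ ?_
    · intro X hX h2 _ hR
      exact hG.num_lt X (hX.trans (Finset.erase_subset _ _)) h2 hR
    · intro X hX hxX hyX
      have := hblock X hX hxX hyX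
      omega
    · intro X hX hxX hyX hR
      have := hblock X hX hxX hyX
      simp only [hR, not_false_eq_true, true_and] at this
      omega
  obtain ⟨pos, own, hgood, ho⟩ := ih H (show (G.V.erase v).card < G.V.card by omega) s t e c hT
    (Finset.mem_insert_of_mem (mem_inside.2 ⟨he, hsub⟩)) (by rwa [hHe])
    (Finset.mem_erase.2 ⟨hvt.symm, ht⟩) hts (by rwa [hHe])
  have hV : ∀ u, u ∈ G.V ↔ u = v ∨ u ∈ H.V := by
    intro u
    rw [hHV, Finset.mem_erase]
    by_cases huv : u = v
    · simp [huv, hv]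
    · simp [huv]
  have hE : ∀ g ∈ H.E, g = e₁ ∨ (g ∈ G.E ∧ v ∉ G.ends g ∧ H.ends g = G.ends g) := by
    intro g hg
    rcases Finset.mem_insert.1 hg with hg | hg
    · exact Or.inl hg
    · have hg' := mem_inside.1 hg
      have hvg := (Finset.subset_erase.1 hg'.2).2
      refine Or.inr ⟨hg'.1, hvg, Function.update_of_ne ?_ _ _⟩
      rintro rfl
      exact hnot (mem_inside.2 hg')
  have h₀ : H.ends e₁ = {x, y} := Function.update_self _ _ _
  have hvH : v ∉ H.V := Finset.notMem_erase v _
  have hxH : x ∈ H.V := Finset.mem_erase.2 ⟨hxv, hx⟩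
  have hyH : y ∈ H.V := Finset.mem_erase.2 ⟨hyv, hy⟩
  have hzH : z ∈ H.V := Finset.mem_erase.2 ⟨hzv, hz⟩
  -- The new edge, named `e₁`, is not owned by both x and y; v goes next to an end that does not own
  -- it.
  by_cases hoy : own e₁ = y
  · obtain ⟨pos', own', hgood', ho'⟩ := hgood.insert_three (G := G) hV hvH hE hxH hyH hzH
      hxy.symm hxz.symm hyz m₁ m₂ m₃ n₁ n₂ n₃ (by rw [h₀, Finset.pair_comm])
      (by rw [hoy]; exact hxy.symm)
    exact ⟨pos', own', hgood', (ho' e hve).trans ho⟩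
  · obtain ⟨pos', own', hgood', ho'⟩ := hgood.insert_three (G := G) hV hvH hE hyH hxH hzH
      hxy hyz.symm hxz m₂ m₁ m₃ n₂ n₁ n₃ h₀ hoy
    exact ⟨pos', own', hgood', (ho' e hve).trans ho⟩

end MGraph

/-! ### Three blocking sets, and the induction -/

namespace MGraph

variable {α β : Type*} [DecidableEq α] [DecidableEq β]

/-- Around a vertex of degree three, three blocking sets that pairwise meet in one vertex
each. -/
structure Triangle (G : MGraph α β) (R : Finset α) (v x y z : α) (X Y Z : Finset α) : Prop where
  claw : G.Claw R v x y z
  hX : G.Blocks R v x y X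
  hY : G.Blocks R v y z Y
  hZ : G.Blocks R v x z Z
  notX : ¬ R ⊆ X
  notY : ¬ R ⊆ Y
  notZ : ¬ R ⊆ Z
  numX : 2 * X.card ≤ G.num X + 3
  numY : 2 * Y.card ≤ G.num Y + 3
  numZ : 2 * Z.card ≤ G.num Z + 3
  interXY : (X ∩ Y).card < 2
  interYZ : (Y ∩ Z).card < 2
  interXZ : (X ∩ Z).card < 2

namespace Triangle

variable {G : MGraph α β} {R : Finset α} {v x y z : α} {X Y Z : Finset α}

theorem rotate (h : G.Triangle R v x y z X Y Z) : G.Triangle R v y z x Y Z X :=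
  ⟨h.claw.rotate, h.hY, h.hZ.symm, h.hX.symm, h.notY, h.notZ, h.notX, h.numY, h.numZ, h.numX,
    h.interYZ, by rw [Finset.inter_comm]; exact h.interXZ,
    by rw [Finset.inter_comm]; exact h.interXY⟩

/-- If X and U shared two vertices, X ∪ U would block the pair x, y with 2|X ∪ U| - 2 edges, which
`Claw.not_num_add_two` excludes. -/
theorem not_subset (h : G.Triangle R v x y z X Y Z) {U : Finset α} (hU : U ⊆ G.V) (hvU : v ∉ U)
    (hn : 2 * U.card ≤ G.num U + 2) {W : Finset α} (hW : 2 ≤ W.card) (hWU : W ⊆ U) :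
    ¬ W ⊆ X := by
  intro hWX
  have h1 := Finset.card_le_card (Finset.subset_inter hWX hWU)
  have h2 := h.claw.tight.num_lt (X ∩ U) (Finset.inter_subset_left.trans h.hX.subset)
    (by omega) fun h' => h.notX (h'.trans Finset.inter_subset_left)
  have h3 := G.num_add_num_le X U
  have h4 := Finset.card_union_add_card_inter X U
  have h5 := h.numX
  have h6 : 2 * (X ∪ U).card ≤ G.num (X ∪ U) + 2 := by omega
  refine h.claw.not_num_add_two (X := X ∪ U) ⟨Finset.union_subset h.hX.subset hU, ?_,
    Finset.mem_union_left _ h.hX.left, Finset.mem_union_left _ h.hX.right, Or.inl h6⟩ h.hY h.hZ h6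
  rw [Finset.mem_union, not_or]
  exact ⟨h.hX.notMem, hvU⟩

theorem facts (h : G.Triangle R v x y z X Y Z) :
    R ⊆ X ∪ Y ∪ Z ∧ G.num (X ∪ Y ∪ Z) + 3 = 2 * (X ∪ Y ∪ Z).card ∧
      (∀ e ∈ G.E, G.ends e ⊆ X ∪ Y ∪ Z → G.ends e ⊆ X ∨ G.ends e ⊆ Y ∨ G.ends e ⊆ Z) ∧
      X ∩ Y = {y} ∧ Y ∩ Z = {z} ∧ X ∩ Z = {x} :=
  h.claw.union_of_inter_card_lt_two h.hX h.hY h.hZ h.numX h.numY h.numZ h.interXY h.interYZ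
    h.interXZ

theorem separation (h : G.Triangle R v x y z X Y Z)
    (hV : insert v (X ∪ Y ∪ Z) = G.V)
    (hends : ∀ e ∈ G.E, v ∈ G.ends e → G.ends e ⊆ {v, x, y, z}) (hX : 3 ≤ X.card) :
    G.Separation X (insert v (Y ∪ Z)) x y := by
  obtain ⟨-, -, hcov, hXY, -, hXZ⟩ := h.facts
  have hxy := h.claw.xy
  have hyY : y ∈ Y := h.hY.left
  have hzY : z ∈ Y := h.hY.right
  have hxZ : x ∈ Z := h.hZ.left
  have hsub : ({v, x, y, z} : Finset α) ⊆ insert v (Y ∪ Z) := by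
    simp [Finset.insert_subset_iff, hyY, hzY, hxZ]
  refine ⟨hxy, ?_, ?_, ?_, hX, ?_⟩
  · rw [← hV, Finset.union_insert, Finset.union_assoc]
  · rw [Finset.inter_insert_of_notMem h.hX.notMem, Finset.inter_union_distrib_left, hXY, hXZ,
      Finset.union_comm, ← Finset.insert_eq]
  · intro e he
    by_cases hve : v ∈ G.ends e
    · exact Or.inr ((hends e he hve).trans hsub)
    · have h1 : G.ends e ⊆ X ∪ Y ∪ Z := by
        rw [← Finset.subset_insert_iff_of_notMem hve, hV]
        exact h.claw.tight.ends_subset e he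
      rcases hcov e he h1 with h2 | h2 | h2
      · exact Or.inl h2
      · exact Or.inr (h2.trans (Finset.subset_union_left.trans (Finset.subset_insert _ _)))
      · exact Or.inr (h2.trans (Finset.subset_union_right.trans (Finset.subset_insert _ _)))
  · have h1 : ({v, x, y} : Finset α) ⊆ insert v (Y ∪ Z) := by
      simp [Finset.insert_subset_iff, hyY, hxZ]
    have h2 := Finset.card_le_card h1
    rwa [Finset.card_eq_three.2 ⟨v, x, y, fun h' => h.hX.notMem (h' ▸ h.hX.left),
      fun h' => h.hX.notMem (h' ▸ h.hX.right), hxy, rfl⟩] at h2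

theorem exists_good_of_three_le (h : G.Triangle R v x y z X Y Z)
    (hV : insert v (X ∪ Y ∪ Z) = G.V)
    (hends : ∀ e ∈ G.E, v ∈ G.ends e → G.ends e ⊆ {v, x, y, z}) (hX : 3 ≤ X.card)
    (hgen : ∀ X ⊆ G.V, X ≠ G.V → 2 ≤ X.card → G.num X + 3 ≤ 2 * X.card)
    (ih : ∀ H : MGraph α β, H.V.card < G.V.card → H.Solvable) {s t c : α} {e : β}
    (hG : G.Tight (insert t (G.ends e))) (he : e ∈ G.E) (hs : s ∈ G.ends e) (ht : t ∈ G.V)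
    (hts : t ≠ s) (hc : c ∈ G.ends e) : ∃ pos own, G.Good s t pos own ∧ own e = c := by
  have hsep := h.separation hV hends hX
  rcases hsep.cover e he with h1 | h1
  · exact hsep.exists_good hgen ih hG he hs ht hts hc h1
  · exact hsep.symm.exists_good hgen ih hG he hs ht hts hc h1

theorem exists_edge (h : G.Triangle R v x y z X Y Z) (hX : X.card < 3) :
    X = {x, y} ∧ ∃ e ∈ G.E, G.ends e = {x, y} := by
  have hs : ({x, y} : Finset α) ⊆ X := by
    simp [Finset.insert_subset_iff, h.hX.left, h.hX.right]
  have hc := Finset.card_pair h.claw.xy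
  have hXe : ({x, y} : Finset α) = X := Finset.eq_of_subset_of_card_le hs (by omega)
  refine ⟨hXe.symm, ?_⟩
  have h1 := h.numX
  rw [← hXe, hc] at h1
  have h2 : (G.inside {x, y}).Nonempty := by
    rw [← Finset.card_pos]
    unfold num at h1
    omega
  obtain ⟨e, he⟩ := h2
  rw [mem_inside] at he
  exact ⟨e, he.1, Finset.eq_of_subset_of_card_le he.2 (by rw [hc, h.claw.tight.card_ends e he.1])⟩

end Triangle

theorem exists_good_of_deg_three {G : MGraph α β}
    (ih : ∀ H : MGraph α β, H.V.card < G.V.card → H.Solvable) {s t c v : α} {e : β}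
    (hG : G.Tight (insert t (G.ends e))) (he : e ∈ G.E) (hs : s ∈ G.ends e) (ht : t ∈ G.V)
    (hts : t ≠ s) (hc : c ∈ G.ends e) (hv : v ∈ G.V) (hvR : v ∉ insert t (G.ends e))
    (hd : G.deg v = 3)
    (hU : (∃ U ⊆ G.V, v ∉ U ∧ 2 * U.card ≤ G.num U + 2 ∧ G.ends e ⊆ U) ∨
      ∀ X ⊆ G.V, X ≠ G.V → 2 ≤ X.card → G.num X + 3 ≤ 2 * X.card) :
    ∃ pos own, G.Good s t pos own ∧ own e = c := by
  set R := insert t (G.ends e) with hR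
  have hve : v ∉ G.ends e := fun h => hvR (Finset.mem_insert_of_mem h)
  have hvt : v ≠ t := fun h => hvR (h ▸ Finset.mem_insert_self _ _)
  have hec := hG.card_ends e he
  have hRc : 2 ≤ R.card := by
    rw [← hec]
    exact Finset.card_le_card (Finset.subset_insert _ _)
  obtain ⟨e₁, e₂, e₃, h12, h13, h23, hE⟩ := Finset.card_eq_three.1 hd
  have hmem : ∀ g, g ∈ G.E ∧ v ∈ G.ends g ↔ g = e₁ ∨ g = e₂ ∨ g = e₃ := by
    intro g
    have : g ∈ (G.E.filter fun e => v ∈ G.ends e) ↔ g ∈ ({e₁, e₂, e₃} : Finset β) := by rw [hE]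
    simpa using this
  have m₁ := (hmem e₁).2 (by simp)
  have m₂ := (hmem e₂).2 (by simp)
  have m₃ := (hmem e₃).2 (by simp)
  obtain ⟨x, hx, hxv, n₁⟩ := hG.exists_other m₁.1 m₁.2
  obtain ⟨y, hy, hyv, n₂⟩ := hG.exists_other m₂.1 m₂.2
  obtain ⟨z, hz, hzv, n₃⟩ := hG.exists_other m₃.1 m₃.2
  have hxy : x ≠ y := by
    rintro rfl
    exact h12 (hG.eq_of_ends_eq hRc hv hvR hx hxv m₁.1 m₂.1 n₁ n₂)
  have hxz : x ≠ z := by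
    rintro rfl
    exact h13 (hG.eq_of_ends_eq hRc hv hvR hx hxv m₁.1 m₃.1 n₁ n₃)
  have hyz : y ≠ z := by
    rintro rfl
    exact h23 (hG.eq_of_ends_eq hRc hv hvR hy hyv m₂.1 m₃.1 n₂ n₃)
  have hins : ∀ W, v ∉ W → x ∈ W → y ∈ W → z ∈ W →
      G.num W + 3 ≤ G.num (insert v W) := by
    intro W hvW hxW hyW hzW
    have hdis : Disjoint (G.inside W) {e₁, e₂, e₃} := by
      rw [Finset.disjoint_left]
      intro g hg hg'
      simp only [Finset.mem_insert, Finset.mem_singleton] at hg'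
      exact hvW ((mem_inside.1 hg).2 ((hmem g).2 hg').2)
    have hsub : G.inside W ∪ {e₁, e₂, e₃} ⊆ G.inside (insert v W) := by
      apply Finset.union_subset (G.inside_mono (Finset.subset_insert _ _))
      intro g hg
      simp only [Finset.mem_insert, Finset.mem_singleton] at hg
      rw [mem_inside]
      refine ⟨((hmem g).2 hg).1, ?_⟩
      rcases hg with rfl | rfl | rfl
      · simp [n₁, Finset.insert_subset_iff, hxW]
      · simp [n₂, Finset.insert_subset_iff, hyW]
      · simp [n₃, Finset.insert_subset_iff, hzW]
    have := Finset.card_le_card hsub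
    rwa [Finset.card_union_of_disjoint hdis,
      Finset.card_eq_three.2 ⟨e₁, e₂, e₃, h12, h13, h23, rfl⟩] at this
  have hclaw : G.Claw R v x y z := by
    refine ⟨hG, hxy, hyz, hxz, ?_, ?_⟩
    · intro W hW hvW hxW hyW hzW
      have h1 := hins W hvW hxW hyW hzW
      have h2 := hG.num_le' (X := insert v W) (Finset.insert_subset hv hW) ⟨v, by simp⟩
      rw [Finset.card_insert_of_notMem hvW] at h2
      omega
    · intro W hW hvW hxW hyW hzW hRW
      have h1 := hins W hvW hxW hyW hzW
      have hcW : 0 < W.card := Finset.card_pos.2 ⟨x, hxW⟩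
      have h2 := hG.num_lt (insert v W) (Finset.insert_subset hv hW)
        (by rw [Finset.card_insert_of_notMem hvW]; omega)
        (by rwa [Finset.subset_insert_iff_of_notMem hvR])
      rw [Finset.card_insert_of_notMem hvW] at h2
      omega
  by_contra hno
  obtain ⟨X, hX⟩ : ∃ X, G.Blocks R v x y X := by
    by_contra! hb
    exact hno (exists_good_of_not_blocks ih hG he hs ht hts hc hv hvR hd m₁.1 m₂.1 m₃.1 n₁ n₂ n₃
      hx hy hz hxv hyv hzv hxy hyz hxz hb)
  obtain ⟨Y, hY⟩ : ∃ Y, G.Blocks R v y z Y := by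
    by_contra! hb
    exact hno (exists_good_of_not_blocks ih hG he hs ht hts hc hv hvR hd m₂.1 m₃.1 m₁.1 n₂ n₃ n₁
      hy hz hx hyv hzv hxv hyz hxz.symm hxy.symm hb)
  obtain ⟨Z, hZ⟩ : ∃ Z, G.Blocks R v x z Z := by
    by_contra! hb
    exact hno (exists_good_of_not_blocks ih hG he hs ht hts hc hv hvR hd m₁.1 m₃.1 m₂.1 n₁ n₃ n₂
      hx hz hy hxv hzv hyv hxz hyz.symm hxy hb)
  have bX := hX.le.resolve_left fun h' => hclaw.not_num_add_two hX hY hZ h'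
  have bY := hY.le.resolve_left fun h' => hclaw.rotate.not_num_add_two hY hZ.symm hX.symm h'
  have bZ := hZ.le.resolve_left fun h' =>
    hclaw.rotate.rotate.not_num_add_two hZ.symm hX hY.symm h'
  have hT : G.Triangle R v x y z X Y Z :=
    ⟨hclaw, hX, hY, hZ, bX.1, bY.1, bZ.1, bX.2, bY.2, bZ.2,
      hclaw.inter_card_lt_two hX hY hZ bX.1 bY.1 bZ.1 bX.2 bY.2 bZ.2 he hR.symm,
      hclaw.rotate.inter_card_lt_two hY hZ.symm hX.symm bY.1 bZ.1 bX.1 bY.2 bZ.2 bX.2 he hR.symm,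
      by
        rw [Finset.inter_comm]
        exact hclaw.rotate.rotate.inter_card_lt_two hZ.symm hX hY.symm bZ.1 bX.1 bY.1 bZ.2 bX.2
          bY.2 he hR.symm⟩
  obtain ⟨hfull, hnum, hcov, -, -, -⟩ := hT.facts
  -- The edge e lies inside one of the blocking sets. If it also lies in a set U with 2|U| - 2 edges
  -- avoiding v, this is a contradiction.
  have heW := hcov e he ((Finset.subset_insert _ _).trans hfull)
  rcases hU with ⟨U, hUV, hvU, hUn, heU⟩ | hgen
  · rcases heW with h1 | h1 | h1
    · exact hT.not_subset hUV hvU hUn hec.ge heU h1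
    · exact hT.rotate.not_subset hUV hvU hUn hec.ge heU h1
    · exact hT.rotate.rotate.not_subset hUV hvU hUn hec.ge heU h1
  · have hvW : v ∉ X ∪ Y ∪ Z := by simp [hX.notMem, hY.notMem, hZ.notMem]
    -- The union W of the blocking sets has 2|W| - 3 edges, and v adds three, so W with v attains
    -- 2|W ∪ {v}| - 2 and cannot be proper.
    have hV : insert v (X ∪ Y ∪ Z) = G.V := by
      by_contra hne
      have h1 := hins (X ∪ Y ∪ Z) hvW (by simp [hX.left]) (by simp [hX.right])
        (by simp [hY.right])
      have hpos : 0 < (X ∪ Y ∪ Z).card := Finset.card_pos.2 ⟨x, by simp [hX.left]⟩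
      have h2 := hgen _ (Finset.insert_subset hv (Finset.union_subset
        (Finset.union_subset hX.subset hY.subset) hZ.subset)) hne
        (by rw [Finset.card_insert_of_notMem hvW]; omega)
      rw [Finset.card_insert_of_notMem hvW] at h2
      omega
    have hends : ∀ g ∈ G.E, v ∈ G.ends g → G.ends g ⊆ {v, x, y, z} := by
      intro g hg hvg
      rcases (hmem g).1 ⟨hg, hvg⟩ with rfl | rfl | rfl
      · simp [n₁, Finset.insert_subset_iff]
      · simp [n₂, Finset.insert_subset_iff]
      · simp [n₃, Finset.insert_subset_iff]
    have cX : X.card < 3 := by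
      by_contra! h3
      exact hno (hT.exists_good_of_three_le hV hends h3 hgen ih hG he hs ht hts hc)
    have cY : Y.card < 3 := by
      by_contra! h3
      refine hno (hT.rotate.exists_good_of_three_le ?_ ?_ h3 hgen ih hG he hs ht hts hc)
      · rw [← hV]
        congr 1
        rw [Finset.union_assoc, Finset.union_assoc, Finset.union_comm X, Finset.union_assoc]
      · intro g hg hvg
        refine (hends g hg hvg).trans ?_
        simp [Finset.insert_subset_iff]
    have cZ : Z.card < 3 := by
      by_contra! h3
      refine hno (hT.rotate.rotate.exists_good_of_three_le ?_ ?_ h3 hgen ih hG he hs ht hts hc)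
      · rw [← hV]
        congr 1
        rw [Finset.union_assoc, Finset.union_comm Z]
      · intro g hg hvg
        refine (hends g hg hvg).trans ?_
        simp [Finset.insert_subset_iff]
    obtain ⟨eX, fX, mX, nX⟩ := hT.exists_edge cX
    obtain ⟨eY, fY, mY, nY⟩ := hT.rotate.exists_edge cY
    obtain ⟨eZ, fZ, mZ, nZ⟩ := hT.rotate.rotate.exists_edge cZ
    obtain ⟨w, hw, hws, hn⟩ := hG.exists_other he hs
    -- Otherwise R consists of the ends of e and is contained in one blocking set.
    have hte : t ∉ G.ends e := by
      intro h'
      rw [hR, Finset.insert_eq_of_mem h'] at bX bY bZ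
      rcases heW with h1 | h1 | h1
      · exact bX.1 h1
      · exact bY.1 h1
      · exact bZ.1 h1
    have htw : t ≠ w := fun h' => hte (by simp [hn, h'])
    have hWxyz : X ∪ Y ∪ Z = {x, y, z} := by
      rw [eX, eY, eZ]
      clear * -
      ext u
      simp only [Finset.mem_union, Finset.mem_insert, Finset.mem_singleton]
      tauto
    have hRW : R = {x, y, z} := by
      apply Finset.eq_of_subset_of_card_le (hWxyz ▸ hfull)
      rw [Finset.card_eq_three.2 ⟨x, y, z, hxy, hxz, hyz, rfl⟩, hR,
        Finset.card_insert_of_notMem hte, hec]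
    have hVs : G.V = {s, v, w, t} := by
      rw [← hV, hWxyz, ← hRW, hR, hn]
      clear * -
      ext u
      simp only [Finset.mem_insert, Finset.mem_singleton]
      tauto
    have hvs : v ≠ s := fun h' => hve (h' ▸ hs)
    have hvw : v ≠ w := fun h' => hve (by simp [hn, h'])
    refine hno (exists_good_of_complete hVs hvs.symm hws.symm hts.symm hvw hvt htw.symm ?_ hn
      (by simpa [hn] using hc))
    rw [← hV, hWxyz]
    intro p hp q hq hpq
    have c₁ : G.ends e₁ = {x, v} := n₁.trans (Finset.pair_comm _ _)
    have c₂ : G.ends e₂ = {y, v} := n₂.trans (Finset.pair_comm _ _)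
    have c₃ : G.ends e₃ = {z, v} := n₃.trans (Finset.pair_comm _ _)
    have cX' : G.ends fX = {y, x} := nX.trans (Finset.pair_comm _ _)
    have cY' : G.ends fY = {z, y} := nY.trans (Finset.pair_comm _ _)
    have cZ' : G.ends fZ = {x, z} := nZ.trans (Finset.pair_comm _ _)
    simp only [Finset.mem_insert, Finset.mem_singleton] at hp hq
    rcases hp with rfl | rfl | rfl | rfl <;> rcases hq with rfl | rfl | rfl | rfl <;>
      first
      | exact absurd rfl hpq
      | exact ⟨_, m₁.1, by assumption⟩
      | exact ⟨_, m₂.1, by assumption⟩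
      | exact ⟨_, m₃.1, by assumption⟩
      | exact ⟨_, mX, by assumption⟩
      | exact ⟨_, mY, by assumption⟩
      | exact ⟨_, mZ, by assumption⟩

theorem solvable (G : MGraph α β) : G.Solvable := by
  induction hN : G.V.card using Nat.strong_induction_on generalizing G with
  | _ N IH =>
    subst hN
    have ih : ∀ H : MGraph α β, H.V.card < G.V.card → H.Solvable := fun H hH => IH _ hH H rfl
    by_cases h2 : G.V.card = 2
    · exact exists_good_of_card_eq_two h2
    intro s t e c hG he hs ht hts hc
    have hsub := hG.ends_subset e he
    have hec := hG.card_ends e he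
    have h3 : 3 ≤ G.V.card := by
      have := Finset.card_le_card hsub
      omega
    have hRV : insert t (G.ends e) ⊆ G.V := Finset.insert_subset ht hsub
    have main : ∀ v ∈ G.V, v ∉ insert t (G.ends e) → G.deg v ≤ 3 →
        ((∃ U ⊆ G.V, v ∉ U ∧ 2 * U.card ≤ G.num U + 2 ∧ G.ends e ⊆ U) ∨
        ∀ X ⊆ G.V, X ≠ G.V → 2 ≤ X.card → G.num X + 3 ≤ 2 * X.card) →
        ∃ pos own, G.Good s t pos own ∧ own e = c := by
      intro v hv hvR hd hU
      have h2d := hG.two_le_deg h3 hv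
      rcases (by omega : G.deg v = 2 ∨ G.deg v = 3) with hd | hd
      · exact exists_good_of_deg_two ih hG he hs ht hts hc hv hvR hd
      · exact exists_good_of_deg_three ih hG he hs ht hts hc hv hvR hd hU
    by_cases hgen : ∀ X ⊆ G.V, X ≠ G.V → 2 ≤ X.card → G.num X + 3 ≤ 2 * X.card
    · obtain ⟨v, hv, hvR, hd⟩ := hG.exists_deg_le_three h3 hRV (by
        have := Finset.card_insert_le t (G.ends e)
        omega)
      exact main v hv hvR hd (Or.inr hgen)
    · push Not at hgen
      obtain ⟨U, hUV, hne, hU2, hUn⟩ := hgen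
      have hRU : insert t (G.ends e) ⊆ U := by
        by_contra hcon
        have := hG.num_lt U hUV hU2 hcon
        omega
      have hle := hG.num_le U hUV hU2
      obtain ⟨v, hv, hvU, hd⟩ := hG.exists_deg_le_three_of_num hUV hne (by omega)
      exact main v hv (fun h' => hvU (hRU h')) hd
        (Or.inl ⟨U, hUV, hvU, by omega, (Finset.subset_insert _ _).trans hRU⟩)

end MGraph

/-! ### Edge counts in trees and 2T-graphs -/

namespace Graph

variable {α β : Type*}

/-- `v` is reached from `r` by a walk of length `n`. -/
def ReachedIn (T : Graph α β) (r : α) : ℕ → α → Prop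
  | 0, v => v = r
  | n + 1, v => ∃ u, T.ReachedIn r n u ∧ T.Adj u v

theorem exists_reachedIn {T : Graph α β} {r v : α} (h : Relation.ReflTransGen T.Adj r v) :
    ∃ n, T.ReachedIn r n v := by
  induction h with
  | refl => exact ⟨0, rfl⟩
  | tail _ hbc ih =>
    obtain ⟨n, hn⟩ := ih
    exact ⟨n + 1, _, hn, hbc⟩

/-- In a tree, the edges correspond to the vertices other than a root. -/
theorem IsTree.exists_child {T : Graph α β} (hT : T.IsTree) :
    ∃ r ∈ V(T), ∃ (d : α → ℕ) (ch : β → α),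
      (∀ e ∈ E(T), ∃ u, T.IsLink e u (ch e) ∧ d u < d (ch e)) ∧
      Set.InjOn ch E(T) ∧ ch '' E(T) = V(T) \ {r} := by
  classical
  obtain ⟨⟨⟨r, hr⟩, hconn⟩, hforest⟩ := hT
  set d : α → ℕ := fun v => sInf {n | T.ReachedIn r n v} with hd
  have hpar : ∀ v : {v // v ∈ V(T) ∧ v ≠ r}, ∃ e u, T.IsLink e u v ∧ d u < d v := by
    rintro ⟨v, hv, hvr⟩
    have hmem : T.ReachedIn r (d v) v := Nat.sInf_mem (exists_reachedIn (hconn r hr v hv))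
    show ∃ e u, T.IsLink e u v ∧ d u < d v
    rcases hdv : d v with _ | n
    · rw [hdv] at hmem
      exact absurd hmem hvr
    · rw [hdv] at hmem
      obtain ⟨u, hu, e, he⟩ := hmem
      exact ⟨e, u, he, Nat.lt_succ_of_le (Nat.sInf_le hu)⟩
  choose p q hpq hlt using hpar
  have hinj : Function.Injective p := by
    intro v w hvw
    have h1 := hpq w
    rw [← hvw] at h1
    rcases (hpq v).eq_and_eq_or_eq_and_eq h1 with h2 | h2
    · exact Subtype.ext h2.2
    · have h3 := hlt v
      have h4 := hlt w
      rw [h2.1] at h3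
      rw [← h2.2] at h4
      exact absurd h3 h4.not_gt
  -- If e were no parent edge, both of its ends would still reach r along parent edges after
  -- deleting e, against acyclicity.
  have hsurj : ∀ e ∈ E(T), ∃ v, p v = e := by
    intro e he
    by_contra! hcon
    obtain ⟨x, y, hxy⟩ := exists_isLink_of_mem_edgeSet he
    apply hforest e x y hxy
    have key : ∀ n, ∀ v ∈ V(T), d v = n → Relation.ReflTransGen (T.deleteEdges {e}).Adj v r := by
      intro n
      induction n using Nat.strong_induction_on with
      | _ n ih =>
        intro v hv hvn
        by_cases hvr : v = r
        · rw [hvr]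
        · have h1 := hpq ⟨v, hv, hvr⟩
          refine Relation.ReflTransGen.head ⟨p ⟨v, hv, hvr⟩, ?_⟩
            (ih _ (hvn ▸ hlt ⟨v, hv, hvr⟩) _ h1.left_mem rfl)
          have : (T.deleteEdges {e}).IsLink (p ⟨v, hv, hvr⟩) v (q ⟨v, hv, hvr⟩) ↔
            T.IsLink (p ⟨v, hv, hvr⟩) v (q ⟨v, hv, hvr⟩) ∧ p ⟨v, hv, hvr⟩ ∉ ({e} : Set β) :=
            Iff.rfl
          exact this.2 ⟨h1.symm, by simpa using hcon ⟨v, hv, hvr⟩⟩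
    refine (key _ x hxy.left_mem rfl).trans ?_
    exact symm (key _ y hxy.right_mem rfl)
  have : ∃ ch : β → α, ∀ e ∈ E(T), ∃ v, p v = e ∧ ch e = v.1 := by
    have : ∀ e, ∃ a, e ∈ E(T) → ∃ v, p v = e ∧ a = v.1 := by
      intro e
      by_cases he : e ∈ E(T)
      · obtain ⟨v, hv⟩ := hsurj e he
        exact ⟨v, fun _ => ⟨v, hv, rfl⟩⟩
      · exact ⟨r, fun h => absurd h he⟩
    choose ch hch using this
    exact ⟨ch, hch⟩
  obtain ⟨ch, hch⟩ := this
  refine ⟨r, hr, d, ch, ?_, ?_, ?_⟩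
  · intro e he
    obtain ⟨v, rfl, hv⟩ := hch e he
    rw [hv]
    exact ⟨q v, hpq v, hlt v⟩
  · intro e he f hf hef
    obtain ⟨v, rfl, hv⟩ := hch e he
    obtain ⟨w, rfl, hw⟩ := hch f hf
    rw [hv, hw] at hef
    rw [Subtype.ext hef]
  · ext v
    constructor
    · rintro ⟨e, he, rfl⟩
      obtain ⟨w, -, hw⟩ := hch e he
      rw [hw]
      exact ⟨w.2.1, w.2.2⟩
    · rintro ⟨hv, hvr⟩
      obtain ⟨w, hpw, hw⟩ := hch _ (hpq ⟨v, hv, hvr⟩).edge_mem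
      exact ⟨_, (hpq ⟨v, hv, hvr⟩).edge_mem, by rw [hw, hinj hpw]⟩

theorem IsTree.finite_edgeSet {T : Graph α β} (hT : T.IsTree) (hV : V(T).Finite) :
    E(T).Finite := by
  obtain ⟨r, -, d, ch, -, h2, h3⟩ := hT.exists_child
  exact Set.Finite.of_finite_image (h3 ▸ hV.sdiff) h2

theorem IsTree.ncard_edgeSet {T : Graph α β} (hT : T.IsTree) (hV : V(T).Finite) :
    E(T).ncard + 1 = V(T).ncard := by
  obtain ⟨r, hr, d, ch, -, h2, h3⟩ := hT.exists_child
  rw [← h2.ncard_image, h3, Set.ncard_sdiff_singleton_add_one hr hV]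

/-- A vertex of X nearest to the root is the child end of no edge inside X. -/
theorem IsTree.ncard_edgeSet_induce {T : Graph α β} (hT : T.IsTree) {X : Set α} (hX : X.Finite)
    (hne : X.Nonempty) : E(T.induce X).ncard + 1 ≤ X.ncard := by
  obtain ⟨r, hr, d, ch, h1, h2, -⟩ := hT.exists_child
  obtain ⟨m, hm, hmin⟩ := Set.exists_min_image X d hX hne
  have hsub : E(T.induce X) ⊆ E(T) := by
    rintro e ⟨x, y, h, -, -⟩
    exact h.edge_mem
  rw [← Set.ncard_sdiff_singleton_add_one hm hX, ← (h2.mono hsub).ncard_image]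
  refine Nat.succ_le_succ (Set.ncard_le_ncard ?_ hX.sdiff)
  rintro - ⟨e, he, rfl⟩
  obtain ⟨u, hu, hd⟩ := h1 e (hsub he)
  obtain ⟨x, y, h, hx, hy⟩ := he
  have huX : u ∈ X := by
    rcases hu.left_eq_or_eq h with rfl | rfl <;> assumption
  have hcX : ch e ∈ X := by
    rcases hu.right_eq_or_eq h with h' | h' <;> rw [h'] <;> assumption
  refine ⟨hcX, fun h' => ?_⟩
  rw [Set.mem_singleton_iff.1 h'] at hd
  exact absurd hd (hmin u huX).not_gt

theorem IsTwoTGraph.finite_edgeSet {G : Graph α β} (hG : G.IsTwoTGraph) (hV : V(G).Finite) :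
    E(G).Finite := by
  obtain ⟨T₁, T₂, hs₁, hs₂, ht₁, ht₂, -, hE⟩ := hG
  rw [← hE]
  exact (ht₁.finite_edgeSet (hs₁.vertexSet_eq ▸ hV)).union
    (ht₂.finite_edgeSet (hs₂.vertexSet_eq ▸ hV))

theorem IsTwoTGraph.ncard_edgeSet {G : Graph α β} (hG : G.IsTwoTGraph) (hV : V(G).Finite) :
    E(G).ncard + 2 = 2 * V(G).ncard := by
  obtain ⟨T₁, T₂, hs₁, hs₂, ht₁, ht₂, hd, hE⟩ := hG
  have h1 : V(T₁).Finite := hs₁.vertexSet_eq ▸ hV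
  have h2 : V(T₂).Finite := hs₂.vertexSet_eq ▸ hV
  have h3 := ht₁.ncard_edgeSet h1
  have h4 := ht₂.ncard_edgeSet h2
  rw [hs₁.vertexSet_eq] at h3
  rw [hs₂.vertexSet_eq] at h4
  rw [← hE, Set.ncard_union_eq hd (ht₁.finite_edgeSet h1) (ht₂.finite_edgeSet h2)]
  omega

theorem IsTwoTGraph.ncard_edgeSet_induce {G : Graph α β} (hG : G.IsTwoTGraph)
    (hV : V(G).Finite) {X : Set α} (hX : X ⊆ V(G)) (hne : X.Nonempty) :
    E(G.induce X).ncard + 2 ≤ 2 * X.ncard := by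
  obtain ⟨T₁, T₂, hs₁, hs₂, ht₁, ht₂, hd, hE⟩ := hG
  have h1 : V(T₁).Finite := hs₁.vertexSet_eq ▸ hV
  have h2 : V(T₂).Finite := hs₂.vertexSet_eq ▸ hV
  have hXf := hV.subset hX
  have h3 := ht₁.ncard_edgeSet_induce hXf hne
  have h4 := ht₂.ncard_edgeSet_induce hXf hne
  have hsub : E(G.induce X) ⊆ E(T₁.induce X) ∪ E(T₂.induce X) := by
    rintro e ⟨x, y, h, hx, hy⟩
    have he := h.edge_mem
    rw [← hE] at he
    rcases he with he | he
    · obtain ⟨a, b, hab⟩ := exists_isLink_of_mem_edgeSet he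
      have := hab.mono hs₁.le
      rcases h.eq_and_eq_or_eq_and_eq this with ⟨rfl, rfl⟩ | ⟨rfl, rfl⟩
      · exact Or.inl ⟨_, _, hab, hx, hy⟩
      · exact Or.inl ⟨_, _, hab, hy, hx⟩
    · obtain ⟨a, b, hab⟩ := exists_isLink_of_mem_edgeSet he
      have := hab.mono hs₂.le
      rcases h.eq_and_eq_or_eq_and_eq this with ⟨rfl, rfl⟩ | ⟨rfl, rfl⟩
      · exact Or.inr ⟨_, _, hab, hx, hy⟩
      · exact Or.inr ⟨_, _, hab, hy, hx⟩
  have hfin : ∀ {T : Graph α β}, T.IsTree → V(T).Finite → E(T.induce X).Finite := by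
    intro T hT hVT
    refine (hT.finite_edgeSet hVT).subset ?_
    rintro e ⟨x, y, h, -, -⟩
    exact h.edge_mem
  have h5 := Set.ncard_le_ncard hsub ((hfin ht₁ h1).union (hfin ht₂ h2))
  have h6 := Set.ncard_union_le E(T₁.induce X) E(T₂.induce X)
  omega

theorem IsTwoTGraph.ne_of_isLink {G : Graph α β} (hG : G.IsTwoTGraph) {e : β} {x y : α}
    (h : G.IsLink e x y) : x ≠ y := by
  rintro rfl
  obtain ⟨T₁, T₂, hs₁, hs₂, ht₁, ht₂, -, hE⟩ := hG
  have he := h.edge_mem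
  rw [← hE] at he
  rcases he with he | he
  · obtain ⟨a, b, hab⟩ := exists_isLink_of_mem_edgeSet he
    rcases h.eq_and_eq_or_eq_and_eq (hab.mono hs₁.le) with ⟨rfl, rfl⟩ | ⟨rfl, rfl⟩ <;>
      exact ht₁.2 e _ _ hab .refl
  · obtain ⟨a, b, hab⟩ := exists_isLink_of_mem_edgeSet he
    rcases h.eq_and_eq_or_eq_and_eq (hab.mono hs₂.le) with ⟨rfl, rfl⟩ | ⟨rfl, rfl⟩ <;>
      exact ht₂.2 e _ _ hab .refl

end Graph

/-! ### Translation between the two notions of multigraph -/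

namespace MGraph

variable {α β : Type*} [DecidableEq α]

/-- `M` is loopless, has `2|V| - 2` edges, and every non-empty vertex set `X` spans at most
`2|X| - 2` of them. -/
structure Sparse (M : MGraph α β) : Prop where
  ends_subset : ∀ e ∈ M.E, M.ends e ⊆ M.V
  card_ends : ∀ e ∈ M.E, (M.ends e).card = 2
  card_edges : M.E.card + 2 = 2 * M.V.card
  num_le : ∀ X ⊆ M.V, X.Nonempty → M.num X + 2 ≤ 2 * X.card

/-- `X` induces a generic circuit of `M`. -/
structure IsCircuit (M : MGraph α β) (X : Finset α) : Prop where
  subset : X ⊆ M.V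
  two_le : 2 ≤ X.card
  num_eq : M.num X + 2 = 2 * X.card
  num_le : ∀ Y ⊆ X, Y ≠ X → 2 ≤ Y.card → M.num Y + 3 ≤ 2 * Y.card

end MGraph

namespace Graph

open Classical in
/-- The multigraph `G` as an `MGraph`. -/
noncomputable def toMGraph {α β : Type*} (G : Graph α β) (hV : V(G).Finite) (hE : E(G).Finite) :
    MGraph α β := ⟨hV.toFinset, hE.toFinset, fun e => hV.toFinset.filter fun x => G.Inc e x⟩

section toMGraph

variable {α β : Type*} [DecidableEq α] {G : Graph α β} {hV : V(G).Finite} {hE : E(G).Finite}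

theorem mem_ends_toMGraph {e : β} {x : α} : x ∈ (G.toMGraph hV hE).ends e ↔ G.Inc e x := by
  simp only [toMGraph, Finset.mem_filter, Set.Finite.mem_toFinset, and_iff_right_iff_imp]
  exact fun h => h.vertex_mem

theorem mem_E_toMGraph {e : β} : e ∈ (G.toMGraph hV hE).E ↔ e ∈ E(G) := by
  simp [toMGraph]

theorem mem_V_toMGraph {x : α} : x ∈ (G.toMGraph hV hE).V ↔ x ∈ V(G) := by
  simp [toMGraph]

theorem IsLink.ends_toMGraph {e : β} {x y : α} (h : G.IsLink e x y) :
    (G.toMGraph hV hE).ends e = {x, y} := by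
  ext u
  rw [mem_ends_toMGraph, Finset.mem_insert, Finset.mem_singleton]
  refine ⟨fun hu => hu.eq_or_eq_of_isLink h, ?_⟩
  rintro (rfl | rfl)
  · exact h.inc_left
  · exact h.inc_right

theorem isLink_of_ends_toMGraph {e : β} {x y : α} (h : (G.toMGraph hV hE).ends e = {x, y}) :
    G.IsLink e x y := by
  rw [isLink_iff_inc, ← mem_ends_toMGraph (hV := hV) (hE := hE),
    ← mem_ends_toMGraph (hV := hV) (hE := hE), h]
  refine ⟨by simp, by simp, fun z hz => ?_⟩
  rw [← mem_ends_toMGraph (hV := hV) (hE := hE), h] at hz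
  simpa using hz

theorem num_toMGraph (X : Finset α) :
    (G.toMGraph hV hE).num X = E(G.induce (X : Set α)).ncard := by
  rw [MGraph.num, ← Set.ncard_coe_finset]
  congr 1
  ext e
  rw [Finset.mem_coe, MGraph.mem_inside, mem_E_toMGraph]
  constructor
  · rintro ⟨he, hs⟩
    obtain ⟨x, y, hxy⟩ := exists_isLink_of_mem_edgeSet he
    exact ⟨x, y, hxy, hs (mem_ends_toMGraph.2 hxy.inc_left), hs (mem_ends_toMGraph.2 hxy.inc_right)⟩
  · rintro ⟨x, y, hxy, hx, hy⟩
    refine ⟨hxy.edge_mem, ?_⟩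
    rw [hxy.ends_toMGraph, Finset.insert_subset_iff, Finset.singleton_subset_iff]
    exact ⟨hx, hy⟩

theorem IsTwoTGraph.sparse (hG : G.IsTwoTGraph) : (G.toMGraph hV hE).Sparse where
  ends_subset e _ x hx := mem_V_toMGraph.2 (mem_ends_toMGraph.1 hx).vertex_mem
  card_ends e he := by
    obtain ⟨x, y, hxy⟩ := exists_isLink_of_mem_edgeSet (mem_E_toMGraph.1 he)
    rw [hxy.ends_toMGraph, Finset.card_pair (hG.ne_of_isLink hxy)]
  card_edges := by
    have := hG.ncard_edgeSet hV
    simp only [toMGraph]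
    rwa [← Set.ncard_eq_toFinset_card _ hV, ← Set.ncard_eq_toFinset_card _ hE]
  num_le X hX hne := by
    rw [num_toMGraph, ← Set.ncard_coe_finset X]
    exact hG.ncard_edgeSet_induce hV (fun x hx => mem_V_toMGraph.1 (hX hx)) hne

theorem IsCircuitOf.isCircuit {X : Finset α} (hX : G.IsCircuitOf X) :
    (G.toMGraph hV hE).IsCircuit X := by
  obtain ⟨hXV, -, -, -, h4, h5, h6⟩ := hX
  have hVX : V(G.induce (X : Set α)) = X := rfl
  rw [hVX, Set.ncard_coe_finset, ← num_toMGraph (hV := hV) (hE := hE)] at h4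
  rw [← num_toMGraph (hV := hV) (hE := hE)] at h5
  refine ⟨fun x hx => mem_V_toMGraph.2 (hXV hx), by omega, by omega, ?_⟩
  intro Y hY hne h2
  have := h6 Y ((Finset.coe_ssubset).2 (hY.ssubset_of_ne hne)) (by rwa [Set.ncard_coe_finset])
  have heq : E((G.induce (X : Set α)).induce (Y : Set α)) = E(G.induce (Y : Set α)) := by
    ext e
    constructor
    · rintro ⟨x, y, h, hx, hy⟩
      exact ⟨x, y, h.1, hx, hy⟩
    · rintro ⟨x, y, h, hx, hy⟩
      exact ⟨x, y, ⟨h, hY hx, hY hy⟩, hx, hy⟩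
  rw [heq, ← num_toMGraph (hV := hV) (hE := hE), Set.ncard_coe_finset] at this
  omega

end toMGraph

end Graph

/-! ### Circuits and the ordering of a hyperpath -/

namespace MGraph

variable {α β : Type*} [DecidableEq α] [DecidableEq β]

/-- An intersection with two or more vertices spans at most 2|X ∩ Y| - 3 edges, which pushes the
union above 2|X ∪ Y| - 2. -/
theorem IsCircuit.card_inter_le_one {M : MGraph α β} (hM : M.Sparse) {X Y : Finset α}
    (hX : M.IsCircuit X) (hY : M.IsCircuit Y) (hne : X ≠ Y) : (X ∩ Y).card ≤ 1 := by
  by_contra! hc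
  have hX0 : X.Nonempty := Finset.card_pos.1 (by have := hX.two_le; omega)
  by_cases hXY : X ∩ Y = X
  · have hs : X ⊆ Y := Finset.inter_eq_left.1 hXY
    have h1 := hY.num_le X hs hne hX.two_le
    have h2 := hX.num_eq
    omega
  · have h1 := hX.num_le (X ∩ Y) Finset.inter_subset_left hXY hc
    have h2 := M.num_add_num_le X Y
    have h3 := Finset.card_union_add_card_inter X Y
    have h4 := hM.num_le (X ∪ Y) (Finset.union_subset hX.subset hY.subset)
      (hX0.mono Finset.subset_union_left)
    have h5 := hX.num_eq
    have h6 := hY.num_eq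
    omega

/-- A generic circuit has a good ordering with any two prescribed extreme vertices. -/
theorem IsCircuit.exists_good {M : MGraph α β} (hM : M.Sparse) {X : Finset α}
    (hX : M.IsCircuit X) {s t : α} (hs : s ∈ X) (ht : t ∈ X) (hts : t ≠ s) :
    ∃ pos own, (M.restrict X).Good s t pos own := by
  -- In a circuit only X itself attains the bound, so the exception for sets containing R is never
  -- used by a proper subset.
  have htight : ∀ R ⊆ X, (M.restrict X).Tight R := by
    intro R hR
    refine ⟨fun e he => (mem_inside.1 he).2, fun e he => hM.card_ends e (mem_inside.1 he).1,
      hX.num_eq, ?_, ?_⟩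
    · intro Y hY h2
      replace hY : Y ⊆ X := hY
      rw [num_restrict M hY]
      exact hM.num_le Y (hY.trans hX.subset) (Finset.card_pos.1 (by omega))
    · intro Y hY h2 hRY
      replace hY : Y ⊆ X := hY
      rw [num_restrict M hY]
      exact hX.num_le Y hY (fun h' => hRY (h' ▸ hR)) h2
  obtain ⟨e, he, hse⟩ : ∃ e ∈ M.inside X, s ∈ M.ends e := by
    by_contra! hcon
    have h1 : M.inside X ⊆ M.inside (X.erase s) := by
      intro e he
      rw [mem_inside] at he ⊢
      exact ⟨he.1, Finset.subset_erase.2 ⟨he.2, hcon e (mem_inside.2 he)⟩⟩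
    have h2 := Finset.card_le_card h1
    have h3 := hM.num_le (X.erase s) ((Finset.erase_subset _ _).trans hX.subset)
      ⟨t, Finset.mem_erase.2 ⟨hts, ht⟩⟩
    have h4 := Finset.card_erase_of_mem hs
    have h5 := hX.num_eq
    have h6 := hX.two_le
    unfold num at h3 h5
    omega
  obtain ⟨pos, own, h, -⟩ := (M.restrict X).solvable s t e s
    (htight _ (Finset.insert_subset ht (mem_inside.1 he).2)) he hse ht hts hse
  exact ⟨pos, own, h⟩

/-- The shared vertex p lacks only an edge up in X and an edge down in Y, and each part supplies
what the other lacks. Y is translated so that the positions of p agree. -/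
theorem PreGood.concat {M : MGraph α β} (hM : ∀ e ∈ M.E, (M.ends e).card = 2) {X Y : Finset α}
    {s t p : α} {posX posY : α → ℚ} {ownX ownY : β → α}
    (hX : (M.restrict X).PreGood s p posX ownX) (hY : (M.restrict Y).PreGood p t posY ownY)
    (hXY : X ∩ Y = {p}) : ∃ pos own, (M.restrict (X ∪ Y)).PreGood s t pos own := by
  have hpX : p ∈ X := (Finset.mem_inter.1 (hXY ▸ Finset.mem_singleton_self p)).1
  have hpY : p ∈ Y := (Finset.mem_inter.1 (hXY ▸ Finset.mem_singleton_self p)).2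
  set pos : α → ℚ := fun u => if u ∈ X then posX u else posY u + (posX p - posY p) with hpos
  have pX : ∀ u ∈ X, pos u = posX u := fun u hu => if_pos hu
  have pY : ∀ u ∈ Y, pos u = posY u + (posX p - posY p) := by
    intro u hu
    by_cases huX : u ∈ X
    · have : u ∈ X ∩ Y := Finset.mem_inter.2 ⟨huX, hu⟩
      rw [hXY, Finset.mem_singleton] at this
      rw [this, pX p hpX]
      ring
    · exact if_neg huX
  set own : β → α := fun e => if M.ends e ⊆ X then ownX e else ownY e with hown
  have oX : ∀ e ∈ M.inside X, own e = ownX e := fun e he => if_pos (mem_inside.1 he).2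
  have oY : ∀ e ∈ M.inside Y, own e = ownY e := by
    intro e he
    refine if_neg fun h' => ?_
    have h1 := Finset.card_le_card (Finset.subset_inter h' (mem_inside.1 he).2)
    rw [hXY, hM e (mem_inside.1 he).1] at h1
    simp at h1
  have iX : M.inside X ⊆ M.inside (X ∪ Y) := M.inside_mono Finset.subset_union_left
  have iY : M.inside Y ⊆ M.inside (X ∪ Y) := M.inside_mono Finset.subset_union_right
  refine ⟨pos, own, ?_, ?_⟩
  · intro v hv hvs
    by_cases hvX : v ∈ X
    · obtain ⟨e, he, ho, u, hu, hen, hl⟩ := hX.down v hvX hvs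
      exact ⟨e, iX he, (oX e he).trans ho, u, Finset.mem_union_left _ hu, hen, by
        rwa [pX u hu, pX v hvX]⟩
    · have hvY := (Finset.mem_union.1 hv).resolve_left hvX
      obtain ⟨e, he, ho, u, hu, hen, hl⟩ := hY.down v hvY fun h' => hvX (h' ▸ hpX)
      exact ⟨e, iY he, (oY e he).trans ho, u, Finset.mem_union_right _ hu, hen, by
        rw [pY u hu, pY v hvY]; linarith⟩
  · intro v hv hvt
    by_cases hvY : v ∈ Y
    · obtain ⟨e, he, ho, u, hu, hen, hl⟩ := hY.up v hvY hvt
      exact ⟨e, iY he, (oY e he).trans ho, u, Finset.mem_union_right _ hu, hen, by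
        rw [pY u hu, pY v hvY]; linarith⟩
    · have hvX := (Finset.mem_union.1 hv).resolve_right hvY
      obtain ⟨e, he, ho, u, hu, hen, hl⟩ := hX.up v hvX fun h' => hvY (h' ▸ hpY)
      exact ⟨e, iX he, (oX e he).trans ho, u, Finset.mem_union_left _ hu, hen, by
        rwa [pX u hu, pX v hvX]⟩

/-- A hyperpath of generic circuits has a good ordering. -/
theorem exists_preGood_of_hyperpath {M : MGraph α β} (hM : M.Sparse) {k : ℕ} (hk : 1 ≤ k)
    {c : ℕ → Finset α} (hc : ∀ i < k, M.IsCircuit (c i))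
    (hne : ∀ i, i + 1 < k → c i ≠ c (i + 1))
    (hmeet : ∀ i, i + 1 < k → (c i ∩ c (i + 1)).Nonempty)
    (hdis : ∀ i j, i + 1 < j → j < k → c i ∩ c j = ∅) :
    ∃ s t pos own, (M.restrict ((Finset.range k).biUnion c)).PreGood s t pos own := by
  have two : ∀ i < k, ∀ x, ∃ y ∈ c i, y ≠ x := fun i hi x =>
    Finset.exists_mem_ne (by have := (hc i hi).two_le; omega) x
  -- The sink must avoid earlier circuits so that it differs from the joint at which the last
  -- circuit is attached.
  have key : ∀ j < k, ∀ t ∈ c j, (∀ i < j, t ∉ c i) →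
      ∃ s pos own, (M.restrict ((Finset.range (j + 1)).biUnion c)).PreGood s t pos own := by
    intro j
    induction j with
    | zero =>
      intro hj t ht _
      obtain ⟨s, hs, hst⟩ := two 0 hj t
      obtain ⟨pos, own, h⟩ := (hc 0 hj).exists_good hM hs ht hst.symm
      refine ⟨s, pos, own, ?_⟩
      have : (Finset.range (0 + 1)).biUnion c = c 0 := by simp
      rw [this]
      exact h.toPreGood
    | succ j ih =>
      intro hj t ht htn
      obtain ⟨p, hp⟩ := hmeet j hj
      have hp' := Finset.mem_inter.1 hp
      have hone : c j ∩ c (j + 1) = {p} := by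
        symm
        apply Finset.eq_of_subset_of_card_le (Finset.singleton_subset_iff.2 hp)
        simpa using (hc j (by omega)).card_inter_le_one hM (hc (j + 1) hj) (hne j hj)
      obtain ⟨s, posX, ownX, hX⟩ := ih (by omega) p hp'.1 fun i hi hpi => by
        have : p ∈ c i ∩ c (j + 1) := Finset.mem_inter.2 ⟨hpi, hp'.2⟩
        rw [hdis i (j + 1) (by omega) hj] at this
        simp at this
      obtain ⟨posY, ownY, hY⟩ := (hc (j + 1) hj).exists_good hM hp'.2 ht
        fun h' => htn j (by omega) (h' ▸ hp'.1)
      have hun : (Finset.range (j + 1 + 1)).biUnion c =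
          (Finset.range (j + 1)).biUnion c ∪ c (j + 1) := by
        rw [Finset.range_add_one, Finset.biUnion_insert, Finset.union_comm]
      have hint : (Finset.range (j + 1)).biUnion c ∩ c (j + 1) = {p} := by
        rw [← hone]
        ext u
        simp only [Finset.mem_inter, Finset.mem_biUnion, Finset.mem_range]
        constructor
        · rintro ⟨⟨i, hi, hu⟩, hu'⟩
          rcases Nat.lt_or_ge i j with h | h
          · have : u ∈ c i ∩ c (j + 1) := Finset.mem_inter.2 ⟨hu, hu'⟩
            rw [hdis i (j + 1) (by omega) hj] at this
            simp at this
          · have : i = j := by omega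
            exact ⟨this ▸ hu, hu'⟩
        · exact fun h => ⟨⟨j, by omega, h.1⟩, h.2⟩
      rw [hun]
      obtain ⟨pos, own, h⟩ := hX.concat hM.card_ends hY.toPreGood hint
      exact ⟨s, pos, own, h⟩
  obtain ⟨j, rfl⟩ : ∃ j, k = j + 1 := ⟨k - 1, by omega⟩
  have ht : ∃ t ∈ c j, ∀ i < j, t ∉ c i := by
    rcases j with _ | j
    · obtain ⟨t, ht⟩ : (c 0).Nonempty :=
        Finset.card_pos.1 (by have := (hc 0 (by omega)).two_le; omega)
      exact ⟨t, ht, fun i hi => absurd hi (by omega)⟩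
    · obtain ⟨p, hp⟩ := hmeet j (by omega)
      obtain ⟨t, ht, htp⟩ := two (j + 1) (by omega) p
      refine ⟨t, ht, fun i hi hti => ?_⟩
      rcases Nat.lt_or_ge i j with h | h
      · have : t ∈ c i ∩ c (j + 1) := Finset.mem_inter.2 ⟨hti, ht⟩
        rw [hdis i (j + 1) (by omega) (by omega)] at this
        simp at this
      · have hij : i = j := by omega
        subst hij
        have h1 := (hc i (by omega)).card_inter_le_one hM (hc (i + 1) (by omega))
          (hne i (by omega))
        exact htp (Finset.card_le_one.1 h1 t (Finset.mem_inter.2 ⟨hti, ht⟩) p hp)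
  obtain ⟨t, ht, htn⟩ := ht
  obtain ⟨s, pos, own, h⟩ := key j (by omega) t ht htn
  exact ⟨s, t, pos, own, h⟩

end MGraph

/-! ### From positions and owners to branchings -/

namespace Graph

variable {α β W : Type*}

/-- Choosing for every vertex other than `s` an arc from a smaller vertex gives an
out-branching. -/
theorem isOutBranching_of_lt [Finite W] {D : β → W → W → Prop} {pos : W → ℚ} {s : W}
    (hlt : ∀ e u v, D e u v → pos u < pos v)
    (hD : ∀ e u v u' v', D e u v → D e u' v' → v = v') {p : W → β}
    (hp : ∀ v, v ≠ s → ∃ u, D (p v) u v) : IsOutBranching D {e | ∃ v, v ≠ s ∧ e = p v} s where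
  isArc := by
    rintro e ⟨v, hv, rfl⟩
    obtain ⟨u, hu⟩ := hp v hv
    exact ⟨u, v, hu⟩
  root := by
    rintro e ⟨v, hv, rfl⟩ u hu
    obtain ⟨u', hu'⟩ := hp v hv
    exact hv (hD _ _ _ _ _ hu' hu)
  entering := by
    intro v hv
    refine ⟨p v, ⟨⟨v, hv, rfl⟩, hp v hv⟩, ?_⟩
    rintro e ⟨⟨w, hw, rfl⟩, u, hu⟩
    obtain ⟨u', hu'⟩ := hp w hw
    rw [hD _ _ _ _ _ hu' hu]
  reachable := by
    intro v
    have hwf : WellFounded fun u w : W => pos u < pos w :=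
      haveI : IsTrans W fun u w => pos u < pos w := ⟨fun _ _ _ h1 h2 => h1.trans h2⟩
      haveI : Std.Irrefl fun u w : W => pos u < pos w := ⟨fun _ h => lt_irrefl _ h⟩
      Finite.wellFounded_of_trans_of_irrefl _
    induction v using hwf.induction with
    | _ v ih =>
      by_cases hv : v = s
      · rw [hv]
      · obtain ⟨u, hu⟩ := hp v hv
        exact (ih u (hlt _ _ _ hu)).tail ⟨p v, ⟨v, hv, rfl⟩, hu⟩

theorem IsOutBranching.reverse {D D' : β → W → W → Prop} {B : Set β} {s : W}
    (h : IsOutBranching D B s) (hD : ∀ e u v, D' e u v ↔ D e v u) : IsInBranching D' B s where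
  isArc e he := by
    obtain ⟨u, v, huv⟩ := h.isArc e he
    exact ⟨v, u, (hD _ _ _).2 huv⟩
  root e he v hv := h.root e he v ((hD _ _ _).1 hv)
  leaving u hu := by
    simp only [hD]
    exact h.entering u hu
  reachable u := by
    have hr := h.reachable u
    induction hr with
    | refl => exact .refl
    | tail _ hab ih =>
      obtain ⟨e, he, hab⟩ := hab
      exact ih.head ⟨e, he, (hD _ _ _).2 hab⟩

/-- The chosen edges down form the out-branching and the chosen edges up form the in-branching, by
negating positions. A common edge would have a single owner and lead from it both down and up. -/
theorem isGood_of_preGood {G : Graph α β} [DecidableEq α] [Nonempty β] {hV : V(G).Finite}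
    {hE : E(G).Finite} {s t : α} {pos : α → ℚ} {own : β → α} (hs : s ∈ V(G)) (ht : t ∈ V(G))
    (h : (G.toMGraph hV hE).PreGood s t pos own) : G.IsGood := by
  obtain ⟨pos, h⟩ := h.exists_good
  have hfin : Finite V(G) := hV
  have hinj : ∀ u v : V(G), pos u = pos v → u = v := by
    intro u v huv
    refine Subtype.ext (h.inj ?_ ?_ huv)
    · exact mem_V_toMGraph.2 u.2
    · exact mem_V_toMGraph.2 v.2
  have hdown : ∀ v : V(G), ∃ e, v ≠ ⟨s, hs⟩ →
      own e = v ∧ ∃ u : V(G), G.IsLink e u v ∧ pos u < pos v := by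
    intro v
    by_cases hv : v = ⟨s, hs⟩
    · exact ⟨Classical.arbitrary β, fun h' => absurd hv h'⟩
    · obtain ⟨e, -, ho, u, hu, hen, hl⟩ := h.down v (mem_V_toMGraph.2 v.2)
        fun h' => hv (Subtype.ext h')
      exact ⟨e, fun _ => ⟨ho, ⟨u, mem_V_toMGraph.1 hu⟩, (isLink_of_ends_toMGraph hen).symm, hl⟩⟩
  have hup : ∀ v : V(G), ∃ e, v ≠ ⟨t, ht⟩ →
      own e = v ∧ ∃ u : V(G), G.IsLink e u v ∧ pos v < pos u := by
    intro v
    by_cases hv : v = ⟨t, ht⟩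
    · exact ⟨Classical.arbitrary β, fun h' => absurd hv h'⟩
    · obtain ⟨e, -, ho, u, hu, hen, hl⟩ := h.up v (mem_V_toMGraph.2 v.2)
        fun h' => hv (Subtype.ext h')
      exact ⟨e, fun _ => ⟨ho, ⟨u, mem_V_toMGraph.1 hu⟩, (isLink_of_ends_toMGraph hen).symm, hl⟩⟩
  choose p hp using hdown
  choose q hq using hup
  have huniq : ∀ f : α → ℚ, ∀ e (u v u' v' : V(G)), (G.IsLink e u v ∧ f u < f v) →
      (G.IsLink e u' v' ∧ f u' < f v') → v = v' := by
    rintro f e u v u' v' ⟨h1, h2⟩ ⟨h3, h4⟩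
    rcases h1.eq_and_eq_or_eq_and_eq h3 with h5 | h5
    · exact Subtype.ext h5.2
    · rw [h5.1, h5.2] at h2
      exact absurd h2 h4.not_gt
  refine ⟨fun u v => pos u < pos v, ?_, {e | ∃ v, v ≠ ⟨s, hs⟩ ∧ e = p v},
    {e | ∃ v, v ≠ ⟨t, ht⟩ ∧ e = q v}, ⟨s, hs⟩, ⟨t, ht⟩, ?_, ?_, ?_⟩
  · exact
      { trichotomous := fun u v h1 h2 => hinj u v (le_antisymm (not_lt.1 h2) (not_lt.1 h1))
        irrefl := fun u => lt_irrefl (pos u)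
        trans := fun u v w h1 h2 => lt_trans h1 h2 }
  · refine isOutBranching_of_lt (W := V(G)) (pos := fun v => pos v) (fun e u v h' => h'.2) (huniq pos) ?_
    intro v hv
    obtain ⟨-, u, hu⟩ := hp v hv
    exact ⟨u, hu⟩
  · refine IsOutBranching.reverse (D := fun e (u v : V(G)) => G.IsLink e u v ∧ -pos u < -pos v)
      (isOutBranching_of_lt (W := V(G)) (pos := fun v => -pos v) (fun e u v h' => h'.2)
        (huniq fun v => -pos v) ?_) ?_
    · intro v hv
      obtain ⟨-, u, hu, hl⟩ := hq v hv
      exact ⟨u, hu, neg_lt_neg hl⟩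
    · intro e u v
      rw [isLink_comm, neg_lt_neg_iff]
      rfl
  · rw [Set.disjoint_left]
    rintro e ⟨v, hv, rfl⟩ ⟨w, hw, hvw⟩
    obtain ⟨h1, u, h2, h3⟩ := hp v hv
    obtain ⟨h4, u', h5, h6⟩ := hq w hw
    rw [← hvw] at h4 h5
    have hwv : v = w := Subtype.ext (h1.symm.trans h4)
    subst hwv
    rw [h5.left_unique h2] at h6
    exact h6.not_gt h3

end Graph

/-! ### Circuits as intervals of a good ordering -/

namespace MGraph

variable {α β : Type*} [DecidableEq α] [DecidableEq β]

/-- `p` and `q` assign to the vertices different from `s` and `t`, respectively, an edge to a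
lower and an edge to a higher vertex, in such a way that all edges of `M` are used. -/
structure Covered (M : MGraph α β) (pos : α → ℕ) (p q : α → β) (s t : α) : Prop where
  inj : Set.InjOn pos M.V
  down : ∀ v ∈ M.V, v ≠ s → ∃ u, M.ends (p v) = {v, u} ∧ pos u < pos v
  up : ∀ v ∈ M.V, v ≠ t → ∃ u, M.ends (q v) = {v, u} ∧ pos v < pos u
  cover : ∀ e ∈ M.E, (∃ v ∈ M.V, v ≠ s ∧ e = p v) ∨ ∃ v ∈ M.V, v ≠ t ∧ e = q v

variable {M : MGraph α β} {pos : α → ℕ} {p q : α → β} {s t : α}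

/-- Every edge inside X is p v with v ≠ a or q v with v ≠ b, which gives at most 2|X| - 2
candidates. As X spans exactly that many edges, every candidate lies inside X. -/
theorem Covered.mem_inside (h : M.Covered pos p q s t) {X : Finset α} (hX : M.IsCircuit X)
    {a b : α} (ha : a ∈ X) (hb : b ∈ X) (hmin : ∀ v ∈ X, pos a ≤ pos v)
    (hmax : ∀ v ∈ X, pos v ≤ pos b) :
    (∀ v ∈ X, v ≠ a → p v ∈ M.inside X) ∧ ∀ v ∈ X, v ≠ b → q v ∈ M.inside X := by
  set P := (X.erase a).filter fun v => p v ∈ M.inside X with hP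
  set Q := (X.erase b).filter fun v => q v ∈ M.inside X with hQ
  have hsub : M.inside X ⊆ P.image p ∪ Q.image q := by
    intro e he
    have he' := MGraph.mem_inside.1 he
    rw [Finset.mem_union, Finset.mem_image, Finset.mem_image]
    rcases h.cover e he'.1 with ⟨v, hv, hvs, rfl⟩ | ⟨v, hv, hvs, rfl⟩
    · obtain ⟨u, hu, hl⟩ := h.down v hv hvs
      rw [hu, Finset.insert_subset_iff, Finset.singleton_subset_iff] at he'
      refine Or.inl ⟨v, Finset.mem_filter.2 ⟨Finset.mem_erase.2 ⟨?_, he'.2.1⟩, he⟩, rfl⟩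
      rintro rfl
      exact absurd hl (hmin u he'.2.2).not_gt
    · obtain ⟨u, hu, hl⟩ := h.up v hv hvs
      rw [hu, Finset.insert_subset_iff, Finset.singleton_subset_iff] at he'
      refine Or.inr ⟨v, Finset.mem_filter.2 ⟨Finset.mem_erase.2 ⟨?_, he'.2.1⟩, he⟩, rfl⟩
      rintro rfl
      exact absurd hl (hmax u he'.2.2).not_gt
  have h1 := Finset.card_le_card hsub
  have h2 := Finset.card_union_le (P.image p) (Q.image q)
  have h3 : (P.image p).card ≤ P.card := Finset.card_image_le
  have h4 : (Q.image q).card ≤ Q.card := Finset.card_image_le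
  have h5 : P.card ≤ (X.erase a).card := Finset.card_filter_le _ _
  have h6 : Q.card ≤ (X.erase b).card := Finset.card_filter_le _ _
  have h7 := Finset.card_erase_of_mem ha
  have h8 := Finset.card_erase_of_mem hb
  have h9 := hX.num_eq
  have h10 := hX.two_le
  unfold num at h9
  constructor
  · intro v hv hva
    have : P = X.erase a :=
      Finset.eq_of_subset_of_card_le (Finset.filter_subset _ _) (by omega)
    have hvP : v ∈ P := by rw [this]; exact Finset.mem_erase.2 ⟨hva, hv⟩
    exact (Finset.mem_filter.1 hvP).2
  · intro v hv hvb
    have : Q = X.erase b :=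
      Finset.eq_of_subset_of_card_le (Finset.filter_subset _ _) (by omega)
    have hvQ : v ∈ Q := by rw [this]; exact Finset.mem_erase.2 ⟨hvb, hv⟩
    exact (Finset.mem_filter.1 hvQ).2

/-- If v were the lowest vertex of neither circuit, its edge p v would lie in both, although they
share at most one vertex. The same holds for q v and highest vertices. -/
theorem Covered.extreme_of_mem_inter (h : M.Covered pos p q s t) (hM : M.Sparse)
    {X Y : Finset α} (hX : M.IsCircuit X) (hY : M.IsCircuit Y) (hne : X ≠ Y) {a b a' b' v : α}
    (ha : a ∈ X) (hb : b ∈ X) (hmin : ∀ v ∈ X, pos a ≤ pos v) (hmax : ∀ v ∈ X, pos v ≤ pos b)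
    (ha' : a' ∈ Y) (hb' : b' ∈ Y) (hmin' : ∀ v ∈ Y, pos a' ≤ pos v)
    (hmax' : ∀ v ∈ Y, pos v ≤ pos b') (hvX : v ∈ X) (hvY : v ∈ Y) :
    (v = b ∧ v = a') ∨ (v = a ∧ v = b') := by
  obtain ⟨h1, h2⟩ := h.mem_inside hX ha hb hmin hmax
  obtain ⟨h3, h4⟩ := h.mem_inside hY ha' hb' hmin' hmax'
  have hcard := hX.card_inter_le_one hM hY hne
  have contra : ∀ e, e ∈ M.inside X → e ∈ M.inside Y → False := by
    intro e he he'
    rw [MGraph.mem_inside] at he he'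
    have := Finset.card_le_card (Finset.subset_inter he.2 he'.2)
    rw [hM.card_ends e he.1] at this
    omega
  have hlow : v = a ∨ v = a' := by
    by_contra! hcon
    exact contra _ (h1 v hvX hcon.1) (h3 v hvY hcon.2)
  have hhigh : v = b ∨ v = b' := by
    by_contra! hcon
    exact contra _ (h2 v hvX hcon.1) (h4 v hvY hcon.2)
  have hlt : ∀ {Z : Finset α} {c d : α}, M.IsCircuit Z → c ∈ Z → d ∈ Z →
      (∀ v ∈ Z, pos c ≤ pos v) → (∀ v ∈ Z, pos v ≤ pos d) → c ≠ d := by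
    rintro Z c d hZ hc hd hmn hmx rfl
    obtain ⟨x, hx, hxc⟩ := Finset.exists_mem_ne (s := Z) (by have := hZ.two_le; omega) c
    exact hxc (h.inj (hZ.subset hx) (hZ.subset hc) (le_antisymm (hmx x hx) (hmn x hx)))
  have n1 := hlt hX ha hb hmin hmax
  have n2 := hlt hY ha' hb' hmin' hmax'
  rcases hlow with rfl | rfl <;> rcases hhigh with rfl | rfl
  · exact absurd rfl n1
  · exact Or.inr ⟨rfl, rfl⟩
  · exact Or.inl ⟨rfl, rfl⟩
  · exact absurd rfl n2

end MGraph

/-- Intervals with integral ends that are pairwise connected via common ends can be listed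
in order. -/
theorem exists_enumeration_of_connected {τ : Type*} {P : τ → Prop} {lo hi : τ → ℕ}
    (hlt : ∀ X, P X → lo X < hi X) (hlo : ∀ X Y, P X → P Y → lo X = lo Y → X = Y)
    (hhi : ∀ X Y, P X → P Y → hi X = hi Y → X = Y) {S : Set τ} (hfin : S.Finite)
    (hne : S.Nonempty) (hS : ∀ X ∈ S, P X)
    (hclosed : ∀ X ∈ S, ∀ Y, P Y → hi X = lo Y → Y ∈ S)
    (hconn : ∀ X ∈ S, ∀ Y ∈ S, Relation.ReflTransGen
      (fun X Y => P X ∧ P Y ∧ (X = Y ∨ hi X = lo Y ∨ hi Y = lo X)) X Y) :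
    ∃ (k : ℕ) (c : Fin k → τ), 1 ≤ k ∧ Function.Injective c ∧ Set.range c = S ∧
      ∀ i j, hi (c i) = lo (c j) ↔ (i : ℕ) + 1 = j := by
  classical
  set r : τ → τ → Prop := fun X Y => P X ∧ P Y ∧ hi X = lo Y with hr
  -- Lower and upper ends determine the interval, so a walk that turns back can only retrace its
  -- steps; any two connected intervals are joined by a monotone path.
  have hcomp : ∀ X Y, Relation.ReflTransGen
      (fun X Y => P X ∧ P Y ∧ (X = Y ∨ hi X = lo Y ∨ hi Y = lo X)) X Y →
      Relation.ReflTransGen r X Y ∨ Relation.ReflTransGen r Y X := by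
    intro X Y hXY
    induction hXY with
    | refl => exact Or.inl .refl
    | tail _ hstep ih =>
      rename_i Y Z _
      obtain ⟨hY, hZ, rfl | h | h⟩ := hstep
      · exact ih
      · rcases ih with ih | ih
        · exact Or.inl (ih.tail ⟨hY, hZ, h⟩)
        · rcases ih.cases_head with rfl | ⟨W, hW, hWX⟩
          · exact Or.inl (.single ⟨hY, hZ, h⟩)
          · have : Z = W := hlo Z W hZ hW.2.1 (h.symm.trans hW.2.2)
            exact Or.inr (this ▸ hWX)
      · rcases ih with ih | ih
        · rcases ih.cases_tail with rfl | ⟨W, hXW, hW⟩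
          · exact Or.inr (.single ⟨hZ, hY, h⟩)
          · have : Z = W := hhi Z W hZ hW.1 (h.trans hW.2.2.symm)
            exact Or.inl (this ▸ hXW)
        · exact Or.inr (ih.head ⟨hZ, hY, h⟩)
  have hmono : ∀ X Y, Relation.ReflTransGen r X Y → lo X ≤ lo Y := by
    intro X Y h
    induction h with
    | refl => exact le_rfl
    | tail _ hstep ih => exact ih.trans (hstep.2.2 ▸ (hlt _ hstep.1).le)
  set L := hfin.toFinset.image lo with hL
  have hcard : 1 ≤ L.card := by
    obtain ⟨X, hX⟩ := hne
    exact Finset.card_pos.2 ⟨lo X, Finset.mem_image_of_mem _ (hfin.mem_toFinset.2 hX)⟩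
  have hex : ∀ i : Fin L.card, ∃ X ∈ S, lo X = L.orderEmbOfFin rfl i := by
    intro i
    obtain ⟨X, hX, h⟩ := Finset.mem_image.1 (L.orderEmbOfFin_mem rfl i)
    exact ⟨X, hfin.mem_toFinset.1 hX, h⟩
  choose c hcS hc using hex
  have hsurj : ∀ X ∈ S, ∃ i, c i = X := by
    intro X hX
    have : lo X ∈ Set.range (L.orderEmbOfFin rfl) := by
      rw [Finset.range_orderEmbOfFin]
      exact Finset.mem_coe.2 (Finset.mem_image_of_mem _ (hfin.mem_toFinset.2 hX))
    obtain ⟨i, hi⟩ := this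
    exact ⟨i, hlo _ _ (hS _ (hcS i)) (hS X hX) ((hc i).trans hi)⟩
  have hlt_iff : ∀ i j, lo (c i) < lo (c j) ↔ i < j := by
    intro i j
    rw [hc, hc]
    exact (L.orderEmbOfFin rfl).lt_iff_lt
  -- The first interval on the monotone path from `c i` to `c j` has index above i and at most j, so
  -- it is `c j`.
  have hsucc : ∀ i j : Fin L.card, (i : ℕ) + 1 = j → hi (c i) = lo (c j) := by
    intro i j hij
    have hij' : lo (c i) < lo (c j) := (hlt_iff i j).2 (Fin.lt_def.2 (by omega))
    rcases hcomp _ _ (hconn _ (hcS i) _ (hcS j)) with h | h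
    · rcases h.cases_head with h | ⟨W, hW, hWj⟩
      · rw [h] at hij'
        exact absurd hij' (lt_irrefl _)
      · obtain ⟨l, rfl⟩ := hsurj W (hclosed _ (hcS i) W hW.2.1 hW.2.2)
        have h1 : i < l := (hlt_iff i l).1 (hW.2.2 ▸ hlt _ hW.1)
        have h2 : ¬ j < l := fun h' => absurd ((hlt_iff j l).2 h') (hmono _ _ hWj).not_gt
        have h3 : l = j := by
          apply Fin.ext
          rw [Fin.lt_def] at h1 h2
          omega
        rw [← h3]
        exact hW.2.2
    · exact absurd hij' (hmono _ _ h).not_gt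
  refine ⟨L.card, c, hcard, ?_, ?_, ?_⟩
  · intro i j hij
    apply (L.orderEmbOfFin rfl).injective
    rw [← hc, ← hc, hij]
  · ext X
    constructor
    · rintro ⟨i, rfl⟩
      exact hcS i
    · exact hsurj X
  · intro i j
    refine ⟨fun h => ?_, hsucc i j⟩
    have h1 : i < j := (hlt_iff i j).1 (h ▸ hlt _ (hS _ (hcS i)))
    rw [Fin.lt_def] at h1
    have h2 := hsucc i ⟨i + 1, by omega⟩ rfl
    have h3 := hlo _ _ (hS _ (hcS j)) (hS _ (hcS _)) (h.symm.trans h2)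
    have h4 : j = ⟨i + 1, by omega⟩ := by
      apply (L.orderEmbOfFin rfl).injective
      rw [← hc, ← hc, h3]
    rw [h4]

namespace Graph

variable {α β : Type*}

/-- Ranks of the vertices in a linear order. -/
theorem exists_rank {W : Type*} [Finite W] {prec : W → W → Prop} (h : IsStrictTotalOrder W prec) :
    ∃ rank : W → ℕ, ∀ u v, prec u v ↔ rank u < rank v := by
  have hlt : ∀ u v, prec u v → {w | prec w u}.ncard < {w | prec w v}.ncard := by
    intro u v huv
    apply Set.ncard_lt_ncard _ (Set.toFinite _)
    refine ⟨fun w hw => h.trans w u v hw huv, fun hsub => ?_⟩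
    exact h.irrefl u (hsub huv)
  refine ⟨fun v => {w | prec w v}.ncard, fun u v => ⟨hlt u v, fun huv => ?_⟩⟩
  by_contra hn
  by_cases hvu : prec v u
  · exact absurd huv (hlt v u hvu).not_gt
  · have := h.trichotomous u v hn hvu
    rw [this] at huv
    exact absurd huv (lt_irrefl _)

/-- The selected arcs down and up are pairwise different and number 2(|V| - 1) = |E|, so they
exhaust the edges. -/
theorem IsGood.exists_covered [DecidableEq α] [DecidableEq β] [Nonempty β] {G : Graph α β}
    (hG : G.IsTwoTGraph) {hV : V(G).Finite} {hE : E(G).Finite} (hgood : G.IsGood) :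
    ∃ pos p q s t, (G.toMGraph hV hE).Covered pos p q s t := by
  obtain ⟨prec, hprec, Bout, Bin, s, t, hout, hin, hdis⟩ := hgood
  have hfin : Finite V(G) := hV
  obtain ⟨rank, hrank⟩ := exists_rank hprec
  have hex : ∃ pos : α → ℕ, ∀ v : V(G), pos v = rank v := by
    classical
    exact ⟨fun a => if h : a ∈ V(G) then rank ⟨a, h⟩ else 0, fun v => by simp⟩
  obtain ⟨pos, hpos⟩ := hex
  have hp : ∀ v : α, ∃ e, v ∈ V(G) → v ≠ s →
      e ∈ Bout ∧ ∃ u, G.IsLink e v u ∧ pos u < pos v := by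
    intro v
    by_cases hv : v ∈ V(G) ∧ v ≠ s
    · obtain ⟨e, ⟨he, u, hu, hl⟩, -⟩ := hout.entering ⟨v, hv.1⟩
        (fun h => hv.2 (congrArg Subtype.val h))
      refine ⟨e, fun _ _ => ⟨he, u, hu.symm, ?_⟩⟩
      rw [hpos u, hpos ⟨v, hv.1⟩]
      exact (hrank _ _).1 hl
    · exact ⟨Classical.arbitrary β, fun h1 h2 => absurd ⟨h1, h2⟩ hv⟩
  have hq : ∀ v : α, ∃ e, v ∈ V(G) → v ≠ t →
      e ∈ Bin ∧ ∃ u, G.IsLink e v u ∧ pos v < pos u := by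
    intro v
    by_cases hv : v ∈ V(G) ∧ v ≠ t
    · obtain ⟨e, ⟨he, u, hu, hl⟩, -⟩ := hin.leaving ⟨v, hv.1⟩
        (fun h => hv.2 (congrArg Subtype.val h))
      refine ⟨e, fun _ _ => ⟨he, u, hu, ?_⟩⟩
      rw [hpos u, hpos ⟨v, hv.1⟩]
      exact (hrank _ _).1 hl
    · exact ⟨Classical.arbitrary β, fun h1 h2 => absurd ⟨h1, h2⟩ hv⟩
  choose p hp using hp
  choose q hq using hq
  refine ⟨pos, p, q, s, t, ?_, ?_, ?_, ?_⟩
  · intro u hu v hv huv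
    have hu' := mem_V_toMGraph.1 hu
    have hv' := mem_V_toMGraph.1 hv
    rw [hpos ⟨u, hu'⟩, hpos ⟨v, hv'⟩] at huv
    have := hprec.trichotomous ⟨u, hu'⟩ ⟨v, hv'⟩ (fun h => ((hrank _ _).1 h).ne huv)
      (fun h => ((hrank _ _).1 h).ne' huv)
    exact congrArg Subtype.val this
  · intro v hv hvs
    obtain ⟨-, u, hu, hl⟩ := hp v (mem_V_toMGraph.1 hv) hvs
    exact ⟨u, hu.ends_toMGraph, hl⟩
  · intro v hv hvt
    obtain ⟨-, u, hu, hl⟩ := hq v (mem_V_toMGraph.1 hv) hvt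
    exact ⟨u, hu.ends_toMGraph, hl⟩
  · set M := G.toMGraph hV hE with hM
    have c1 : ((M.V.erase s).image p).card = (M.V.erase s).card := by
      apply Finset.card_image_of_injOn
      intro v hv w hw hvw
      have hv' := Finset.mem_erase.1 (Finset.mem_coe.1 hv)
      have hw' := Finset.mem_erase.1 (Finset.mem_coe.1 hw)
      obtain ⟨-, u, h1, h2⟩ := hp v (mem_V_toMGraph.1 hv'.2) hv'.1
      obtain ⟨-, u', h3, h4⟩ := hp w (mem_V_toMGraph.1 hw'.2) hw'.1
      rw [show p v = p w from hvw] at h1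
      rcases h1.eq_and_eq_or_eq_and_eq h3 with h5 | h5
      · exact h5.1
      · rw [h5.1, h5.2] at h2
        exact absurd h2 h4.not_gt
    have c2 : ((M.V.erase t).image q).card = (M.V.erase t).card := by
      apply Finset.card_image_of_injOn
      intro v hv w hw hvw
      have hv' := Finset.mem_erase.1 (Finset.mem_coe.1 hv)
      have hw' := Finset.mem_erase.1 (Finset.mem_coe.1 hw)
      obtain ⟨-, u, h1, h2⟩ := hq v (mem_V_toMGraph.1 hv'.2) hv'.1
      obtain ⟨-, u', h3, h4⟩ := hq w (mem_V_toMGraph.1 hw'.2) hw'.1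
      rw [show q v = q w from hvw] at h1
      rcases h1.eq_and_eq_or_eq_and_eq h3 with h5 | h5
      · exact h5.1
      · rw [h5.1, h5.2] at h2
        exact absurd h2 h4.not_gt
    have hd : Disjoint ((M.V.erase s).image p) ((M.V.erase t).image q) := by
      rw [Finset.disjoint_left]
      intro e h1 h2
      obtain ⟨v, hv, rfl⟩ := Finset.mem_image.1 h1
      obtain ⟨w, hw, hwv⟩ := Finset.mem_image.1 h2
      have hv' := Finset.mem_erase.1 hv
      have hw' := Finset.mem_erase.1 hw
      refine Set.disjoint_left.1 hdis (hp v (mem_V_toMGraph.1 hv'.2) hv'.1).1 ?_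
      rw [← hwv]
      exact (hq w (mem_V_toMGraph.1 hw'.2) hw'.1).1
    have hsub : (M.V.erase s).image p ∪ (M.V.erase t).image q ⊆ M.E := by
      apply Finset.union_subset
      · intro e he
        obtain ⟨v, hv, rfl⟩ := Finset.mem_image.1 he
        have hv' := Finset.mem_erase.1 hv
        obtain ⟨-, u, h1, -⟩ := hp v (mem_V_toMGraph.1 hv'.2) hv'.1
        exact mem_E_toMGraph.2 h1.edge_mem
      · intro e he
        obtain ⟨v, hv, rfl⟩ := Finset.mem_image.1 he
        have hv' := Finset.mem_erase.1 hv
        obtain ⟨-, u, h1, -⟩ := hq v (mem_V_toMGraph.1 hv'.2) hv'.1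
        exact mem_E_toMGraph.2 h1.edge_mem
    have hcE := (hG.sparse (hV := hV) (hE := hE)).card_edges
    have heq := Finset.eq_of_subset_of_card_le hsub (by
      rw [Finset.card_union_of_disjoint hd, c1, c2]
      have c3 : (M.V.erase s).card = M.V.card - 1 :=
        Finset.card_erase_of_mem (mem_V_toMGraph.2 s.2)
      have c4 : (M.V.erase t).card = M.V.card - 1 :=
        Finset.card_erase_of_mem (mem_V_toMGraph.2 t.2)
      have : M.E.card + 2 = 2 * M.V.card := hcE
      omega)
    intro e he
    rw [← heq, Finset.mem_union, Finset.mem_image, Finset.mem_image] at he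
    rcases he with ⟨v, hv, rfl⟩ | ⟨v, hv, rfl⟩
    · have hv' := Finset.mem_erase.1 hv
      exact Or.inl ⟨v, hv'.2, hv'.1, rfl⟩
    · have hv' := Finset.mem_erase.1 hv
      exact Or.inr ⟨v, hv'.2, hv'.1, rfl⟩

end Graph

/-! ### Generic components and the conclusion -/

namespace Graph

variable {α β : Type*} {G : Graph α β}

theorem IsCircuitOf.nonempty {X : Set α} (hX : G.IsCircuitOf X) : X.Nonempty := by
  obtain ⟨-, -, -, hf, -, hpos, -⟩ := hX
  obtain ⟨e, x, y, -, hx, -⟩ := (Set.ncard_pos hf).1 hpos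
  exact ⟨x, hx⟩

theorem IsCircuitOf.nonempty_edge {X : Set α} (hX : G.IsCircuitOf X) : Nonempty β := by
  obtain ⟨-, -, -, hf, -, hpos, -⟩ := hX
  obtain ⟨e, -⟩ := (Set.ncard_pos hf).1 hpos
  exact ⟨e⟩

theorem CircuitsConnected.symm {X Y : Set α} (h : G.CircuitsConnected X Y) :
    G.CircuitsConnected Y X := by
  have : Std.Symm fun X Y : Set α => G.IsCircuitOf X ∧ G.IsCircuitOf Y ∧ (X ∩ Y).Nonempty :=
    ⟨fun X Y h => ⟨h.2.1, h.1, by rw [Set.inter_comm]; exact h.2.2⟩⟩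
  exact (Relation.ReflTransGen.stdSymm (r := fun X Y : Set α =>
    G.IsCircuitOf X ∧ G.IsCircuitOf Y ∧ (X ∩ Y).Nonempty)).symm _ _ h

/-- A circuit that meets a member of a maximal set of connected circuits belongs to the set. -/
theorem mem_of_maximal_connected {S : Set (Set α)}
    (hS : Maximal (fun S' : Set (Set α) => S'.Nonempty ∧ (∀ X ∈ S', G.IsCircuitOf X) ∧
      ∀ X ∈ S', ∀ Y ∈ S', G.CircuitsConnected X Y) S) {X Y : Set α} (hX : G.IsCircuitOf X)
    (hY : Y ∈ S) (hXY : (X ∩ Y).Nonempty) : X ∈ S := by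
  obtain ⟨⟨-, h1, h2⟩, hmax⟩ := hS
  have hstep : G.CircuitsConnected X Y := .single ⟨hX, h1 Y hY, hXY⟩
  have hto : ∀ Z ∈ S, G.CircuitsConnected X Z := fun Z hZ => hstep.trans (h2 Y hY Z hZ)
  refine hmax (y := insert X S) ⟨⟨X, Set.mem_insert _ _⟩, ?_, ?_⟩ (Set.subset_insert _ _)
    (Set.mem_insert _ _)
  · rintro Z (rfl | hZ)
    · exact hX
    · exact h1 Z hZ
  · rintro Z (rfl | hZ) W (rfl | hW)
    · exact .refl
    · exact hto W hW
    · exact (hto Z hZ).symm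
    · exact h2 Z hZ W hW

/-- The component of a circuit. -/
theorem isGenericComponent_of_isCircuitOf {X : Set α} (hX : G.IsCircuitOf X) :
    G.IsGenericComponent (⋃₀ {Y | G.IsCircuitOf Y ∧ G.CircuitsConnected X Y}) := by
  refine Or.inr ⟨{Y | G.IsCircuitOf Y ∧ G.CircuitsConnected X Y},
    ⟨⟨⟨X, hX, .refl⟩, fun Y hY => hY.1, fun Y hY Z hZ => ?_⟩, ?_⟩, rfl⟩
  · exact hY.2.symm.trans hZ.2
  · rintro S' ⟨-, h1, h2⟩ hle Y hY
    have hXS : X ∈ S' := hle (show X ∈ {Y | G.IsCircuitOf Y ∧ G.CircuitsConnected X Y} from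
      ⟨hX, .refl⟩)
    exact ⟨h1 Y hY, h2 X hXS Y hY⟩

/-- In a good ordering of a 2T-graph, generic circuits behave like intervals that can only meet
in common ends. -/
theorem IsGood.exists_lo_hi (hG : G.IsTwoTGraph) (hV : V(G).Finite) (hgood : G.IsGood)
    [Nonempty β] : ∃ lo hi : Set α → ℕ, (∀ X, G.IsCircuitOf X → lo X < hi X) ∧
      ∀ X Y, G.IsCircuitOf X → G.IsCircuitOf Y → X ≠ Y →
        lo X ≠ lo Y ∧ hi X ≠ hi Y ∧ ((X ∩ Y).Nonempty ↔ hi X = lo Y ∨ hi Y = lo X) := by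
  classical
  have hE := hG.finite_edgeSet hV
  obtain ⟨pos, p, q, s, t, h⟩ := hgood.exists_covered hG (hV := hV) (hE := hE)
  set M := G.toMGraph hV hE with hM
  have hsparse : M.Sparse := hG.sparse
  have hends : ∀ X, G.IsCircuitOf X → ∃ F : Finset α, M.IsCircuit F ∧ X = F ∧
      ∃ a ∈ F, ∃ b ∈ F, (∀ v ∈ F, pos a ≤ pos v) ∧ ∀ v ∈ F, pos v ≤ pos b := by
    intro X hX
    obtain ⟨F, rfl⟩ := (hV.subset hX.1).exists_finset_coe
    have hne : F.Nonempty := Finset.coe_nonempty.1 hX.nonempty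
    obtain ⟨a, ha, ha'⟩ := F.exists_min_image pos hne
    obtain ⟨b, hb, hb'⟩ := F.exists_max_image pos hne
    exact ⟨F, hX.isCircuit, rfl, a, ha, b, hb, ha', hb'⟩
  have hex : ∀ X, ∃ l : ℕ × ℕ, G.IsCircuitOf X → ∃ F : Finset α, M.IsCircuit F ∧ X = F ∧
      ∃ a ∈ F, ∃ b ∈ F, (∀ v ∈ F, pos a ≤ pos v) ∧ (∀ v ∈ F, pos v ≤ pos b) ∧
        l.1 = pos a ∧ l.2 = pos b := by
    intro X
    by_cases hX : G.IsCircuitOf X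
    · obtain ⟨F, h1, h2, a, ha, b, hb, h3, h4⟩ := hends X hX
      exact ⟨(pos a, pos b), fun _ => ⟨F, h1, h2, a, ha, b, hb, h3, h4, rfl, rfl⟩⟩
    · exact ⟨(0, 0), fun h' => absurd h' hX⟩
  choose l hl using hex
  refine ⟨fun X => (l X).1, fun X => (l X).2, ?_, ?_⟩
  · intro X hX
    obtain ⟨F, hF, -, a, ha, b, hb, h3, h4, h5, h6⟩ := hl X hX
    show (l X).1 < (l X).2
    rw [h5, h6]
    refine lt_of_le_of_ne (h3 b hb) fun heq => ?_
    obtain ⟨x, hx, hxa⟩ := Finset.exists_mem_ne (s := F) (by have := hF.two_le; omega) a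
    exact hxa (h.inj (hF.subset hx) (hF.subset ha)
      (le_antisymm ((h4 x hx).trans heq.ge) (h3 x hx)))
  · intro X Y hX hY hne
    obtain ⟨F, hF, rfl, a, ha, b, hb, h3, h4, h5, h6⟩ := hl X hX
    obtain ⟨F', hF', rfl, a', ha', b', hb', h3', h4', h5', h6'⟩ := hl Y hY
    have hab : pos a < pos b ∧ pos a' < pos b' := by
      constructor
      · refine lt_of_le_of_ne (h3 b hb) fun heq => ?_
        obtain ⟨x, hx, hxa⟩ := Finset.exists_mem_ne (s := F) (by have := hF.two_le; omega) a
        exact hxa (h.inj (hF.subset hx) (hF.subset ha)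
          (le_antisymm ((h4 x hx).trans heq.ge) (h3 x hx)))
      · refine lt_of_le_of_ne (h3' b' hb') fun heq => ?_
        obtain ⟨x, hx, hxa⟩ := Finset.exists_mem_ne (s := F') (by have := hF'.two_le; omega) a'
        exact hxa (h.inj (hF'.subset hx) (hF'.subset ha')
          (le_antisymm ((h4' x hx).trans heq.ge) (h3' x hx)))
    have key : ∀ v ∈ F, v ∈ F' → (v = b ∧ v = a') ∨ (v = a ∧ v = b') := fun v hv hv' =>
      h.extreme_of_mem_inter hsparse hF hF' (fun h' => hne (by rw [h'])) ha hb h3 h4 ha' hb' h3' h4'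
        hv hv'
    show (l F).1 ≠ (l F').1 ∧ (l F).2 ≠ (l F').2 ∧
      (((F : Set α) ∩ F').Nonempty ↔ (l F).2 = (l F').1 ∨ (l F').2 = (l F).1)
    rw [h5, h6, h5', h6']
    refine ⟨fun heq => ?_, fun heq => ?_, ?_, ?_⟩
    · have := h.inj (hF.subset ha) (hF'.subset ha') heq
      subst this
      rcases key a ha ha' with h' | h'
      · rw [← h'.1] at hab
        exact absurd hab.1 (lt_irrefl _)
      · rw [← h'.2] at hab
        exact absurd hab.2 (lt_irrefl _)
    · have := h.inj (hF.subset hb) (hF'.subset hb') heq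
      subst this
      rcases key b hb hb' with h' | h'
      · rw [← h'.2] at hab
        exact absurd hab.2 (lt_irrefl _)
      · rw [← h'.1] at hab
        exact absurd hab.1 (lt_irrefl _)
    · rintro ⟨v, hv, hv'⟩
      rcases key v hv hv' with ⟨h1, h2⟩ | ⟨h1, h2⟩
      · exact Or.inl (by rw [← h1, ← h2])
      · exact Or.inr (by rw [← h1, ← h2])
    · rintro (heq | heq)
      · have := h.inj (hF.subset hb) (hF'.subset ha') heq
        exact ⟨b, hb, this ▸ ha'⟩
      · have := h.inj (hF'.subset hb') (hF.subset ha) heq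
        exact ⟨a, ha, this ▸ hb'⟩

theorem IsGood.isLinear (hG : G.IsTwoTGraph) (hV : V(G).Finite) (hgood : G.IsGood) :
    G.IsLinear := by
  rintro K (⟨v, -, -, rfl⟩ | ⟨S, hS, rfl⟩) hK
  · exact absurd hK Set.not_nontrivial_singleton
  obtain ⟨⟨⟨X₀, hX₀⟩, hcirc, hconn⟩, -⟩ := id hS
  have : Nonempty β := (hcirc X₀ hX₀).nonempty_edge
  obtain ⟨lo, hi, hlt, hpair⟩ := hgood.exists_lo_hi hG hV
  -- A circuit inside the component meets a member of S, so it belongs to S by maximality.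
  have hSeq : {X | G.IsCircuitOf X ∧ X ⊆ ⋃₀ S} = S := by
    ext X
    constructor
    · rintro ⟨hX, hsub⟩
      obtain ⟨x, hx⟩ := hX.nonempty
      obtain ⟨Y, hY, hxY⟩ := hsub hx
      exact mem_of_maximal_connected hS hX hY ⟨x, hx, hxY⟩
    · exact fun hX => ⟨hcirc X hX, Set.subset_sUnion_of_mem hX⟩
  have hfin : S.Finite := hV.finite_subsets.subset fun X hX => (hcirc X hX).1
  obtain ⟨k, c, hk, hinj, hrange, hc⟩ := exists_enumeration_of_connected (P := G.IsCircuitOf)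
    (lo := lo) (hi := hi) hlt
    (fun X Y hX hY heq => by_contra fun hne => (hpair X Y hX hY hne).1 heq)
    (fun X Y hX hY heq => by_contra fun hne => (hpair X Y hX hY hne).2.1 heq)
    hfin ⟨X₀, hX₀⟩ hcirc
    (fun X hX Y hY heq => by
      by_cases hne : X = Y
      · exact hne ▸ hX
      · have := (hpair X Y (hcirc X hX) hY hne).2.2.2 (Or.inl heq)
        rw [Set.inter_comm] at this
        exact mem_of_maximal_connected hS hY hX this)
    (fun X hX Y hY => by
      refine Relation.ReflTransGen.mono ?_ _ _ (hconn X hX Y hY)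
      rintro Z W ⟨hZ, hW, hZW⟩
      refine ⟨hZ, hW, ?_⟩
      by_cases hne : Z = W
      · exact Or.inl hne
      · exact Or.inr ((hpair Z W hZ hW hne).2.2.1 hZW))
  have hcS : ∀ i, G.IsCircuitOf (c i) := fun i => hcirc _ (hrange ▸ Set.mem_range_self i)
  refine ⟨k, c, hk, hinj, hrange.trans hSeq.symm, fun i j hij => ?_⟩
  rw [(hpair _ _ (hcS i) (hcS j) (fun h => hij (hinj h))).2.2, hc, hc]

theorem IsHyperpath.isGood (hG : G.IsTwoTGraph) (hV : V(G).Finite) {K : Set α}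
    (hK : G.IsHyperpath K) (hKV : V(G) ⊆ K) (hcover : ∀ v ∈ V(G), ∃ X, G.IsCircuitOf X ∧ v ∈ X) :
    G.IsGood := by
  classical
  have hE := hG.finite_edgeSet hV
  set M := G.toMGraph hV hE with hM
  have hsparse : M.Sparse := hG.sparse
  obtain ⟨k, c, hk, hinj, hrange, hc⟩ := hK
  have hcirc : ∀ i, G.IsCircuitOf (c i) := fun i => by
    have : c i ∈ {X | G.IsCircuitOf X ∧ X ⊆ K} := hrange ▸ Set.mem_range_self i
    exact this.1
  have : Nonempty β := (hcirc ⟨0, hk⟩).nonempty_edge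
  have hex : ∀ i : ℕ, ∃ F : Finset α, ∀ h : i < k, c ⟨i, h⟩ = F := by
    intro i
    by_cases h : i < k
    · obtain ⟨F, hF⟩ := (hV.subset (hcirc ⟨i, h⟩).1).exists_finset_coe
      exact ⟨F, fun _ => hF.symm⟩
    · exact ⟨∅, fun h' => absurd h' h⟩
  choose F hF using hex
  have hFc : ∀ i < k, M.IsCircuit (F i) := by
    intro i hi
    have := hcirc ⟨i, hi⟩
    rw [hF i hi] at this
    exact this.isCircuit
  have hmeet : ∀ i j, (hi : i < k) → (hj : j < k) → i ≠ j →
      ((F i ∩ F j).Nonempty ↔ i + 1 = j ∨ j + 1 = i) := by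
    intro i j hi hj hij
    have := hc ⟨i, hi⟩ ⟨j, hj⟩ (fun h => hij (congrArg Fin.val h))
    rw [hF i hi, hF j hj, ← Finset.coe_inter, Finset.coe_nonempty] at this
    exact this
  obtain ⟨s, t, pos, own, h⟩ := MGraph.exists_preGood_of_hyperpath hsparse hk hFc
    (fun i hi heq => by
      have : c ⟨i, by omega⟩ = c ⟨i + 1, hi⟩ := by rw [hF, hF, heq]
      have := congrArg Fin.val (hinj this)
      simp at this)
    (fun i hi => (hmeet i (i + 1) (by omega) hi (by omega)).2 (Or.inl rfl))
    (fun i j hij hj => by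
      rw [← Finset.not_nonempty_iff_eq_empty, hmeet i j (by omega) hj (by omega)]
      omega)
  have hun : (Finset.range k).biUnion F = M.V := by
    ext v
    simp only [Finset.mem_biUnion, Finset.mem_range]
    constructor
    · rintro ⟨i, hi, hv⟩
      exact (hFc i hi).subset hv
    · intro hv
      obtain ⟨X, hX, hvX⟩ := hcover v (mem_V_toMGraph.1 hv)
      have : X ∈ Set.range c := hrange ▸ ⟨hX, hX.1.trans hKV⟩
      obtain ⟨i, rfl⟩ := this
      rw [hF i i.2] at hvX
      exact ⟨i, i.2, hvX⟩
  have hpre : M.PreGood s t pos own := by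
    rw [hun] at h
    refine ⟨fun v hv hvs => ?_, fun v hv hvt => ?_⟩
    · obtain ⟨e, he, h'⟩ := h.down v hv hvs
      exact ⟨e, (MGraph.mem_inside.1 he).1, h'⟩
    · obtain ⟨e, he, h'⟩ := h.up v hv hvt
      exact ⟨e, (MGraph.mem_inside.1 he).1, h'⟩
  obtain ⟨v, hv⟩ := (hcirc ⟨0, hk⟩).nonempty
  have hne : M.V.Nonempty := ⟨v, mem_V_toMGraph.2 ((hcirc ⟨0, hk⟩).1 hv)⟩
  -- Otherwise even the lowest vertex would need a lower neighbour; dually for t.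
  have hs : s ∈ V(G) := by
    by_contra hs
    obtain ⟨m, hm, hmin⟩ := M.V.exists_min_image pos hne
    obtain ⟨e, -, -, u, hu, -, hl⟩ := hpre.down m hm
      fun h' => hs (h' ▸ mem_V_toMGraph.1 hm)
    exact absurd hl (hmin u hu).not_gt
  have ht : t ∈ V(G) := by
    by_contra ht
    obtain ⟨m, hm, hmax⟩ := M.V.exists_max_image pos hne
    obtain ⟨e, -, -, u, hu, -, hl⟩ := hpre.up m hm
      fun h' => ht (h' ▸ mem_V_toMGraph.1 hm)
    exact absurd hl (hmax u hu).not_gt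
  exact isGood_of_preGood hs ht hpre

end Graph

theorem mainTheorem6 {α β : Type*} (G : Graph α β) (hfin : V(G).Finite) (hG : G.IsTwoTGraph) :
    (G.IsGood → G.IsLinear) ∧
    (∀ K : Set α, K.Nontrivial → (∀ K' : Set α, G.IsGenericComponent K' ↔ K' = K) →
      (G.IsGood ↔ G.IsHyperpath K) ∧ (G.IsGood ↔ G.IsLinear)) := by
  refine ⟨fun h => h.isLinear hG hfin, fun K hK huniq => ?_⟩
  have hcomp : G.IsGenericComponent K := (huniq K).2 rfl
  -- A vertex in no circuit would be a trivial component, different from K. Hence K contains all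
  -- vertices and an ordering of K orders G.
  have hcover : ∀ v ∈ V(G), ∃ X, G.IsCircuitOf X ∧ v ∈ X := by
    intro v hv
    by_contra! hcon
    have := (huniq {v}).1 (Or.inl ⟨v, hv, hcon, rfl⟩)
    rw [← this] at hK
    exact Set.not_nontrivial_singleton hK
  have hVK : V(G) ⊆ K := by
    intro v hv
    obtain ⟨X, hX, hvX⟩ := hcover v hv
    rw [← (huniq _).1 (Graph.isGenericComponent_of_isCircuitOf hX)]
    exact ⟨X, ⟨hX, .refl⟩, hvX⟩
  have hback : G.IsHyperpath K → G.IsGood := fun h => h.isGood hG hfin hVK hcover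
  exact ⟨⟨fun h => h.isLinear hG hfin K hcomp hK, hback⟩,
    ⟨fun h => h.isLinear hG hfin, fun h => hback (h K hcomp hK)⟩⟩
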